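/- **Model.** Let $K\ge 1$, $L\ge 0$ be integers. There are $K$ open-access tiers $k=1,\dots,K$ and $L$ closed-access tiers $l=1,\dots,L$ of base stations (BSs). The BSs of open-access tier $k$ (closed-access tier $l$) form a homogeneous Poisson point process in $\mathbb R^2$ of density $\lambda_k>0$ ($\lambda_{cl}>0$), with transmit power $P_k>0$ ($P_{cl}>0$) and path-loss exponent $\varepsilon_k>2$ ($\varepsilon_{cl}>2$). The mobile station is at the origin; $R_{kn}$ ($R_{cln}$) is the distance of the $n$-th nearest BS of the tier, $n\ge 1$, and $\Psi_{kn}$ ($\Psi_{cln}$) is its fading gain. Within a tier the fading gains are i.i.d. with the law of an almost surely positive random variable $\Psi_k$ ($\Psi_{cl}$), otherwise arbitrary, with $\mathbb E[\Psi_k^{2/\varepsilon_k}]<\infty$ ($\mathbb E[\Psi_{cl}^{2/\varepsilon_{cl}}]<\infty$). All point processes and all fading gains are independent. Let $\eta\ge 0$ be the noise power, $\beta_k>0$ the SINR thresholds, $\gamma_k=1+1/\beta_k$, $\kappa=\max_i\gamma_i$. Put $$I_o=\sum_{k=1}^K\sum_{n\ge1}P_k\Psi_{kn}R_{kn}^{-\varepsilon_k},\quad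 I_c=\sum_{l=1}^L\sum_{n\ge1}P_{cl}\Psi_{cln}R_{cln}^{-\varepsilon_{cl}},\quad I=I_o+I_c+\eta,$$ $$\mathrm{SINR}_{kn}=\frac{P_k\Psi_{kn}R_{kn}^{-\varepsilon_k}}{I-P_k\Psi_{kn}R_{kn}^{-\varepsilon_k}},\quad M_k=\sup_n P_k\Psi_{kn}R_{kn}^{-\varepsilon_k},\quad N_k=P_k\Psi_{k1}R_{k1}^{-\varepsilon_k},$$ $$\mathbb P^{\text{max-SINR}}=\mathbb P\Big(\bigcup_{k}\bigcup_{n\ge1}\{\mathrm{SINR}_{kn}>\beta_k\}\Big),\qquad \mathbb P^{\text{nearest}}=\mathbb P\Big(\bigcup_k\{\mathrm{SINR}_{k1}>\beta_k\}\Big),$$ $$\mathcal L^M(s,u)=\mathbb E\big[e^{-sI}\mathbf 1(\max_k\gamma_kM_k\le u)\big],\qquad \mathcal L^N(s,u)=\mathbb E\big[e^{-sI}\mathbf 1(\max_k\gamma_kN_k\le u)\big].$$ Write $j=\sqrt{-1}$, let complex powers be principal, and let $\Gamma(a,z)=\int_z^\infty t^{a-1}e^{-t}\,dt$ be the upper incomplete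 Gamma function (integral along the ray from $z$ in the direction of $z$). **Theorem.** Almost surely the series of received powers of every tier converges, and the following hold. (1) Max-SINR connectivity: $$\mathbb P^{\text{max-SINR}}=\sum_{i=1}^K\lambda_i\frac{2\pi}{\varepsilon_i}(\gamma_iP_i)^{2/\varepsilon_i}\,\mathbb E\big[\Psi_i^{2/\varepsilon_i}\big]\int_0^\infty\!\int_{-\infty}^\infty \mathcal L^M(j\omega,y)\,\frac{e^{j\omega y(1-\gamma_i^{-1})}-e^{j\omega(\eta+y(\kappa^{-1}-\gamma_i^{-1}))}}{2\pi j\omega\, y^{1+2/\varepsilon_i}}\,d\omega\,dy .$$ For every $i$ and $y>0$ the inner integral converges absolutely, and its value is an absolutely integrable function of $y\in(0,\infty)$. For $s=j\omega$, $\omega\in\mathbb{R}\setminus\{0\}$, and $u>0$, $$\mathcal L^M(s,u)=\mathcal L_{I_c}(s)\exp\Big(-s\eta-\sum_{k=1}^K\lambda_k\pi(sP_k)^{2/\varepsilon_k}\mathbb E\big[\Psi_k^{2/\varepsilon_k}\big]\Big[\Gamma\big(1-\tfrac2{\varepsilon_k}\big)+\tfrac2{\varepsilon_k}\Gamma\big(-\tfrac2{\varepsilon_k},\tfrac{su}{\gamma_k}\big)\Big]\Big),$$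 where $\mathcal L_{I_c}(s)=\exp\big(-\sum_{l=1}^L\lambda_{cl}\pi(sP_{cl})^{2/\varepsilon_{cl}}\mathbb E[\Psi_{cl}^{2/\varepsilon_{cl}}]\Gamma(1-\tfrac2{\varepsilon_{cl}})\big)$. (2) Nearest-BS connectivity: $$\mathbb P^{\text{nearest}}=\int_0^\infty\!\int_{-\infty}^\infty\frac{\partial}{\partial u}\mathcal L^N(j\omega,u)\Big|_{u=y}\,\frac{e^{j\omega y}-e^{j\omega(y/\kappa+\eta)}}{2\pi j\omega}\,d\omega\,dy .$$ For every $y>0$ the inner integral converges absolutely, and its value is an absolutely integrable function of $y\in(0,\infty)$. For $s=j\omega$, $\omega\in\mathbb{R}\setminus\{0\}$, and $u>0$, put $c_k=\lambda_k\frac{2\pi}{\varepsilon_k}(sP_k)^{2/\varepsilon_k}$, $G_k(x)=\mathbb E\big[\Psi_k^{2/\varepsilon_k}\Gamma(-\tfrac2{\varepsilon_k},x\Psi_k)\big]$, let $\Psi_{k1}$ have the law of $\Psi_k$, and let $$F_k(s,u)=\mathbb E_{\Psi_{k1}}\Big[\int_0^{su/(\gamma_k\Psi_{k1})}c_k\,x^{-\frac2{\varepsilon_k}-1}e^{-\Psi_{k1}x-c_kG_k(x)}\,dx\Big]\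 (\text{integral along the straight segment}),$$ $$A(s)=\mathcal L_{I_c}(s)\,e^{-s\eta-\sum_{k=1}^K\lambda_k\pi(sP_k)^{2/\varepsilon_k}\mathbb E[\Psi_k^{2/\varepsilon_k}]\Gamma(1-2/\varepsilon_k)},\qquad E_k(s,u)=\mathbb E_{\Psi_{k1}}\Big[\Psi_{k1}^{2/\varepsilon_k}e^{-c_kG_k(su/(\gamma_k\Psi_{k1}))}\Big],$$ $$n_k(s,u)=\frac{E_k(s,u)}{u\,e^{su/\gamma_k}},\qquad d_k(s,u)=\int_0^1\frac{E_k(s,ux)}{x^{2/\varepsilon_k+1}e^{sux/\gamma_k}}\,dx .$$ Then $\mathcal L^N(s,u)=A(s)\prod_{k=1}^KF_k(s,u)$; the function $\mathcal L^N(s,\cdot)$ is differentiable at $u$ with $$\frac{\partial}{\partial u}\mathcal L^N(s,u)=A(s)\sum_{k=1}^Kc_k\Big(\frac{su}{\gamma_k}\Big)^{-2/\varepsilon_k}n_k(s,u)\prod_{l\ne k}F_l(s,u);$$ and, whenever $\mathcal L^N(s,u)\ne0$, $$\frac{\frac{\partial}{\partial u}\mathcal L^N(s,u)}{\mathcal L^N(s,u)}=\sum_{k=1}^K\frac{n_k(s,u)}{d_k(s,u)}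 .$$ -/

import Mathlib

open MeasureTheory ProbabilityTheory
open scoped ENNReal

noncomputable section

namespace HetNet

/-- The plane in which base stations (BSs) are located; the mobile station is at the origin. -/
abbrev Plane : Type := EuclideanSpace ℝ (Fin 2)

/-- Number of points of the random sequence `X` that fall in the set `B`. -/
def count {Ω E : Type*} (X : ℕ → Ω → E) (B : Set E) (ω : Ω) : ℕ∞ :=
  {n | X n ω ∈ B}.encard

/-- The random points `X 0, X 1, …` form a Poisson point process with intensity measure `Λ`:
the number of points in a measurable set `B` of finite intensity is Poisson with mean `Λ B`, and
the numbers of points in finitely many disjoint such sets are independent. -/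
structure IsPoissonProcess {Ω E : Type*} [MeasurableSpace Ω] [MeasurableSpace E]
    (X : ℕ → Ω → E) (Λ : Measure E) (μ : Measure Ω) : Prop where
  measurable : ∀ n, Measurable (X n)
  count_law : ∀ B : Set E, MeasurableSet B → Λ B ≠ ∞ → ∀ k : ℕ,
    μ {ω | count X B ω = (k : ℕ∞)} = poissonMeasure (Λ B).toNNReal {k}
  count_indep : ∀ (m : ℕ) (B : Fin m → Set E), (∀ i, MeasurableSet (B i)) →
    (∀ i, Λ (B i) ≠ ∞) → Pairwise (fun i j => Disjoint (B i) (B j)) →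
    iIndepFun (fun i => count X (B i)) μ

/-- Index set of the tiers: `Sum.inl k` is the `k`-th open-access tier, `Sum.inr l` is the `l`-th
closed-access tier. -/
abbrev Tier (K L : ℕ) : Type := Fin K ⊕ Fin L

/-- Deterministic parameters of a network with `K` open-access and `L` closed-access tiers. -/
structure Params (K L : ℕ) where
  /-- BS densities -/
  dens : Tier K L → ℝ
  /-- transmit powers -/
  pow : Tier K L → ℝ
  /-- path-loss exponents -/
  ple : Tier K L → ℝ
  /-- distributions of the fading gains -/
  fading : Tier K L → Measure ℝ
  /-- SINR thresholds of the open-access tiers -/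
  thr : Fin K → ℝ
  /-- background noise power -/
  noise : ℝ

variable {K L : ℕ}

namespace Params

variable (p : Params K L)

/-- The exponent `2 / ε` of a tier. -/
def expo (t : Tier K L) : ℝ := 2 / p.ple t

/-- The fractional moment `E[Ψ ^ (2 / ε)]` of the fading gain of a tier. -/
def moment (t : Tier K L) : ℝ := ∫ x, x ^ p.expo t ∂(p.fading t)

/-- Admissible parameters: positive densities, powers and thresholds, nonnegative noise, path-loss
exponents larger than two, positive fading gains of arbitrary distribution with finite moment of
order `2 / ε`. -/
structure Admissible : Prop where
  dens_pos : ∀ t, 0 < p.dens t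
  pow_pos : ∀ t, 0 < p.pow t
  ple_gt_two : ∀ t, 2 < p.ple t
  fading_prob : ∀ t, IsProbabilityMeasure (p.fading t)
  fading_pos : ∀ t, ∀ᵐ x ∂(p.fading t), 0 < x
  fading_moment : ∀ t, Integrable (fun x : ℝ => x ^ p.expo t) (p.fading t)
  thr_pos : ∀ k, 0 < p.thr k
  noise_nonneg : 0 ≤ p.noise

/-- `γ_k = 1 + 1 / β_k` -/
def gam (k : Fin K) : ℝ := 1 + 1 / p.thr k

/-- `κ = max_k γ_k` -/
def kap : ℝ := ⨆ k, p.gam k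

end Params

/-- The random network: `X t n` is the location of the `n`-th nearest BS of tier `t` (counted from
`n = 0`) and `Ψ t n` is its fading gain. The BSs of each tier form a homogeneous Poisson point
process in the plane, the fading gains within a tier are i.i.d., and the tiers, their layouts and
their fading gains are all independent. -/
structure IsNetwork {Ω : Type*} [MeasurableSpace Ω] (p : Params K L) (μ : Measure Ω)
    (X : Tier K L → ℕ → Ω → Plane) (Ψ : Tier K L → ℕ → Ω → ℝ) : Prop where
  poisson : ∀ t, IsPoissonProcess (X t) (ENNReal.ofReal (p.dens t) • (volume : Measure Plane)) μ
  ordered : ∀ t, ∀ᵐ ω ∂μ, Monotone (fun n => ‖X t n ω‖)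
  fading_measurable : ∀ t n, Measurable (Ψ t n)
  fading_law : ∀ t n, μ.map (Ψ t n) = p.fading t
  layout_indep : iIndepFun (fun t ω n => X t n ω) μ
  fading_indep : iIndepFun (fun (i : Tier K L × ℕ) => Ψ i.1 i.2) μ
  layout_fading_indep : IndepFun (fun ω t n => X t n ω) (fun ω t n => Ψ t n ω) μ

section Radio

variable {Ω : Type*} (p : Params K L)
  (X : Tier K L → ℕ → Ω → Plane) (Ψ : Tier K L → ℕ → Ω → ℝ)

/-- Received power `P Ψ R ^ (-ε)` from the `n`-th nearest BS of tier `t`. -/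
def rx (t : Tier K L) (n : ℕ) (ω : Ω) : ℝ :=
  p.pow t * Ψ t n ω * ‖X t n ω‖ ^ (-p.ple t)

/-- `I_o`, the total received power from the open-access tiers. -/
def openPower (ω : Ω) : ℝ := ∑ k : Fin K, ∑' n, rx p X Ψ (Sum.inl k) n ω

/-- `I_c`, the total received power from the closed-access tiers. -/
def closedPower (ω : Ω) : ℝ := ∑ l : Fin L, ∑' n, rx p X Ψ (Sum.inr l) n ω

/-- `I_o + I_c + η` -/
def total (ω : Ω) : ℝ := openPower p X Ψ ω + closedPower p X Ψ ω + p.noise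

/-- SINR from the `n`-th nearest BS of the `k`-th open-access tier. -/
def sinr (k : Fin K) (n : ℕ) (ω : Ω) : ℝ :=
  rx p X Ψ (Sum.inl k) n ω /
    (openPower p X Ψ ω - rx p X Ψ (Sum.inl k) n ω + closedPower p X Ψ ω + p.noise)

/-- `max_k γ_k M_k`, where `M_k` is the largest received power from the `k`-th open-access tier. -/
def maxBest (ω : Ω) : ℝ := ⨆ k : Fin K, p.gam k * ⨆ n : ℕ, rx p X Ψ (Sum.inl k) n ω

/-- `max_k γ_k N_k`, where `N_k` is the received power from the nearest BS of the `k`-th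
open-access tier. -/
def maxNearest (ω : Ω) : ℝ := ⨆ k : Fin K, p.gam k * rx p X Ψ (Sum.inl k) 0 ω

variable [MeasurableSpace Ω] (μ : Measure Ω)

/-- Coverage probability under max-SINR connectivity. -/
def coverageMaxSINR : ℝ := μ.real {ω | ∃ k n, p.thr k < sinr p X Ψ k n ω}

/-- Coverage probability under nearest-BS connectivity. -/
def coverageNearest : ℝ := μ.real {ω | ∃ k, p.thr k < sinr p X Ψ k 0 ω}

/-- The joint Laplace transform `E[exp(-s (I_o + I_c + η)) 1(Y ≤ u)]`. -/
def jointLT (Y : Ω → ℝ) (s : ℂ) (u : ℝ) : ℂ :=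
  ∫ ω, {ω' | Y ω' ≤ u}.indicator (fun ω' => Complex.exp (-s * (total p X Ψ ω' : ℂ))) ω ∂μ

end Radio

/-- The upper incomplete Gamma function `Γ(a, z)`, the integral of `t ^ (a - 1) exp(-t)` along the
ray `t = r z`, `1 < r`. The integral converges absolutely if `Re z > 0`, and also if `z ≠ 0`,
`Re z = 0` and `Re a < 0`. -/
def incGamma (a z : ℂ) : ℂ :=
  ∫ r in Set.Ioi (1 : ℝ), ((r : ℂ) * z) ^ (a - 1) * Complex.exp (-((r : ℂ) * z)) * z

section ClosedForm

variable (p : Params K L) (s : ℂ)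

/-- `∑_l λ_{cl} π (s P_{cl})^{2/ε_{cl}} E[Ψ_{cl}^{2/ε_{cl}}] Γ(1 - 2/ε_{cl})`, the negative logarithm
of the Laplace transform of `I_c`. -/
def closedExponent : ℂ :=
  ∑ l : Fin L, (p.dens (Sum.inr l) * Real.pi : ℂ) *
    (s * p.pow (Sum.inr l)) ^ (p.expo (Sum.inr l) : ℂ) * p.moment (Sum.inr l) *
    Real.Gamma (1 - p.expo (Sum.inr l))

/-- Explicit joint Laplace transform for max-SINR connectivity. -/
def explicitMax (u : ℝ) : ℂ :=
  Complex.exp (-closedExponent p s) *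
  Complex.exp (-s * p.noise - ∑ k : Fin K, (p.dens (Sum.inl k) * Real.pi : ℂ) *
    (s * p.pow (Sum.inl k)) ^ (p.expo (Sum.inl k) : ℂ) * p.moment (Sum.inl k) *
    (Real.Gamma (1 - p.expo (Sum.inl k)) +
      p.expo (Sum.inl k) * incGamma (-(p.expo (Sum.inl k) : ℂ)) (s * u / p.gam k)))

/-- The factor common to all terms of the explicit joint Laplace transform for nearest-BS
connectivity. -/
def nearestPrefactor : ℂ :=
  Complex.exp (-closedExponent p s) *
  Complex.exp (-s * p.noise - ∑ k : Fin K, (p.dens (Sum.inl k) * Real.pi : ℂ) *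
    (s * p.pow (Sum.inl k)) ^ (p.expo (Sum.inl k) : ℂ) * p.moment (Sum.inl k) *
    Real.Gamma (1 - p.expo (Sum.inl k)))

/-- `λ_k (2π / ε_k) (s P_k)^{2/ε_k}` -/
def tierConst (k : Fin K) : ℂ :=
  (p.dens (Sum.inl k) * (2 * Real.pi / p.ple (Sum.inl k)) : ℂ) *
    (s * p.pow (Sum.inl k)) ^ (p.expo (Sum.inl k) : ℂ)

/-- `E[Ψ_k^{2/ε_k} Γ(-2/ε_k, x Ψ_k)]` -/
def fadGamma (k : Fin K) (x : ℂ) : ℂ :=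
  ∫ ψ, ((ψ ^ p.expo (Sum.inl k) : ℝ) : ℂ) * incGamma (-(p.expo (Sum.inl k) : ℂ)) (x * ψ)
    ∂(p.fading (Sum.inl k))

/-- Integrand of the factor of the `k`-th tier in the joint Laplace transform for nearest-BS
connectivity, for a nearest BS with fading gain `ψ`. -/
def nearestIntegrand (k : Fin K) (ψ : ℝ) (x : ℂ) : ℂ :=
  tierConst p s k * x ^ (-(p.expo (Sum.inl k) : ℂ) - 1) *
    Complex.exp (-ψ * x - tierConst p s k * fadGamma p k x)

/-- The factor of the `k`-th tier,
`E_ψ[∫_{x = 0}^{s u / (γ_k ψ)} nearestIntegrand ψ x dx]`; the contour of the inner integral is the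
straight segment `x = v z`, `0 ≤ v ≤ 1`, with end point `z = s u / (γ_k ψ)`. -/
def nearestFactor (k : Fin K) (u : ℝ) : ℂ :=
  ∫ ψ, (∫ v in (0 : ℝ)..1,
      nearestIntegrand p s k ψ ((v : ℂ) * (s * u / (p.gam k * ψ))) * (s * u / (p.gam k * ψ)))
    ∂(p.fading (Sum.inl k))

/-- Explicit joint Laplace transform for nearest-BS connectivity. -/
def explicitNearest (u : ℝ) : ℂ :=
  nearestPrefactor p s * ∏ k : Fin K, nearestFactor p s k u

/-- `E_ψ[ψ^{2/ε_k} exp(-λ_k (2π/ε_k) (s P_k)^{2/ε_k} E[Ψ_k^{2/ε_k} Γ(-2/ε_k, s u Ψ_k / (γ_k ψ))])]` -/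
def nearestMean (k : Fin K) (u : ℝ) : ℂ :=
  ∫ ψ, ((ψ ^ p.expo (Sum.inl k) : ℝ) : ℂ) *
      Complex.exp (-tierConst p s k * fadGamma p k (s * u / (p.gam k * ψ)))
    ∂(p.fading (Sum.inl k))

/-- Numerator of the `k`-th term of the logarithmic `u`-derivative for nearest-BS connectivity. -/
def nearestNum (k : Fin K) (u : ℝ) : ℂ :=
  nearestMean p s k u / (u * Complex.exp (s * u / p.gam k))

/-- Denominator of the `k`-th term of the logarithmic `u`-derivative for nearest-BS
connectivity. -/
def nearestDen (k : Fin K) (u : ℝ) : ℂ :=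
  ∫ x in (0 : ℝ)..1, nearestMean p s k (u * x) /
    (((x ^ (p.expo (Sum.inl k) + 1) : ℝ) : ℂ) * Complex.exp (s * u * x / p.gam k))

/-- The `u`-derivative of the factor `nearestFactor` in explicit form. -/
def nearestFactorDeriv (k : Fin K) (u : ℝ) : ℂ :=
  tierConst p s k * (s * u / p.gam k) ^ (-(p.expo (Sum.inl k) : ℂ)) * nearestNum p s k u

/-- The explicit `u`-derivative of the joint Laplace transform for nearest-BS connectivity. -/
def explicitNearestDeriv (u : ℝ) : ℂ :=
  nearestPrefactor p s * ∑ k : Fin K,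
    nearestFactorDeriv p s k u * ∏ l ∈ Finset.univ.erase k, nearestFactor p s l u

end ClosedForm

section CoverageIntegrands

variable {Ω : Type*} [MeasurableSpace Ω] (p : Params K L) (μ : Measure Ω)
  (X : Tier K L → ℕ → Ω → Plane) (Ψ : Tier K L → ℕ → Ω → ℝ)

/-- Integrand (in the Fourier variable `w` and in `y`) of the `i`-th term of the max-SINR coverage
probability. -/
def maxIntegrand (i : Fin K) (y w : ℝ) : ℂ :=
  jointLT p X Ψ μ (maxBest p X Ψ) (Complex.I * w) y *
    ((Complex.exp (Complex.I * w * (y * (1 - (p.gam i)⁻¹) : ℝ)) -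
        Complex.exp (Complex.I * w * (p.noise + y * (p.kap⁻¹ - (p.gam i)⁻¹) : ℝ))) /
      (2 * Real.pi * Complex.I * w * ((y ^ (1 + p.expo (Sum.inl i)) : ℝ) : ℂ)))

/-- Integrand (in the Fourier variable `w` and in `y`) of the nearest-BS coverage probability. -/
def nearestCovIntegrand (y w : ℝ) : ℂ :=
  deriv (fun u : ℝ => jointLT p X Ψ μ (maxNearest p X Ψ) (Complex.I * w) u) y *
    ((Complex.exp (Complex.I * w * (y : ℝ)) -
        Complex.exp (Complex.I * w * (y / p.kap + p.noise : ℝ))) /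
      (Complex.I * w * (2 * Real.pi)))

end CoverageIntegrands

end HetNet

end

section

open Filter Topology Set
open scoped NNReal

namespace HetNet

/-! ### Unit rate Poisson processes and their probability generating functional. -/

section

variable {Ω : Type*} [MeasurableSpace Ω] {μ : Measure Ω}

/-! In the variable λπ‖x‖² the BSs of a tier become a unit rate Poisson process on the half-line. A
BS with arrival time s and fading gain ψ is received with power ψ (c/s)^(1/a), where a = 2/ε lies in
(0, 1) and c = λπP^a. Every transform of the network is therefore an expectation of products over
independent marked one-dimensional Poisson processes.

Two facts compute such expectations: the probability generating functional E ∏ g(T_n) = exp(-∫(1 -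
g)) (`IsUnitPoisson.integral_finprod`), and, when the nearest BS carries a factor of its own, the
fact that beyond the first point the process is again Poisson
(`IsUnitPoisson.integral_zero_mul_finprod`). Together with the averaging over fading gains and the
independence of tiers they give `IsNetwork.integral_prod_eq`. Campbell's formula turns the exponents
into integrals against a x^(-a-1) dx, and the integral of 1 - exp(-iwx) against this measure is
(iw)^a Γ(1 - a). Bounding all received powers of a tier by v removes the contribution exp(-iwx) of x
> v, which adds an incomplete Gamma term to the exponent. Bounding only the nearest power by v leads
to the integral of `StableTier.kernel` over (0, v). Applied to exp(-θx) with θ → 0, the same product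
formula shows that the received powers are summable.

Pathwise, an SINR exceeds its threshold exactly if the total power I is less than γ times the
received power. Both coverage probabilities are thus P(I < Y), with Y the largest of the γ_k M_k or
of the γ_k N_k. A single received power is strictly smaller than the sum of its tier, whence Y/κ + η
< I almost surely. For w ≠ 0 the transform E[exp(-iwI); Y ≤ u] is the integral over (0, u) of an
explicit density D(w, y), so integrating D against the Fourier kernel of the interval from y/κ + η
to y should give P(I < Y). The finite lower endpoint keeps this kernel bounded near w = 0.

The inversion is `measureReal_lt_eq_integral`: damping by exp(-ε|w|) turns the kernel into a
difference of arctangents, which tends to the indicator of I < Y. The event I = Y is null because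
the transform of Y - I is integrable. Absolute convergence rests on `SpectralDensity`: |D(w, y)| is
at most exp(-c'|w|^α) g(y), where g is integrable against a small power of y. Since the method
yields no first moment of g, the kernel is estimated by an interpolation, |w|^(δ-1) (1 + y^δ) up to
a constant, with a small exponent δ. The decay in w comes from the stable exponent, whose real part
is a positive multiple of |w|^a. -/

/-- The random times `T 0 ≤ T 1 ≤ …` are the points of a unit rate Poisson process on the positive
half-line. -/
structure IsUnitPoisson (T : ℕ → Ω → ℝ) (μ : Measure Ω) : Prop where
  measurable : ∀ n, Measurable (T n)
  pos : ∀ᵐ ω ∂μ, ∀ n, 0 < T n ω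
  mono : ∀ᵐ ω ∂μ, Monotone (fun n => T n ω)
  count_law : ∀ a b : ℝ, 0 ≤ a → a ≤ b → ∀ k : ℕ,
    μ {ω | count T (Ioc a b) ω = (k : ℕ∞)} = poissonMeasure (b - a).toNNReal {k}
  count_indep : ∀ (m : ℕ) (δ : ℝ), 0 < δ →
    iIndepFun (fun i : Fin m => count T (Ioc ((i : ℝ) * δ) (((i : ℝ) + 1) * δ))) μ

lemma measurable_count {E : Type*} [MeasurableSpace E] {T : ℕ → Ω → E}
    (hT : ∀ n, Measurable (T n)) {B : Set E} (hB : MeasurableSet B) : Measurable (count T B) := by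
  unfold count
  refine measurable_encard.comp (measurable_set_iff.2 fun n => ?_)
  exact measurableSet_setOfPred.1 (hT n hB)

/-- Only finite values are prescribed; the mass at `⊤` is the complement of their total, so it
agrees as well. -/
lemma map_count_eq_poisson [IsProbabilityMeasure μ] {N : Ω → ℕ∞} (hN : Measurable N) {r : ℝ≥0}
    (h : ∀ k : ℕ, μ {ω | N ω = (k : ℕ∞)} = poissonMeasure r {k}) :
    μ.map N = (poissonMeasure r).map (Nat.cast : ℕ → ℕ∞) := by
  have hfin : ∀ k : ℕ, μ.map N {(k : ℕ∞)} = (poissonMeasure r).map (Nat.cast : ℕ → ℕ∞)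
      {(k : ℕ∞)} := by
    intro k
    have h1 : (Nat.cast : ℕ → ℕ∞) ⁻¹' {(k : ℕ∞)} = {k} := by ext n; simp
    rw [Measure.map_apply hN (measurableSet_singleton _),
      Measure.map_apply .of_discrete (measurableSet_singleton _), h1]
    exact h k
  have := Measure.isProbabilityMeasure_map (μ := μ) hN.aemeasurable
  have htop : ∀ ν : Measure ℕ∞, IsProbabilityMeasure ν → ν {⊤} = 1 - ∑' k : ℕ, ν {(k : ℕ∞)} := by
    intro ν _
    have h1 : ν (⋃ k : ℕ, {(k : ℕ∞)}) = ∑' k : ℕ, ν {(k : ℕ∞)} := by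
      refine measure_iUnion (fun i j hij => ?_) (fun _ => measurableSet_singleton _)
      simpa using fun h => hij h
    have h2 : (⋃ k : ℕ, {(k : ℕ∞)})ᶜ = ({⊤} : Set ℕ∞) := by
      ext x
      induction x using ENat.recTopCoe <;> simp
    rw [← h2, prob_compl_eq_one_sub (.of_discrete), h1]
  refine Measure.ext_of_singleton fun x => ?_
  induction x using ENat.recTopCoe with
  | top => rw [htop _ inferInstance, htop _ inferInstance]; simp_rw [hfin]
  | coe k => exact hfin k

lemma integral_pow_poisson (r : ℝ≥0) (z : ℂ) :
    ∫ k, z ^ k.toNat ∂((poissonMeasure r).map (Nat.cast : ℕ → ℕ∞)) =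
      Complex.exp (-(r : ℂ) * (1 - z)) := by
  rw [integral_map .of_discrete .of_discrete, integral_poissonMeasure]
  have h := NormedSpace.expSeries_div_hasSum_exp ((r : ℂ) * z)
  rw [← Complex.exp_eq_exp_ℂ] at h
  have h2 := (h.mul_left (Complex.exp (-r))).tsum_eq
  rw [← Complex.exp_add] at h2
  rw [show -(r : ℂ) * (1 - z) = -r + r * z by ring, ← h2]
  congr 1; ext n
  simp [mul_pow]
  ring

namespace IsUnitPoisson

variable {T : ℕ → Ω → ℝ}

/-- A Poisson count is almost surely finite, and integer levels suffice. Positivity of the points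
lets the intervals start at 0. -/
lemma ae_finite [IsProbabilityMeasure μ] (hT : IsUnitPoisson T μ) :
    ∀ᵐ ω ∂μ, ∀ B : ℝ, {n | T n ω ≤ B}.Finite := by
  have h : ∀ᵐ ω ∂μ, ∀ B : ℕ, count T (Ioc 0 (B : ℝ)) ω ≠ ⊤ := by
    refine ae_all_iff.2 fun B => ?_
    have hm := measurable_count hT.measurable (measurableSet_Ioc (a := 0) (b := (B : ℝ)))
    have h1 := map_count_eq_poisson hm (hT.count_law 0 B le_rfl (by positivity))
    have h2 : (μ.map (count T (Ioc 0 (B : ℝ)))) {⊤} = 0 := by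
      rw [h1, Measure.map_apply .of_discrete (measurableSet_singleton _)]
      have : (Nat.cast : ℕ → ℕ∞) ⁻¹' {⊤} = ∅ := by ext; simp
      simp [this]
    rw [Measure.map_apply hm (measurableSet_singleton _)] at h2
    exact measure_eq_zero_iff_ae_notMem.1 h2
  filter_upwards [h, hT.pos] with ω h hpos B
  obtain ⟨m, hm⟩ := exists_nat_ge B
  have := h m
  rw [count, Set.encard_ne_top_iff] at this
  exact this.subset fun n hn => ⟨hpos n, le_trans hn hm⟩

end IsUnitPoisson

/-- A product over the cells of a mesh. -/
lemma finprod_comp_ceil_eq_prod {τ : ℕ → ℝ} (hpos : ∀ n, 0 < τ n) {B d : ℕ} (hd : 0 < d)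
    (hfin : {n | τ n ≤ B}.Finite) {g : ℝ → ℂ} (hg : ∀ t : ℝ, B ≤ t → g t = 1) :
    ∏ᶠ n, g (⌈d * τ n⌉₊ / d) = ∏ j : Fin (d * B), g (((j : ℕ) + 1 : ℝ) / d) ^
      ({n | τ n ∈ Ioc ((j : ℝ) * (1 / d)) (((j : ℝ) + 1) * (1 / d))}.encard.toNat) := by
  have hd' : (0 : ℝ) < d := by exact_mod_cast hd
  -- Rounding up moves points to the right only, so points beyond `B` keep the factor 1.
  have hsub : Function.mulSupport (fun n => g (⌈d * τ n⌉₊ / d)) ⊆ hfin.toFinset := by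
    intro n hn
    simp only [Finite.coe_toFinset, mem_ofPred_eq]
    by_contra hcon
    push Not at hcon
    refine hn (hg _ ?_)
    rw [le_div_iff₀ hd']
    have := Nat.le_ceil (d * τ n)
    nlinarith
  rw [finprod_eq_prod_of_mulSupport_subset _ hsub]
  rw [Fin.prod_univ_eq_prod_range (fun j : ℕ => g (((j : ℕ) + 1 : ℝ) / d) ^
    ({n | τ n ∈ Ioc ((j : ℝ) * (1 / d)) (((j : ℝ) + 1) * (1 / d))}.encard.toNat)) (d * B)]
  -- A positive point has positive ceiling, so the natural subtraction in the cell index `⌈d * τ n⌉₊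
  -- - 1` is exact.
  have hcpos : ∀ n, 0 < ⌈d * τ n⌉₊ := fun n => Nat.ceil_pos.2 (mul_pos hd' (hpos n))
  rw [← Finset.prod_fiberwise_of_maps_to (s := hfin.toFinset) (t := Finset.range (d * B))
    (g := fun n => ⌈d * τ n⌉₊ - 1)]
  · refine Finset.prod_congr rfl fun j hj => ?_
    have hj' : j + 1 ≤ d * B := by simpa using hj
    have hmem : ∀ n, (⌈d * τ n⌉₊ - 1 = j ↔
        τ n ∈ Ioc ((j : ℝ) * (1 / d)) (((j : ℝ) + 1) * (1 / d))) := by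
      intro n
      have h1 : (⌈d * τ n⌉₊ - 1 = j) ↔ ⌈d * τ n⌉₊ = j + 1 := by have := hcpos n; omega
      rw [h1, Nat.ceil_eq_iff (by omega), mem_Ioc, mul_one_div, mul_one_div, div_lt_iff₀ hd',
        le_div_iff₀ hd', mul_comm (τ n)]
      simp
    have hset : {n | τ n ∈ Ioc ((j : ℝ) * (1 / d)) (((j : ℝ) + 1) * (1 / d))} =
        ((hfin.toFinset.filter fun n => ⌈d * τ n⌉₊ - 1 = j : Finset ℕ) : Set ℕ) := by
      ext n
      simp only [mem_ofPred_eq, Finset.coe_filter, Finite.mem_toFinset, hmem]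
      refine ⟨fun h => ⟨h.2.trans ?_, h⟩, fun h => h.2⟩
      rw [mul_one_div, div_le_iff₀ hd']
      calc (j : ℝ) + 1 ≤ d * B := by exact_mod_cast hj'
        _ = B * d := mul_comm _ _
    rw [hset, Set.encard_coe_eq_coe_finsetCard, ENat.toNat_natCast, ← Finset.prod_const]
    refine Finset.prod_congr rfl fun n hn => ?_
    have h1 := (Finset.mem_filter.1 hn).2
    have h2 : ⌈d * τ n⌉₊ = j + 1 := by have := hcpos n; omega
    rw [h2]; push_cast; rfl
  · intro n hn
    have h1 : τ n ≤ B := by simpa using hn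
    have h2 : ⌈d * τ n⌉₊ ≤ d * B := by
      refine Nat.ceil_le.2 ?_
      push_cast
      gcongr
    have := hcpos n
    simp only [Finset.mem_range]; omega

lemma tendsto_ceil_mul_div (t : ℝ) (ht : 0 < t) :
    Tendsto (fun m : ℕ => (⌈((m + 1 : ℕ) : ℝ) * t⌉₊ : ℝ) / ((m + 1 : ℕ) : ℝ)) atTop (𝓝[≥] t) := by
  refine tendsto_nhdsWithin_iff.2 ⟨?_, Eventually.of_forall fun m => ?_⟩
  · have h := (tendsto_nat_ceil_mul_div_atTop (R := ℝ) ht.le).comp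
      (tendsto_natCast_atTop_atTop.comp (tendsto_add_atTop_nat 1))
    simpa [Function.comp_def, mul_comm] using h
  · rw [mem_Ici, le_div_iff₀ (by positivity), mul_comm]
    exact Nat.le_ceil _

/-- No finiteness is needed: a `finprod` with infinite support is 1 by convention. -/
lemma norm_finprod_le_one {ι : Type*} {z : ι → ℂ} (h : ∀ i, ‖z i‖ ≤ 1) : ‖∏ᶠ i, z i‖ ≤ 1 := by
  refine finprod_induction (p := fun w : ℂ => ‖w‖ ≤ 1) (by simp) (fun a b ha hb => ?_) h
  rw [norm_mul]
  exact mul_le_one₀ ha (norm_nonneg _) hb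

lemma tendsto_prod_range_finprod {z : ℕ → ℂ} (h : (Function.mulSupport z).Finite) :
    Tendsto (fun N => ∏ n ∈ Finset.range N, z n) atTop (𝓝 (∏ᶠ n, z n)) := by
  obtain ⟨N, hN⟩ := h.bddAbove
  refine tendsto_const_nhds.congr' ?_
  filter_upwards [eventually_gt_atTop N] with M hM
  refine finprod_eq_prod_of_mulSupport_subset _ fun n hn => ?_
  simpa using (hN hn).trans_lt hM

lemma aestronglyMeasurable_finprod {G : ℕ → Ω → ℂ} (hG : ∀ n, Measurable (G n))
    (h : ∀ᵐ ω ∂μ, (Function.mulSupport fun n => G n ω).Finite) :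
    AEStronglyMeasurable (fun ω => ∏ᶠ n, G n ω) μ := by
  refine aestronglyMeasurable_of_tendsto_ae atTop
    (f := fun N ω => ∏ n ∈ Finset.range N, G n ω)
    (fun N => (Finset.measurable_prod _ fun n _ => hG n).aestronglyMeasurable) ?_
  filter_upwards [h] with ω hω using tendsto_prod_range_finprod hω

lemma mulSupport_finite_of_eq_one {τ : ℕ → ℝ} {B : ℝ} (hfin : {n | τ n ≤ B}.Finite) {g : ℝ → ℂ}
    (hg : ∀ t : ℝ, B ≤ t → g t = 1) : (Function.mulSupport fun n => g (τ n)).Finite := by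
  refine hfin.subset fun n hn => ?_
  by_contra h
  exact hn (hg _ (not_le.1 h).le)

lemma le_ceil_mul_div {d : ℕ} (hd : 0 < d) (t : ℝ) : t ≤ ⌈d * t⌉₊ / d := by
  rw [le_div_iff₀ (by exact_mod_cast hd), mul_comm]
  exact Nat.le_ceil _

/-- The step function of `g` on a mesh has the right Riemann sums. -/
lemma integral_comp_ceil_eq_sum {d B : ℕ} (hd : 0 < d) {g : ℝ → ℂ} (hg : ∀ t : ℝ, B ≤ t → g t = 1) :
    ∫ t in Ioi (0 : ℝ), (1 - g (⌈d * t⌉₊ / d)) =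
      ∑ j : Fin (d * B), (1 / d : ℂ) * (1 - g (((j : ℕ) + 1 : ℝ) / d)) := by
  have hd' : (0 : ℝ) < d := by exact_mod_cast hd
  rw [Fin.sum_univ_eq_sum_range (fun j : ℕ => (1 / d : ℂ) * (1 - g (((j : ℕ) + 1 : ℝ) / d)))]
  have h0 : ∫ t in Ioi (0 : ℝ), (1 - g (⌈d * t⌉₊ / d)) =
      ∫ t in Ioc (0 : ℝ) B, (1 - g (⌈d * t⌉₊ / d)) := by
    refine setIntegral_eq_of_subset_of_forall_sdiff_eq_zero measurableSet_Ioi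
      Ioc_subset_Ioi_self fun t ht => ?_
    have h1 : (B : ℝ) < t := by
      by_contra h; push Not at h; exact ht.2 (mem_Ioc.2 ⟨mem_Ioi.1 ht.1, h⟩)
    rw [hg, sub_self]
    rw [le_div_iff₀ hd']
    have := Nat.le_ceil (d * t)
    nlinarith
  have hcell : ∀ j : ℕ, EqOn (fun t : ℝ => 1 - g (⌈d * t⌉₊ / d))
      (fun _ => 1 - g (((j : ℕ) + 1 : ℝ) / d)) (Ioc ((j : ℝ) / d) (((j + 1 : ℕ) : ℝ) / d)) := by
    intro j t ht
    have : ⌈d * t⌉₊ = j + 1 := by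
      rw [Nat.ceil_eq_iff (by omega)]
      rw [mem_Ioc, div_lt_iff₀ hd', le_div_iff₀ hd', mul_comm t] at ht
      simpa using ht
    simp [this]
  have hle : ∀ j : ℕ, (j : ℝ) / d ≤ ((j + 1 : ℕ) : ℝ) / d := fun j => by gcongr; simp
  rw [h0, ← intervalIntegral.integral_of_le (by positivity)]
  have hsum := intervalIntegral.sum_integral_adjacent_intervals (μ := volume)
    (f := fun t : ℝ => 1 - g (⌈d * t⌉₊ / d)) (a := fun j : ℕ => (j : ℝ) / d) (n := d * B) ?_
  · simp only [Nat.cast_zero, zero_div, Nat.cast_mul] at hsum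
    rw [mul_div_cancel_left₀ _ hd'.ne'] at hsum
    rw [← hsum]
    refine Finset.sum_congr rfl fun j _ => ?_
    rw [intervalIntegral.integral_of_le (hle j), setIntegral_congr_fun measurableSet_Ioc (hcell j),
      setIntegral_const]
    simp only [measureReal_def, Real.volume_Ioc]
    rw [ENNReal.toReal_ofReal (by linarith [hle j])]
    rw [Complex.real_smul]
    push_cast
    congr 1
    field_simp
    ring
  · intro j _
    rw [intervalIntegrable_iff_integrableOn_Ioc_of_le (hle j)]
    exact (integrableOn_const (by simp)).congr_fun (hcell j).symm measurableSet_Ioc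

namespace IsUnitPoisson

variable {T : ℕ → Ω → ℝ}

/-- The probability generating functional on a mesh. -/
lemma integral_finprod_comp_ceil [IsProbabilityMeasure μ] (hT : IsUnitPoisson T μ) {d B : ℕ}
    (hd : 0 < d) {g : ℝ → ℂ} (hg : ∀ t : ℝ, B ≤ t → g t = 1) :
    ∫ ω, ∏ᶠ n, g (⌈d * T n ω⌉₊ / d) ∂μ =
      Complex.exp (-∫ t in Ioi (0 : ℝ), (1 - g (⌈d * t⌉₊ / d))) := by
  have hd' : (0 : ℝ) < d := by exact_mod_cast hd
  have h1 : ∫ ω, ∏ᶠ n, g (⌈d * T n ω⌉₊ / d) ∂μ =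
      ∫ ω, ∏ j : Fin (d * B), (fun k : ℕ∞ => g (((j : ℕ) + 1 : ℝ) / d) ^ k.toNat)
        -- Each cell enters through its count alone, so the cells are independent and every factor
        -- is a Poisson generating function.
        (count T (Ioc ((j : ℝ) * (1 / d)) (((j : ℝ) + 1) * (1 / d))) ω) ∂μ := by
    refine integral_congr_ae ?_
    filter_upwards [hT.pos, hT.ae_finite] with ω hpos hfin
    exact finprod_comp_ceil_eq_prod hpos hd (hfin B) hg
  have hm : ∀ j : Fin (d * B),
      Measurable (count T (Ioc ((j : ℝ) * (1 / d)) (((j : ℝ) + 1) * (1 / d)))) :=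
    fun j => measurable_count hT.measurable measurableSet_Ioc
  rw [h1, iIndepFun.integral_fun_prod_comp
    (f := fun j : Fin (d * B) => fun k : ℕ∞ => g (((j : ℕ) + 1 : ℝ) / d) ^ k.toNat)
    (hT.count_indep (d * B) (1 / d) (by positivity))
    (fun j => (hm j).aemeasurable) (fun j => .of_discrete), integral_comp_ceil_eq_sum hd hg,
    ← Finset.sum_neg_distrib, Complex.exp_sum]
  refine Finset.prod_congr rfl fun j _ => ?_
  have hl : ((j : ℝ)) * (1 / d) ≤ ((j : ℝ) + 1) * (1 / d) := by gcongr; linarith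
  have h2 := map_count_eq_poisson (hm j) (hT.count_law _ _ (by positivity) hl)
  rw [← integral_map (φ := count T (Ioc ((j : ℝ) * (1 / d)) (((j : ℝ) + 1) * (1 / d))))
    (f := fun k : ℕ∞ => g (((j : ℕ) + 1 : ℝ) / d) ^ k.toNat) (hm j).aemeasurable .of_discrete, h2,
    integral_pow_poisson]
  congr 1
  have h3 : (((((j : ℝ) + 1) * (1 / d) - (j : ℝ) * (1 / d)).toNNReal : ℝ) : ℂ) = 1 / d := by
    rw [Real.coe_toNNReal _ (by linarith)]
    push_cast; ring
  rw [h3]; ring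

/-- The probability generating functional of a unit rate Poisson process. -/
theorem integral_finprod [IsProbabilityMeasure μ] (hT : IsUnitPoisson T μ) {B : ℕ} {g : ℝ → ℂ}
    (hgm : Measurable g) (hg1 : ∀ t, ‖g t‖ ≤ 1)
    (hrc : ∀ t, 0 < t → ContinuousWithinAt g (Ici t) t) (hg : ∀ t : ℝ, B ≤ t → g t = 1) :
    ∫ ω, ∏ᶠ n, g (T n ω) ∂μ = Complex.exp (-∫ t in Ioi (0 : ℝ), (1 - g t)) := by
  -- The mesh points approach each point from the right, hence right-continuity is enough; almost
  -- surely only finitely many factors differ from 1.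
  have hlim : Tendsto (fun m : ℕ => ∫ ω, ∏ᶠ n, g (⌈((m + 1 : ℕ) : ℝ) *
      T n ω⌉₊ / ((m + 1 : ℕ) : ℝ)) ∂μ)
      atTop (𝓝 (∫ ω, ∏ᶠ n, g (T n ω) ∂μ)) := by
    refine tendsto_integral_of_dominated_convergence (fun _ => 1) (fun m => ?_)
      (integrable_const _) (fun m => ?_) ?_
    · refine aestronglyMeasurable_finprod (fun n => ?_) ?_
      · have := hT.measurable n
        fun_prop
      · filter_upwards [hT.ae_finite] with ω hω
        refine mulSupport_finite_of_eq_one (hω B)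
          (g := fun t => g (⌈((m + 1 : ℕ) : ℝ) * t⌉₊ / ((m + 1 : ℕ) : ℝ))) fun t ht => ?_
        exact hg _ (ht.trans (le_ceil_mul_div (Nat.succ_pos _) _))
    · exact Eventually.of_forall fun ω => norm_finprod_le_one fun n => hg1 _
    · filter_upwards [hT.pos, hT.ae_finite] with ω hpos hfin
      have hsub : ∀ q : ℝ → ℝ, (∀ t, t ≤ q t) →
          Function.mulSupport (fun n => g (q (T n ω))) ⊆ (hfin B).toFinset := by
        intro q hq n hn
        simp only [Finite.coe_toFinset, mem_ofPred_eq]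
        by_contra h
        exact hn (hg _ ((not_le.1 h).le.trans (hq _)))
      rw [finprod_eq_prod_of_mulSupport_subset _ (hsub (fun t => t) fun _ => le_rfl)]
      simp_rw [fun m : ℕ => finprod_eq_prod_of_mulSupport_subset _
        (hsub (fun t => ⌈((m + 1 : ℕ) : ℝ) * t⌉₊ / ((m + 1 : ℕ) : ℝ))
          (le_ceil_mul_div (Nat.succ_pos m)))]
      exact tendsto_finsetProd _ fun n _ => (hrc _ (hpos n)).tendsto.comp
        (tendsto_ceil_mul_div _ (hpos n))
  have hlim2 : Tendsto (fun m : ℕ =>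
      ∫ t in Ioi (0 : ℝ), (1 - g (⌈((m + 1 : ℕ) : ℝ) * t⌉₊ / ((m + 1 : ℕ) : ℝ)))) atTop
      (𝓝 (∫ t in Ioi (0 : ℝ), (1 - g t))) := by
    have hzero : ∀ q : ℝ → ℝ, (∀ t, t ≤ q t) →
        ∫ t in Ioi (0 : ℝ), (1 - g (q t)) = ∫ t in Ioc (0 : ℝ) B, (1 - g (q t)) := by
      intro q hq
      refine (setIntegral_eq_of_subset_of_forall_sdiff_eq_zero measurableSet_Ioi
        Ioc_subset_Ioi_self fun t ht => ?_)
      have h1 : (B : ℝ) < t := by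
        by_contra h; push Not at h; exact ht.2 (mem_Ioc.2 ⟨mem_Ioi.1 ht.1, h⟩)
      rw [hg _ (h1.le.trans (hq t)), sub_self]
    rw [hzero (fun t => t) fun _ => le_rfl]
    simp_rw [fun m : ℕ => hzero (fun t => ⌈((m + 1 : ℕ) : ℝ) * t⌉₊ / ((m + 1 : ℕ) : ℝ))
      (le_ceil_mul_div (Nat.succ_pos m))]
    refine tendsto_integral_of_dominated_convergence (fun _ => 2) (fun m => ?_)
      (integrable_const _) (fun m => ?_) ?_
    · exact Measurable.aestronglyMeasurable (by fun_prop)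
    · refine Eventually.of_forall fun t => (norm_sub_le _ _).trans ?_
      have := hg1 (⌈((m + 1 : ℕ) : ℝ) * t⌉₊ / ((m + 1 : ℕ) : ℝ))
      rw [norm_one]; linarith
    · refine (ae_restrict_iff' measurableSet_Ioc).2 (Eventually.of_forall fun t ht => ?_)
      exact tendsto_const_nhds.sub ((hrc _ ht.1).tendsto.comp (tendsto_ceil_mul_div _ ht.1))
  refine tendsto_nhds_unique hlim ?_
  simp_rw [hT.integral_finprod_comp_ceil (Nat.succ_pos _) hg]
  exact (Complex.continuous_exp.tendsto _).comp hlim2.neg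

end IsUnitPoisson

end

/-! ### The first point of a unit rate Poisson process. -/

section

variable {Ω : Type*} [MeasurableSpace Ω] {μ : Measure Ω}

/-- `exp (-∫_t^∞ (1 - g))`, the probability generating functional of the points beyond `t`. -/
noncomputable def tailPGF (g : ℝ → ℂ) (t : ℝ) : ℂ := Complex.exp (-∫ x in Ioi t, (1 - g x))

lemma integrableOn_one_sub_of_eq_one {g : ℝ → ℂ} {B : ℝ} (hgm : Measurable g)
    (hg1 : ∀ t, ‖g t‖ ≤ 1) (hg : ∀ t : ℝ, B ≤ t → g t = 1) (a : ℝ) :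
    IntegrableOn (fun t => 1 - g t) (Ioi a) := by
  have h : IntegrableOn (fun t => 1 - g t) (Ioc a (max a B)) := by
    refine Measure.integrableOn_of_bounded (M := 2) (by simp) (by fun_prop)
      (Eventually.of_forall fun t => ?_)
    refine (norm_sub_le _ _).trans ?_
    have := hg1 t
    rw [norm_one]; linarith
  have h2 : IntegrableOn (fun t => 1 - g t) (Ioi (max a B)) := by
    refine integrableOn_zero.congr_fun (fun t ht => ?_) measurableSet_Ioi
    rw [hg t ((le_max_right _ _).trans (le_of_lt ht)), sub_self]
  rw [← Ioc_union_Ioi_eq_Ioi (le_max_left a B)]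
  exact h.union h2

lemma continuousOn_tailPGF {g : ℝ → ℂ} (hg : IntegrableOn (fun t => 1 - g t) (Ioi 0)) :
    ContinuousOn (tailPGF g) (Ici 0) := by
  have h : ContinuousOn (fun t => ∫ x in (0 : ℝ)..t, (1 - g x)) (Ici 0) := by
    intro t ht
    have h1 := intervalIntegral.continuousOn_primitive_interval (μ := volume)
      (f := fun x => 1 - g x) (a := 0) (b := t + 1) (by
        rw [uIcc_of_le (by linarith [mem_Ici.1 ht]), integrableOn_Icc_iff_integrableOn_Ioc]
        exact hg.mono_set Ioc_subset_Ioi_self)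
    rw [uIcc_of_le (by linarith [mem_Ici.1 ht])] at h1
    refine (h1 t ⟨ht, by linarith⟩).mono_of_mem_nhdsWithin ?_
    exact mem_nhdsWithin.2 ⟨Iio (t + 1), isOpen_Iio, by simp, fun x hx => ⟨hx.2, le_of_lt hx.1⟩⟩
  have h2 : ∀ t ∈ Ici (0 : ℝ), tailPGF g t = Complex.exp (-((∫ x in Ioi 0, (1 - g x)) -
      ∫ x in (0 : ℝ)..t, (1 - g x))) := by
    intro t ht
    rw [tailPGF, intervalIntegral.integral_of_le ht, ← Ioc_union_Ioi_eq_Ioi (mem_Ici.1 ht),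
      setIntegral_union (Ioc_disjoint_Ioi le_rfl) measurableSet_Ioi
        (hg.mono_set Ioc_subset_Ioi_self) (hg.mono_set (Ioi_subset_Ioi ht))]
    congr 1; ring
  refine ContinuousOn.congr ?_ h2
  exact Complex.continuous_exp.comp_continuousOn (continuousOn_const.sub h).neg

/-- The real part of 1 - g is nonnegative on the unit disc. -/
lemma norm_tailPGF_le_one {g : ℝ → ℂ} (hg1 : ∀ t, ‖g t‖ ≤ 1) {t : ℝ}
    (hg : IntegrableOn (fun t => 1 - g t) (Ioi t)) : ‖tailPGF g t‖ ≤ 1 := by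
  rw [tailPGF, Complex.norm_exp, Real.exp_le_one_iff, Complex.neg_re, neg_nonpos]
  have h := integral_re hg
  simp only [RCLike.re_eq_complex_re] at h
  rw [← h]
  refine setIntegral_nonneg measurableSet_Ioi fun x _ => ?_
  have := (Complex.re_le_norm (g x)).trans (hg1 x)
  simpa using this

namespace IsUnitPoisson

variable {T : ℕ → Ω → ℝ}

/-- The event `a ≤ T 0` is itself a product over points: the generating functional applies to the
function that is 0 below `a`, 1 on `[a, b)` and `g` from `b` on, for which the integral of 1 - q is
a plus the tail beyond b. -/
lemma integral_indicator_le_zero_mul_finprod [IsProbabilityMeasure μ] (hT : IsUnitPoisson T μ)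
    {B : ℕ} {g : ℝ → ℂ} (hgm : Measurable g) (hg1 : ∀ t, ‖g t‖ ≤ 1)
    (hrc : ∀ t, 0 < t → ContinuousWithinAt g (Ici t) t) (hg : ∀ t : ℝ, B ≤ t → g t = 1)
    {a b : ℝ} (ha : 0 ≤ a) (hab : a ≤ b) :
    ∫ ω, (if a ≤ T 0 ω then ∏ᶠ n, (if T n ω < b then 1 else g (T n ω)) else 0) ∂μ =
      Complex.exp (-a) * tailPGF g b := by
  obtain ⟨B', hB'⟩ := exists_nat_ge (max (B : ℝ) b)
  set q : ℝ → ℂ := fun t => if t < a then 0 else if t < b then 1 else g t with hq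
  have hqB : ∀ t : ℝ, B' ≤ t → q t = 1 := by
    intro t ht
    have h1 : b ≤ t := (le_max_right _ _).trans (hB'.trans ht)
    have h2 : (B : ℝ) ≤ t := (le_max_left _ _).trans (hB'.trans ht)
    simp only [hq, if_neg (not_lt.2 (hab.trans h1)), if_neg (not_lt.2 h1), hg t h2]
  have hqm : Measurable q := Measurable.ite measurableSet_Iio measurable_const
    (Measurable.ite measurableSet_Iio measurable_const hgm)
  have hq1 : ∀ t, ‖q t‖ ≤ 1 := by
    intro t
    simp only [hq]
    split_ifs <;> simp [hg1]
  have hqc : ∀ t, 0 < t → ContinuousWithinAt q (Ici t) t := by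
    intro t ht
    rcases lt_or_ge t a with h | h
    · refine (continuousWithinAt_const (b := (0 : ℂ))).congr_of_eventuallyEq ?_ (if_pos h)
      filter_upwards [mem_nhdsWithin_of_mem_nhds (Iio_mem_nhds h)] with x hx using if_pos hx
    · rcases lt_or_ge t b with h' | h'
      · refine (continuousWithinAt_const (b := (1 : ℂ))).congr_of_eventuallyEq ?_
          (by simp [hq, h', not_lt.2 h])
        filter_upwards [mem_nhdsWithin_of_mem_nhds (Iio_mem_nhds h'), self_mem_nhdsWithin]
          with x hx hx'
        simp [hq, not_lt.2 (h.trans hx'), mem_Iio.1 hx]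
      · refine (hrc t ht).congr_of_eventuallyEq ?_ (by simp [hq, not_lt.2 h, not_lt.2 h'])
        filter_upwards [self_mem_nhdsWithin] with x hx
        simp [hq, not_lt.2 (h.trans hx), not_lt.2 (h'.trans hx)]
  have key := hT.integral_finprod hqm hq1 hqc hqB
  have hI := integrableOn_one_sub_of_eq_one hgm hg1 hg
  have hIq := integrableOn_one_sub_of_eq_one hqm hq1 hqB
  have h1 : ∫ t in Ioi (0 : ℝ), (1 - q t) = a + ∫ t in Ioi b, (1 - g t) := by
    have e1 : ∫ t in Ioc 0 a, (1 - q t) = a := by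
      rw [integral_Ioc_eq_integral_Ioo, setIntegral_congr_fun (g := fun _ => (1 : ℂ))
        measurableSet_Ioo fun t ht => by simp [hq, ht.2]]
      simp [ha]
    have e2 : ∫ t in Ioc a b, (1 - q t) = 0 := by
      rw [integral_Ioc_eq_integral_Ioo, setIntegral_congr_fun (g := fun _ => (0 : ℂ))
        measurableSet_Ioo fun t ht => by simp [hq, ht.2, not_lt.2 ht.1.le]]
      simp
    have e3 : ∫ t in Ioi b, (1 - q t) = ∫ t in Ioi b, (1 - g t) := by
      refine setIntegral_congr_fun measurableSet_Ioi fun t ht => ?_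
      simp [hq, not_lt.2 (le_of_lt (mem_Ioi.1 ht)), not_lt.2 (hab.trans (le_of_lt (mem_Ioi.1 ht)))]
    rw [← Ioc_union_Ioi_eq_Ioi (ha.trans hab), setIntegral_union (Ioc_disjoint_Ioi le_rfl)
      measurableSet_Ioi ((hIq 0).mono_set Ioc_subset_Ioi_self) (hIq b), e3,
      ← Ioc_union_Ioc_eq_Ioc ha hab, setIntegral_union (Ioc_disjoint_Ioc_of_le le_rfl)
      measurableSet_Ioc ((hIq 0).mono_set Ioc_subset_Ioi_self)
      ((hIq a).mono_set Ioc_subset_Ioi_self), e1, e2, add_zero]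
  rw [h1, neg_add, Complex.exp_add] at key
  rw [tailPGF, ← key]
  refine integral_congr_ae ?_
  filter_upwards [hT.mono, hT.ae_finite] with ω hmono hfin
  split_ifs with h0
  · refine finprod_congr fun n => ?_
    simp [hq, not_lt.2 (h0.trans (hmono (Nat.zero_le n)))]
  · symm
    have hs := mulSupport_finite_of_eq_one (hfin B') hqB
    rw [finprod_eq_prod _ hs]
    have hz : q (T 0 ω) = 0 := by simp [hq, not_le.1 h0]
    refine Finset.prod_eq_zero (i := 0) ?_ hz
    simp [hz]

/-- The difference of the previous formula for the starting points `a` and `b`. -/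
lemma integral_indicator_Ico_mul_finprod [IsProbabilityMeasure μ] (hT : IsUnitPoisson T μ)
    {B : ℕ} {g : ℝ → ℂ} (hgm : Measurable g) (hg1 : ∀ t, ‖g t‖ ≤ 1)
    (hrc : ∀ t, 0 < t → ContinuousWithinAt g (Ici t) t) (hg : ∀ t : ℝ, B ≤ t → g t = 1)
    {a b : ℝ} (ha : 0 ≤ a) (hab : a ≤ b) :
    ∫ ω in {ω | T 0 ω ∈ Ico a b}, ∏ᶠ n, (if T n ω < b then 1 else g (T n ω)) ∂μ =
      (Complex.exp (-a) - Complex.exp (-b)) * tailPGF g b := by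
  have hm : AEStronglyMeasurable (fun ω => ∏ᶠ n, (if T n ω < b then 1 else g (T n ω))) μ := by
    refine aestronglyMeasurable_finprod (fun n => Measurable.ite
      (measurableSet_lt (hT.measurable n) measurable_const) measurable_const
      (hgm.comp (hT.measurable n))) ?_
    filter_upwards [hT.ae_finite] with ω hfin
    refine mulSupport_finite_of_eq_one (hfin B) (g := fun t => if t < b then 1 else g t)
      fun t ht => ?_
    simp [hg t ht]
  have hb : ∀ ω, ‖∏ᶠ n, (if T n ω < b then 1 else g (T n ω))‖ ≤ 1 := fun ω =>
    norm_finprod_le_one fun n => by split_ifs <;> simp [hg1]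
  have hi : Integrable (fun ω => ∏ᶠ n, (if T n ω < b then 1 else g (T n ω))) μ :=
    Integrable.of_bound hm 1 (Eventually.of_forall hb)
  have hset : ∀ c : ℝ, MeasurableSet {ω | c ≤ T 0 ω} := fun c =>
    measurableSet_le measurable_const (hT.measurable 0)
  have e : ∀ c : ℝ, (fun ω => if c ≤ T 0 ω then ∏ᶠ n, (if T n ω < b then 1 else g (T n ω)) else 0)
      = indicator {ω | c ≤ T 0 ω} (fun ω => ∏ᶠ n, (if T n ω < b then 1 else g (T n ω))) := by
    intro c; ext ω; simp [indicator_apply]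
  have h1 := hT.integral_indicator_le_zero_mul_finprod hgm hg1 hrc hg ha hab
  have h2 := hT.integral_indicator_le_zero_mul_finprod hgm hg1 hrc hg (ha.trans hab) le_rfl (b := b)
  rw [e, integral_indicator (hset _)] at h1 h2
  rw [sub_mul, ← h1, ← h2]
  have hd : {ω | a ≤ T 0 ω} = {ω | T 0 ω ∈ Ico a b} ∪ {ω | b ≤ T 0 ω} := by
    ext ω
    simp only [mem_ofPred_eq, mem_union, mem_Ico]
    constructor
    · intro h; rcases lt_or_ge (T 0 ω) b with h' | h'
      · exact Or.inl ⟨h, h'⟩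
      · exact Or.inr h'
    · rintro (h | h)
      · exact h.1
      · exact hab.trans h
  rw [hd, setIntegral_union _ (hset b) hi.integrableOn hi.integrableOn, add_sub_cancel_right]
  refine Set.disjoint_left.2 fun ω h h' => ?_
  exact not_le.2 h.2 h'

/-- With r = b - a the probability is 1 - (1 + r) e^(-r), and e^(-r) ≥ 1 - r. The quadratic order is
what excludes coincident points. -/
lemma measure_two_le_count_le [IsProbabilityMeasure μ] (hT : IsUnitPoisson T μ) {a b : ℝ}
    (ha : 0 ≤ a) (hab : a ≤ b) :
    μ {ω | 2 ≤ count T (Ioc a b) ω} ≤ ENNReal.ofReal ((b - a) ^ 2) := by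
  set N := count T (Ioc a b)
  have hN : Measurable N := measurable_count hT.measurable measurableSet_Ioc
  have h0 := hT.count_law a b ha hab 0
  have h1 := hT.count_law a b ha hab 1
  have hs : {ω | 2 ≤ N ω} = ({ω | N ω = (0 : ℕ)} ∪ {ω | N ω = (1 : ℕ)})ᶜ := by
    ext ω
    simp only [mem_ofPred_eq, mem_compl_iff, mem_union, not_or]
    generalize N ω = x
    induction x using ENat.recTopCoe with
    | top => simp
    | coe k =>
      norm_cast
      omega
  have hm : ∀ k : ℕ, MeasurableSet {ω | N ω = k} := fun k => hN (measurableSet_singleton _)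
  have hdis : Disjoint {ω | N ω = (0 : ℕ)} {ω | N ω = (1 : ℕ)} := by
    refine Set.disjoint_left.2 fun ω h h' => ?_
    have : ((0 : ℕ) : ℕ∞) = (1 : ℕ) := h.symm.trans h'
    norm_cast at this
  rw [hs, prob_compl_eq_one_sub ((hm 0).union (hm 1)), measure_union hdis (hm 1), h0, h1,
    poissonMeasure_singleton, poissonMeasure_singleton, Real.coe_toNNReal _ (sub_nonneg.2 hab),
    ← ENNReal.ofReal_add (by positivity) (by have := sub_nonneg.2 hab; positivity),
    ← ENNReal.ofReal_one,
    ← ENNReal.ofReal_sub _ (by have := sub_nonneg.2 hab; positivity)]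
  refine ENNReal.ofReal_le_ofReal ?_
  have := Real.add_one_le_exp (-(b - a))
  have h3 := sub_nonneg.2 hab
  simp only [pow_zero, pow_one, Nat.factorial]
  have h4 := mul_le_mul_of_nonneg_right this (by linarith : 0 ≤ 1 + (b - a))
  simp only [mul_one, Nat.cast_one, div_one]
  nlinarith

/-- If the first two points coincide below `B`, one of the `d * B` cells of length 1/d contains two
points. This has probability at most B/d, and d is arbitrary. -/
lemma ae_zero_lt_one [IsProbabilityMeasure μ] (hT : IsUnitPoisson T μ) :
    ∀ᵐ ω ∂μ, T 0 ω < T 1 ω := by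
  have key : ∀ B : ℕ, μ {ω | 0 < T 0 ω ∧ T 0 ω = T 1 ω ∧ T 0 ω ≤ B} = 0 := by
    intro B
    have hle : ∀ d : ℕ, 0 < d →
        μ {ω | 0 < T 0 ω ∧ T 0 ω = T 1 ω ∧ T 0 ω ≤ B} ≤ ENNReal.ofReal (B / d) := by
      intro d hd
      have hd' : (0 : ℝ) < d := by exact_mod_cast hd
      have hsub : {ω | 0 < T 0 ω ∧ T 0 ω = T 1 ω ∧ T 0 ω ≤ B} ⊆
          ⋃ j ∈ Finset.range (d * B),
              {ω | 2 ≤ count T (Ioc ((j : ℝ) / d) ((j + 1 : ℝ) / d)) ω} := by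
        rintro ω ⟨hpos, heq, hB⟩
        have hc : 0 < ⌈d * T 0 ω⌉₊ := Nat.ceil_pos.2 (mul_pos hd' hpos)
        have hcB : ⌈d * T 0 ω⌉₊ ≤ d * B := by
          refine Nat.ceil_le.2 ?_
          push_cast; gcongr
        refine mem_iUnion₂.2 ⟨⌈d * T 0 ω⌉₊ - 1, Finset.mem_range.2 (by omega), ?_⟩
        have hmem : T 0 ω ∈ Ioc (((⌈d * T 0 ω⌉₊ - 1 : ℕ) : ℝ) / d)
            ((((⌈d * T 0 ω⌉₊ - 1 : ℕ) : ℝ) + 1) / d) := by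
          rw [mem_Ioc, div_lt_iff₀ hd', le_div_iff₀ hd', mul_comm (T 0 ω), Nat.cast_pred hc]
          refine ⟨?_, by simpa using Nat.le_ceil (d * T 0 ω)⟩
          have := Nat.ceil_lt_add_one (mul_pos hd' hpos).le
          linarith
        show (2 : ℕ∞) ≤ _
        rw [count]
        have : ({0, 1} : Set ℕ) ⊆ {n | T n ω ∈ Ioc (((⌈d * T 0 ω⌉₊ - 1 : ℕ) : ℝ) / d)
            ((((⌈d * T 0 ω⌉₊ - 1 : ℕ) : ℝ) + 1) / d)} := by
          rintro n (rfl | rfl)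
          · exact hmem
          · show T 1 ω ∈ Ioc _ _
            rw [← heq]; exact hmem
        refine le_trans ?_ (Set.encard_le_encard this)
        rw [Set.encard_pair (by norm_num)]
      refine (measure_mono hsub).trans ((measure_biUnion_finset_le _ _).trans ?_)
      calc ∑ j ∈ Finset.range (d * B),
            μ {ω | 2 ≤ count T (Ioc ((j : ℝ) / d) ((j + 1 : ℝ) / d)) ω}
          ≤ ∑ j ∈ Finset.range (d * B), ENNReal.ofReal ((1 / d) ^ 2) := by
            refine Finset.sum_le_sum fun j _ => ?_
            refine (hT.measure_two_le_count_le (by positivity) (by gcongr; linarith)).trans_eq ?_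
            congr 2; field_simp; ring
        _ = ENNReal.ofReal (B / d) := by
            rw [Finset.sum_const, Finset.card_range, ← ENNReal.ofReal_nsmul]
            congr 1
            rw [nsmul_eq_mul]; push_cast; field_simp
    refine le_antisymm ?_ zero_le
    refine ge_of_tendsto' (x := atTop) (f := fun d : ℕ => ENNReal.ofReal (B / ((d + 1 : ℕ) : ℝ)))
      ?_ fun d => hle (d + 1) (Nat.succ_pos _)
    rw [← ENNReal.ofReal_zero]
    exact (ENNReal.continuous_ofReal.tendsto _).comp
      ((tendsto_const_div_atTop_nhds_zero_nat (B : ℝ)).comp (tendsto_add_atTop_nat 1))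
  have h2 : ∀ᵐ ω ∂μ, ∀ B : ℕ, ω ∉ {ω | 0 < T 0 ω ∧ T 0 ω = T 1 ω ∧ T 0 ω ≤ B} :=
    ae_all_iff.2 fun B => measure_eq_zero_iff_ae_notMem.1 (key B)
  filter_upwards [h2, hT.pos, hT.mono] with ω h hpos hmono
  obtain ⟨B, hB⟩ := exists_nat_ge (T 0 ω)
  exact lt_of_le_of_ne (hmono (Nat.zero_le 1)) fun he => h B ⟨hpos 0, he, hB⟩

/-- The first point exceeds `x` exactly if there is no point in `(0, x]`, an event of probability
e^(-x). -/
lemma map_zero_eq_expMeasure [IsProbabilityMeasure μ] (hT : IsUnitPoisson T μ) :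
    μ.map (T 0) = expMeasure 1 := by
  have := Measure.isProbabilityMeasure_map (μ := μ) (hT.measurable 0).aemeasurable
  have := isProbabilityMeasure_expMeasure one_pos
  refine Measure.eq_of_cdf _ _ ?_
  ext x
  rw [cdf_expMeasure_eq one_pos, cdf_eq_real, measureReal_def,
    Measure.map_apply (hT.measurable 0) measurableSet_Iic]
  split_ifs with hx
  · have hm : MeasurableSet {ω | count T (Ioc 0 x) ω = (0 : ℕ)} :=
      measurable_count hT.measurable measurableSet_Ioc (measurableSet_singleton _)
    have h1 : (T 0 ⁻¹' Iic x : Set Ω) =ᵐ[μ] ({ω | count T (Ioc 0 x) ω = (0 : ℕ)}ᶜ : Set Ω) := by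
      filter_upwards [hT.pos, hT.mono] with ω hpos hmono
      refine propext ?_
      show T 0 ω ≤ x ↔ ¬ (count T (Ioc 0 x) ω = (0 : ℕ))
      rw [count, Nat.cast_zero, Set.encard_eq_zero, ← Ne, ← Set.nonempty_iff_ne_empty]
      constructor
      · exact fun h => ⟨0, hpos 0, h⟩
      · rintro ⟨n, hn⟩
        exact (hmono (Nat.zero_le n)).trans hn.2
    rw [measure_congr h1, prob_compl_eq_one_sub hm, hT.count_law 0 x le_rfl hx,
      poissonMeasure_singleton, sub_zero, Real.coe_toNNReal _ hx, ← ENNReal.ofReal_one,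
      ← ENNReal.ofReal_sub _ (by positivity)]
    simp [ENNReal.toReal_ofReal, hx]
  · have h1 : μ (T 0 ⁻¹' Iic x) = 0 := by
      rw [measure_eq_zero_iff_ae_notMem]
      filter_upwards [hT.pos] with ω hpos hmem
      exact hx ((hpos 0).le.trans hmem)
    simp [h1]

lemma integral_zero_comp [IsProbabilityMeasure μ] (hT : IsUnitPoisson T μ) {k : ℝ → ℂ}
    (hk : Measurable k) :
    ∫ ω, k (T 0 ω) ∂μ = ∫ t in Ioi (0 : ℝ), Complex.exp (-t) * k t := by
  rw [← integral_map (hT.measurable 0).aemeasurable hk.aestronglyMeasurable,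
    hT.map_zero_eq_expMeasure, expMeasure, gammaMeasure,
    integral_withDensity_eq_integral_toReal_smul (by
      exact (measurable_gammaPDFReal 1 1).ennreal_ofReal) (by simp [gammaPDF]),
    ← integral_Ici_eq_integral_Ioi, ← integral_indicator measurableSet_Ici]
  congr 1
  ext t
  by_cases ht : 0 ≤ t
  · have h1 : gammaPDF 1 1 t = exponentialPDF 1 t := rfl
    rw [indicator_of_mem (mem_Ici.2 ht), h1, exponentialPDF_of_nonneg ht,
      ENNReal.toReal_ofReal (by positivity), Complex.real_smul]
    simp
  · have h1 : gammaPDF 1 1 t = 0 := gammaPDF_of_neg (not_le.1 ht)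
    rw [indicator_of_notMem (by simpa using ht), h1]
    simp

/-- The first point of a unit rate Poisson process is independent of the later gaps. -/
theorem integral_zero_mul_finprod [IsProbabilityMeasure μ] (hT : IsUnitPoisson T μ)
    {B : ℕ} {g h : ℝ → ℂ} (hgm : Measurable g) (hg1 : ∀ t, ‖g t‖ ≤ 1)
    (hrc : ∀ t, 0 < t → ContinuousWithinAt g (Ici t) t) (hg : ∀ t : ℝ, B ≤ t → g t = 1)
    (hhm : Measurable h) (hh1 : ∀ t, ‖h t‖ ≤ 1)
    (hhc : ∀ t, 0 < t → ContinuousWithinAt h (Ici t) t) :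
    ∫ ω, h (T 0 ω) * ∏ᶠ n, g (T (n + 1) ω) ∂μ =
      ∫ t in Ioi (0 : ℝ), Complex.exp (-t) * (h t * tailPGF g t) := by
  have hI := integrableOn_one_sub_of_eq_one hgm hg1 hg
  have hΦc := continuousOn_tailPGF (hI 0)
  have hΦ1 : ∀ t, ‖tailPGF g t‖ ≤ 1 := fun t => norm_tailPGF_le_one hg1 (hI t)
  have hΦm : Measurable (tailPGF g) := by
    unfold tailPGF
    have : StronglyMeasurable fun t : ℝ => ∫ x, (Ioi t).indicator (fun x => 1 - g x) x := by
      refine StronglyMeasurable.integral_prod_right (f := fun t x => (Ioi t).indicator (fun x =>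
          1 - g x) x) ?_
      have : (Function.uncurry fun t x : ℝ => (Ioi t).indicator (fun x => 1 - g x) x) =
          {z : ℝ × ℝ | z.1 < z.2}.indicator fun z => 1 - g z.2 := by
        ext ⟨t, x⟩; simp [indicator_apply]
      rw [this]
      exact (Measurable.indicator (by fun_prop)
        (measurableSet_lt measurable_fst measurable_snd)).stronglyMeasurable
    simp_rw [integral_indicator measurableSet_Ioi] at this
    exact Complex.measurable_exp.comp this.measurable.neg
  -- The first mesh point strictly beyond `t`. Strictness removes the factor of `T 0` from the
  -- product over the points that are not below `c m (T 0 ω)`.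
  set c : ℕ → ℝ → ℝ := fun m t => (⌊((m + 1 : ℕ) : ℝ) * t⌋₊ + 1 : ℝ) / ((m + 1 : ℕ) : ℝ) with hc
  have hcm : ∀ m, Measurable (c m) := fun m => by simp only [hc]; fun_prop
  have hclt : ∀ m t, t < c m t := by
    intro m t
    rw [hc, lt_div_iff₀ (by positivity), mul_comm]
    exact Nat.lt_floor_add_one _
  have hclim : ∀ t, 0 < t → Tendsto (fun m => c m t) atTop (𝓝[≥] t) := by
    intro t ht
    refine tendsto_nhdsWithin_iff.2 ⟨?_, Eventually.of_forall fun m => (hclt m t).le⟩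
    have h1 := (tendsto_nat_floor_mul_div_atTop (R := ℝ) ht.le).comp
      (tendsto_natCast_atTop_atTop.comp (tendsto_add_atTop_nat 1))
    have h2 := (tendsto_one_div_add_atTop_nhds_zero_nat (𝕜 := ℝ))
    have h3 := h1.add h2
    rw [add_zero] at h3
    refine h3.congr fun m => ?_
    simp only [hc, Function.comp_apply]
    push_cast
    rw [add_div, mul_comm]
  set F : ℕ → Ω → ℂ := fun m ω => h (c m (T 0 ω)) *
    ∏ᶠ n, (if T n ω < c m (T 0 ω) then 1 else g (T n ω)) with hF
  have hT0 := hT.measurable 0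
  have hFm : ∀ m, AEStronglyMeasurable (F m) μ := by
    intro m
    have := hcm m
    refine AEStronglyMeasurable.mul (Measurable.aestronglyMeasurable (by fun_prop)) ?_
    refine aestronglyMeasurable_finprod (fun n => Measurable.ite
      (measurableSet_lt (hT.measurable n) ((hcm m).comp hT0)) measurable_const
      (hgm.comp (hT.measurable n))) ?_
    filter_upwards [hT.ae_finite] with ω hfin
    refine mulSupport_finite_of_eq_one (hfin B)
      (g := fun t => if t < c m (T 0 ω) then 1 else g t) fun t ht => ?_
    simp [hg t ht]
  have hF1 : ∀ m ω, ‖F m ω‖ ≤ 1 := by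
    intro m ω
    simp only [hF]
    rw [norm_mul]
    exact mul_le_one₀ (hh1 _) (norm_nonneg _)
      (norm_finprod_le_one fun n => by split_ifs <;> simp [hg1])
  have hFi : ∀ m, Integrable (F m) μ := fun m =>
    Integrable.of_bound (hFm m) 1 (Eventually.of_forall (hF1 m))
  have hGi : ∀ m, Integrable (fun ω => h (c m (T 0 ω)) * tailPGF g (c m (T 0 ω))) μ := by
    intro m
    refine Integrable.of_bound (Measurable.aestronglyMeasurable ?_) 1
      (Eventually.of_forall fun ω => ?_)
    · have := hcm m
      fun_prop
    · rw [norm_mul]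
      exact mul_le_one₀ (hh1 _) (norm_nonneg _) (hΦ1 _)
  -- On a cell of the mesh `c m (T 0 ω)` is constant, and both integrals are the same multiple of
  -- e^(-a) - e^(-b). On the right this is the formula for the trivial function `g = 1`.
  have hEq : ∀ m, ∫ ω, F m ω ∂μ = ∫ ω, h (c m (T 0 ω)) * tailPGF g (c m (T 0 ω)) ∂μ := by
    intro m
    have hd : (0 : ℝ) < ((m + 1 : ℕ) : ℝ) := by positivity
    set S : ℕ → Set Ω := fun j =>
      {ω | T 0 ω ∈ Ico ((j : ℝ) / ((m + 1 : ℕ) : ℝ)) ((j + 1 : ℝ) / ((m + 1 : ℕ) : ℝ))} with hS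
    have hSm : ∀ j, MeasurableSet (S j) := fun j => hT0 measurableSet_Ico
    have hfl : ∀ j, ∀ ω ∈ S j, ⌊((m + 1 : ℕ) : ℝ) * T 0 ω⌋₊ = j := by
      intro j ω hω
      have h1 : T 0 ω ∈ Ico _ _ := hω
      rw [mem_Ico, div_le_iff₀ hd, lt_div_iff₀ hd, mul_comm] at h1
      rw [Nat.floor_eq_iff (by exact le_trans (by positivity) h1.1)]
      exact h1
    have hcS : ∀ j, ∀ ω ∈ S j, c m (T 0 ω) = (j + 1 : ℝ) / ((m + 1 : ℕ) : ℝ) := by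
      intro j ω hω
      simp only [hc]
      rw [hfl j ω hω]
    have hdis : Pairwise (Function.onFun Disjoint S) := by
      intro i j hij
      refine Set.disjoint_left.2 fun ω h1 h2 => hij ?_
      rw [← hfl i ω h1, ← hfl j ω h2]
    have hU : ∀ k : Ω → ℂ, ∫ ω, k ω ∂μ = ∫ ω in ⋃ j, S j, k ω ∂μ := by
      intro k
      refine (setIntegral_eq_integral_of_ae_compl_eq_zero ?_).symm
      filter_upwards [hT.pos] with ω hpos hω
      refine absurd (mem_iUnion.2 ⟨⌊((m + 1 : ℕ) : ℝ) * T 0 ω⌋₊, ?_⟩) hω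
      show T 0 ω ∈ Ico _ _
      rw [mem_Ico, div_le_iff₀ hd, lt_div_iff₀ hd, mul_comm (T 0 ω)]
      exact ⟨Nat.floor_le (mul_pos hd (hpos 0)).le, Nat.lt_floor_add_one _⟩
    rw [hU, hU, integral_iUnion hSm hdis (hFi m).integrableOn,
      integral_iUnion hSm hdis (hGi m).integrableOn]
    congr 1
    ext j
    have hab : (j : ℝ) / ((m + 1 : ℕ) : ℝ) ≤ (j + 1 : ℝ) / ((m + 1 : ℕ) : ℝ) := by
      gcongr; linarith
    have e1 : ∫ ω in S j, F m ω ∂μ = h ((j + 1 : ℝ) / ((m + 1 : ℕ) : ℝ)) *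
        ∫ ω in S j, ∏ᶠ n, (if T n ω < (j + 1 : ℝ) / ((m + 1 : ℕ) : ℝ) then 1 else g
            (T n ω)) ∂μ := by
      rw [← integral_const_mul]
      refine setIntegral_congr_fun (hSm j) fun ω hω => ?_
      simp only [hF, hcS j ω hω]
    have e2 : ∫ ω in S j, h (c m (T 0 ω)) * tailPGF g (c m (T 0 ω)) ∂μ =
        h ((j + 1 : ℝ) / ((m + 1 : ℕ) : ℝ)) * tailPGF g ((j + 1 : ℝ) / ((m + 1 : ℕ) : ℝ)) *
        ∫ ω in S j, ∏ᶠ n : ℕ, (if T n ω < (j + 1 : ℝ) / ((m + 1 : ℕ) : ℝ) then 1 else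
          (fun _ : ℝ => (1 : ℂ)) (T n ω)) ∂μ := by
      rw [← integral_const_mul]
      refine setIntegral_congr_fun (hSm j) fun ω hω => ?_
      simp [hcS j ω hω]
    rw [e1, e2, hT.integral_indicator_Ico_mul_finprod hgm hg1 hrc hg (by positivity) hab,
      hT.integral_indicator_Ico_mul_finprod (B := 0) (g := fun _ => 1) measurable_const (by simp)
        (fun t _ => continuousWithinAt_const) (by simp) (by positivity) hab]
    simp only [tailPGF, sub_self, integral_zero, neg_zero, Complex.exp_zero]
    ring
  have hlim1 : Tendsto (fun m => ∫ ω, F m ω ∂μ) atTop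
      (𝓝 (∫ ω, h (T 0 ω) * ∏ᶠ n, g (T (n + 1) ω) ∂μ)) := by
    refine tendsto_integral_of_dominated_convergence (fun _ => 1) hFm (integrable_const _)
      (fun m => Eventually.of_forall (hF1 m)) ?_
    filter_upwards [hT.pos, hT.mono, hT.ae_finite, hT.ae_zero_lt_one] with ω hpos hmono hfin hlt
    refine ((hhc _ (hpos 0)).tendsto.comp (hclim _ (hpos 0))).mul ?_
    obtain ⟨N, hN⟩ := (hfin B).bddAbove
    have hgt : ∀ n, N < n → (B : ℝ) ≤ T n ω := by
      intro n hn
      by_contra hcon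
      exact absurd (hN (not_le.1 hcon).le) (not_le.2 hn)
    have e1 : ∀ m, ∏ᶠ n, (if T n ω < c m (T 0 ω) then 1 else g (T n ω)) =
        ∏ n ∈ Finset.range N, (if T (n + 1) ω < c m (T 0 ω) then 1 else g (T (n + 1) ω)) := by
      intro m
      rw [finprod_eq_prod_of_mulSupport_subset (s := Finset.range (N + 1)), Finset.prod_range_succ',
        if_pos (hclt m _), mul_one]
      intro n hn
      simp only [Finset.coe_range, mem_Iio]
      by_contra hcon
      exact hn (by simp [hg _ (hgt n (by omega))])
    have e2 : ∏ᶠ n, g (T (n + 1) ω) = ∏ n ∈ Finset.range N, g (T (n + 1) ω) := by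
      refine finprod_eq_prod_of_mulSupport_subset _ fun n hn => ?_
      simp only [Finset.coe_range, mem_Iio]
      by_contra hcon
      exact hn (hg _ (hgt (n + 1) (by omega)))
    simp_rw [e1, e2]
    refine tendsto_finsetProd _ fun n _ => ?_
    -- The later points lie strictly beyond the first one, so the mesh point eventually falls below
    -- each of them.
    have h1 : T 0 ω < T (n + 1) ω := hlt.trans_le (hmono (by omega))
    refine tendsto_const_nhds.congr' ?_
    filter_upwards [((hclim _ (hpos 0)).mono_right nhdsWithin_le_nhds).eventually_lt_const h1]
      with m hm
    rw [if_neg (not_lt.2 hm.le)]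
  have hlim2 : Tendsto (fun m => ∫ ω, h (c m (T 0 ω)) * tailPGF g (c m (T 0 ω)) ∂μ) atTop
      (𝓝 (∫ ω, h (T 0 ω) * tailPGF g (T 0 ω) ∂μ)) := by
    refine tendsto_integral_of_dominated_convergence (fun _ => 1)
      (fun m => (hGi m).aestronglyMeasurable) (integrable_const _)
      (fun m => Eventually.of_forall fun ω => ?_) ?_
    · rw [norm_mul]
      exact mul_le_one₀ (hh1 _) (norm_nonneg _) (hΦ1 _)
    · filter_upwards [hT.pos] with ω hpos
      refine ((hhc _ (hpos 0)).tendsto.comp (hclim _ (hpos 0))).mul ?_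
      have h1 : ContinuousWithinAt (tailPGF g) (Ici (T 0 ω)) (T 0 ω) :=
        (hΦc _ (hpos 0).le).mono (Ici_subset_Ici.2 (hpos 0).le)
      exact h1.tendsto.comp (hclim _ (hpos 0))
  simp_rw [hEq] at hlim1
  rw [tendsto_nhds_unique hlim1 hlim2]
  exact hT.integral_zero_comp (k := fun t => h t * tailPGF g t) (hhm.mul hΦm)

end IsUnitPoisson

end

/-! ### Arrival times of the planar network and products over all tiers. -/

section

variable {Ω : Type*} [MeasurableSpace Ω] {μ : Measure Ω} {K L : ℕ}

/-- A disc of radius r has area πr², hence c π ‖x‖² transports the planar intensity c to Lebesgue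
measure on the half-line. -/
lemma volume_annulus {c : ℝ} (hc : 0 < c) {a b : ℝ} (ha : 0 ≤ a) (hab : a ≤ b) :
    (ENNReal.ofReal c • (volume : Measure Plane)) {x | c * Real.pi * ‖x‖ ^ 2 ∈ Ioc a b} =
      ENNReal.ofReal (b - a) := by
  have hcp : 0 < c * Real.pi := by positivity
  have hball : ∀ r : ℝ, 0 ≤ r → {x : Plane | c * Real.pi * ‖x‖ ^ 2 ≤ r} =
      Metric.closedBall 0 (√(r / (c * Real.pi))) := by
    intro r hr
    ext x
    rw [mem_closedBall_zero_iff, Real.le_sqrt (norm_nonneg _) (by positivity), le_div_iff₀ hcp,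
      mul_comm (‖x‖ ^ 2)]
    rfl
  have hvol : ∀ r : ℝ, 0 ≤ r → (volume : Measure Plane) {x | c * Real.pi * ‖x‖ ^ 2 ≤ r} =
      ENNReal.ofReal (r / c) := by
    intro r hr
    rw [hball r hr, EuclideanSpace.volume_closedBall_fin_two, ← ENNReal.ofReal_pow (by positivity),
      Real.sq_sqrt (by positivity)]
    rw [← ENNReal.ofReal_mul (by positivity)]
    congr 1
    field_simp
  have hset : {x : Plane | c * Real.pi * ‖x‖ ^ 2 ∈ Ioc a b} =
      {x | c * Real.pi * ‖x‖ ^ 2 ≤ b} \ {x | c * Real.pi * ‖x‖ ^ 2 ≤ a} := by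
    ext x
    simp only [mem_ofPred_eq, mem_Ioc, Set.mem_sdiff, not_le]
    exact and_comm
  have hmeas : MeasurableSet {x : Plane | c * Real.pi * ‖x‖ ^ 2 ≤ a} :=
    measurableSet_le (by fun_prop) measurable_const
  have hsub : {x : Plane | c * Real.pi * ‖x‖ ^ 2 ≤ a} ⊆ {x | c * Real.pi * ‖x‖ ^ 2 ≤ b} :=
    fun x hx => le_trans (b := a) hx hab
  rw [Measure.smul_apply, hset, measure_sdiff hsub
    hmeas.nullMeasurableSet (by rw [hvol a ha]; exact ENNReal.ofReal_ne_top), hvol b (ha.trans hab),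
    hvol a ha, ← ENNReal.ofReal_sub _ (by positivity), smul_eq_mul, ← ENNReal.ofReal_mul hc.le]
  congr 1
  field_simp

/-- The squared distance of the `n`-th nearest BS of a tier, in units in which these form a unit
rate Poisson process. -/
noncomputable def arrival (p : Params K L) (X : Tier K L → ℕ → Ω → Plane) (t : Tier K L) (n : ℕ)
    (ω : Ω) : ℝ :=
  p.dens t * Real.pi * ‖X t n ω‖ ^ 2

/-- The mapping theorem: intervals of arrival times pull back to disjoint annuli of the plane. -/
lemma IsNetwork.isUnitPoisson [IsProbabilityMeasure μ] {p : Params K L} (hp : p.Admissible)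
    {X : Tier K L → ℕ → Ω → Plane} {Ψ : Tier K L → ℕ → Ω → ℝ} (hnet : IsNetwork p μ X Ψ)
    (t : Tier K L) : IsUnitPoisson (arrival p X t) μ := by
  have hd := hp.dens_pos t
  have hdp : 0 < p.dens t * Real.pi := by positivity
  have hann : ∀ a b : ℝ, MeasurableSet {x : Plane | p.dens t * Real.pi * ‖x‖ ^ 2 ∈ Ioc a b} :=
    fun a b => (by fun_prop : Measurable fun x : Plane => p.dens t * Real.pi * ‖x‖ ^ 2)
      measurableSet_Ioc
  have hcount : ∀ a b, count (arrival p X t) (Ioc a b) =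
      count (X t) {x : Plane | p.dens t * Real.pi * ‖x‖ ^ 2 ∈ Ioc a b} := fun a b => rfl
  constructor
  · intro n
    have := (hnet.poisson t).measurable n
    unfold arrival
    fun_prop
  -- The origin has intensity zero, so almost surely it carries no BS.
  · have h0 := (hnet.poisson t).count_law {0} (measurableSet_singleton _) (by simp) 0
    have hz : (ENNReal.ofReal (p.dens t) • (volume : Measure Plane)) {0} = 0 := by simp
    rw [hz, poissonMeasure_singleton] at h0
    have hmeas : MeasurableSet {ω | count (X t) {0} ω = (0 : ℕ)} :=
      measurable_count (hnet.poisson t).measurable (measurableSet_singleton _)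
        (measurableSet_singleton _)
    have h1 : ∀ᵐ ω ∂μ, count (X t) {0} ω = (0 : ℕ) :=
      (prob_compl_eq_zero_iff hmeas).2 (by simpa using h0)
    filter_upwards [h1] with ω hω n
    rw [count, Nat.cast_zero, Set.encard_eq_zero] at hω
    have hne : X t n ω ≠ 0 := fun h => by
      have : n ∈ {n | X t n ω ∈ ({0} : Set Plane)} := h
      rw [hω] at this
      exact this
    have : 0 < ‖X t n ω‖ := norm_pos_iff.2 hne
    unfold arrival
    positivity
  · filter_upwards [hnet.ordered t] with ω hω n m hnm
    have : ‖X t n ω‖ ≤ ‖X t m ω‖ := hω hnm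
    simp only [arrival]
    gcongr
  · intro a b ha hab k
    rw [hcount, (hnet.poisson t).count_law _ (hann a b)
      (by rw [volume_annulus hd ha hab]; exact ENNReal.ofReal_ne_top) k, volume_annulus hd ha hab]
    rfl
  · intro m δ hδ
    have hle : ∀ i : Fin m, (i : ℝ) * δ ≤ ((i : ℝ) + 1) * δ := fun i => by gcongr; linarith
    refine (hnet.poisson t).count_indep m
      (fun i => {x : Plane | p.dens t * Real.pi * ‖x‖ ^ 2 ∈ Ioc ((i : ℝ) * δ) (((i : ℝ) + 1) * δ)})
      (fun i => hann _ _) (fun i => ?_) (fun i j hij => ?_)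
    · rw [volume_annulus hd (by positivity) (hle i)]; exact ENNReal.ofReal_ne_top
    · have key : ∀ i j : Fin m, i < j →
          Disjoint (Ioc ((i : ℝ) * δ) (((i : ℝ) + 1) * δ)) (Ioc ((j : ℝ) * δ) (((j : ℝ) +
              1) * δ)) := by
        intro i j hij
        refine Ioc_disjoint_Ioc_of_le ?_
        have : (i : ℝ) + 1 ≤ j := by exact_mod_cast hij
        gcongr
      have := (lt_or_gt_of_ne hij).elim (key i j) fun h => (key j i h).symm
      exact this.preimage (fun x : Plane => p.dens t * Real.pi * ‖x‖ ^ 2)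

/-- Averaging over the fading gains of finitely many BSs of every tier. -/
lemma IsNetwork.integral_prod_marks [IsProbabilityMeasure μ] {p : Params K L} (hp : p.Admissible)
    {X : Tier K L → ℕ → Ω → Plane} {Ψ : Tier K L → ℕ → Ω → ℝ} (hnet : IsNetwork p μ X Ψ)
    (f : Tier K L → ℕ → ℝ → ℝ → ℂ) (hfm : ∀ t n, Measurable (Function.uncurry (f t n)))
    (hf1 : ∀ t n s x, ‖f t n s x‖ ≤ 1) (N : ℕ) :
    ∫ ω, ∏ t, ∏ n ∈ Finset.range N, f t n (arrival p X t n ω) (Ψ t n ω) ∂μ =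
      ∏ t, ∫ ω, ∏ n ∈ Finset.range N, (∫ x, f t n (arrival p X t n ω) x ∂(p.fading t)) ∂μ := by
  have hprob := hp.fading_prob
  have hXm : ∀ t n, Measurable (X t n) := fun t => (hnet.poisson t).measurable
  have hΨm := hnet.fading_measurable
  have hXX : Measurable (fun ω t n => X t n ω) := by fun_prop
  have hPP : Measurable (fun ω t n => Ψ t n ω) := by fun_prop
  set A : Tier K L → Plane → ℝ := fun t x => p.dens t * Real.pi * ‖x‖ ^ 2 with hA
  have hAm : ∀ t, Measurable (A t) := fun t => by simp only [hA]; fun_prop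
  set G : (Tier K L → ℕ → Plane) × (Tier K L → ℕ → ℝ) → ℂ := fun z =>
    ∏ t, ∏ n ∈ Finset.range N, f t n (A t (z.1 t n)) (z.2 t n) with hG
  have hGm : Measurable G := by
    refine Finset.measurable_prod _ fun t _ => Finset.measurable_prod _ fun n _ => ?_
    exact (hfm t n).comp (Measurable.prodMk (by fun_prop) (by fun_prop))
  have hGb : ∀ z, ‖G z‖ ≤ 1 := by
    intro z
    rw [hG, norm_prod]
    refine Finset.prod_le_one (fun _ _ => norm_nonneg _) fun t _ => ?_
    rw [norm_prod]
    exact Finset.prod_le_one (fun _ _ => norm_nonneg _) fun n _ => hf1 _ _ _ _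
  have hpX := Measure.isProbabilityMeasure_map (μ := μ) hXX.aemeasurable
  have hpP := Measure.isProbabilityMeasure_map (μ := μ) hPP.aemeasurable
  -- Layout and fading gains are independent, so the joint law is a product and the gains can be
  -- integrated first with the layout frozen.
  have h1 : ∫ ω, G (fun t n => X t n ω, fun t n => Ψ t n ω) ∂μ =
      ∫ x, ∫ y, G (x, y) ∂(μ.map fun ω t n => Ψ t n ω) ∂(μ.map fun ω t n => X t n ω) := by
    rw [← integral_prod _ (Integrable.of_bound hGm.aestronglyMeasurable 1
        (Eventually.of_forall hGb)),
      ← (indepFun_iff_map_prod_eq_prod_map_map hXX.aemeasurable hPP.aemeasurable).1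
        hnet.layout_fading_indep, integral_map (hXX.prodMk hPP).aemeasurable
            hGm.aestronglyMeasurable]
  have h2 : ∀ x : Tier K L → ℕ → Plane, ∫ y, G (x, y) ∂(μ.map fun ω t n => Ψ t n ω) =
      ∏ t, ∏ n ∈ Finset.range N, ∫ y, f t n (A t (x t n)) y ∂(p.fading t) := by
    intro x
    rw [integral_map (f := fun y => G (x, y)) hPP.aemeasurable
      (hGm.comp measurable_prodMk_left).aestronglyMeasurable]
    have hinj : Function.Injective fun i : Tier K L × Fin N => (i.1, (i.2 : ℕ)) := by
      rintro ⟨t, i⟩ ⟨t', i'⟩ h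
      simp only [Prod.mk.injEq] at h
      exact Prod.ext h.1 (Fin.ext h.2)
    have hI := hnet.fading_indep.precomp hinj
    have h3 := iIndepFun.integral_fun_prod_comp
      (f := fun (i : Tier K L × Fin N) (y : ℝ) => f i.1 i.2 (A i.1 (x i.1 i.2)) y) hI
      (fun i => (hΨm _ _).aemeasurable)
      (fun i => ((hfm _ _).comp measurable_prodMk_left).aestronglyMeasurable)
    have e : ∀ F : Tier K L → ℕ → ℂ, ∏ t, ∏ n ∈ Finset.range N, F t n =
        ∏ i : Tier K L × Fin N, F i.1 i.2 := by
      intro F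
      rw [Fintype.prod_prod_type]
      exact Finset.prod_congr rfl fun t _ => Finset.prod_range _
    simp only [hG, e]
    refine h3.trans (Finset.prod_congr rfl fun i _ => ?_)
    rw [← hnet.fading_law i.1 i.2, integral_map
      (f := fun y => f i.1 i.2 (A i.1 (x i.1 i.2)) y) (hΨm _ _).aemeasurable
      ((hfm _ _).comp measurable_prodMk_left).aestronglyMeasurable]
  have hgm : ∀ t n, Measurable fun s => ∫ y, f t n s y ∂(p.fading t) := fun t n =>
    (StronglyMeasurable.integral_prod_right (f := f t n) (hfm t n).stronglyMeasurable).measurable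
  have hHm : ∀ t, Measurable fun x : ℕ → Plane =>
      ∏ n ∈ Finset.range N, ∫ y, f t n (A t (x n)) y ∂(p.fading t) := by
    intro t
    refine Finset.measurable_prod _ fun n _ => (hgm t n).comp ?_
    fun_prop
  refine h1.trans ?_
  simp_rw [h2]
  rw [integral_map (f := fun x : Tier K L → ℕ → Plane =>
    ∏ t, ∏ n ∈ Finset.range N, ∫ y, f t n (A t (x t n)) y ∂(p.fading t)) hXX.aemeasurable
    (Finset.measurable_prod _ fun t _ =>
    (hHm t).comp (measurable_pi_apply t)).aestronglyMeasurable]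
  exact iIndepFun.integral_fun_prod_comp
    (f := fun t (x : ℕ → Plane) => ∏ n ∈ Finset.range N, ∫ y, f t n (A t (x n)) y ∂(p.fading t))
    hnet.layout_indep (fun t => (measurable_pi_lambda _ (hXm t)).aemeasurable)
    (fun t => (hHm t).aestronglyMeasurable)

/-- A bounded function of the arrival time and of the fading gain of a BS which is right-continuous
in the arrival time. -/
structure MarkFun (F : Measure ℝ) (f : ℝ → ℝ → ℂ) : Prop where
  measurable : Measurable (Function.uncurry f)
  norm_le_one : ∀ s x, ‖f s x‖ ≤ 1
  right_cont : ∀ s, 0 < s → ∀ᵐ x ∂F, ContinuousWithinAt (fun r => f r x) (Ici s) s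

/-- The mean of a function of the arrival time and of the fading gain over the fading gain. -/
noncomputable def markMean (F : Measure ℝ) (f : ℝ → ℝ → ℂ) (s : ℝ) : ℂ := ∫ x, f s x ∂F

namespace MarkFun

variable {F : Measure ℝ} [IsProbabilityMeasure F] {f : ℝ → ℝ → ℂ}

lemma measurable_markMean (hf : MarkFun F f) : Measurable (markMean F f) :=
  (StronglyMeasurable.integral_prod_right (f := f) hf.measurable.stronglyMeasurable).measurable

lemma norm_markMean_le_one (hf : MarkFun F f) (s : ℝ) : ‖markMean F f s‖ ≤ 1 := by
  refine (norm_integral_le_of_norm_le_const (Eventually.of_forall (hf.norm_le_one s))).trans ?_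
  simp

lemma continuousWithinAt_markMean (hf : MarkFun F f) {s : ℝ} (hs : 0 < s) :
    ContinuousWithinAt (markMean F f) (Ici s) s := by
  refine tendsto_integral_filter_of_dominated_convergence (fun _ => 1)
    (Eventually.of_forall fun r =>
      (hf.measurable.comp measurable_prodMk_left).aestronglyMeasurable)
    (Eventually.of_forall fun r => Eventually.of_forall (hf.norm_le_one r)) (integrable_const _) ?_
  exact hf.right_cont s hs

end MarkFun

/-- A function cut off at the arrival time `b`. -/
noncomputable def cutoff (b : ℝ) (g : ℝ → ℂ) (s : ℝ) : ℂ := if s < b then g s else 1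

lemma cutoff_eq_one {b s : ℝ} (g : ℝ → ℂ) (h : b ≤ s) : cutoff b g s = 1 := if_neg (not_lt.2 h)

lemma norm_cutoff_le_one {g : ℝ → ℂ} (hg : ∀ t, ‖g t‖ ≤ 1) (b s : ℝ) : ‖cutoff b g s‖ ≤ 1 := by
  unfold cutoff; split_ifs <;> simp [hg]

lemma measurable_cutoff {g : ℝ → ℂ} (hg : Measurable g) (b : ℝ) : Measurable (cutoff b g) :=
  Measurable.ite measurableSet_Iio hg measurable_const

lemma continuousWithinAt_cutoff {g : ℝ → ℂ} {s : ℝ} (hg : ContinuousWithinAt g (Ici s) s) (b : ℝ) :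
    ContinuousWithinAt (cutoff b g) (Ici s) s := by
  rcases lt_or_ge s b with h | h
  · refine hg.congr_of_eventuallyEq ?_ (if_pos h)
    filter_upwards [mem_nhdsWithin_of_mem_nhds (Iio_mem_nhds h)] with x hx using if_pos hx
  · refine (continuousWithinAt_const (b := (1 : ℂ))).congr_of_eventuallyEq ?_ (cutoff_eq_one g h)
    filter_upwards [self_mem_nhdsWithin] with x hx using cutoff_eq_one g (h.trans hx)

lemma tendsto_tailPGF_cutoff {g : ℝ → ℂ} {t : ℝ} (hg : IntegrableOn (fun s => 1 - g s) (Ioi t)) :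
    Tendsto (fun b : ℕ => tailPGF (cutoff b g) t) atTop (𝓝 (tailPGF g t)) := by
  refine (Complex.continuous_exp.tendsto _).comp (Tendsto.neg ?_)
  have h1 : ∀ b : ℕ, (fun s => 1 - cutoff b g s) = (Iio (b : ℝ)).indicator fun s => 1 - g s := by
    intro b; ext s
    by_cases h : s < b <;> simp [cutoff, h]
  refine tendsto_integral_of_dominated_convergence (fun s => ‖1 - g s‖) (fun b => ?_) hg.norm
    (fun b => Eventually.of_forall fun s => ?_) (Eventually.of_forall fun s => ?_)
  · rw [h1]
    exact hg.aestronglyMeasurable.indicator measurableSet_Iio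
  · rw [show 1 - cutoff b g s = _ from congrFun (h1 b) s]
    exact norm_indicator_le_norm_self _ _
  · refine tendsto_const_nhds.congr' ?_
    obtain ⟨B, hB⟩ := exists_nat_gt s
    filter_upwards [eventually_ge_atTop B] with b hb
    have : s < b := hB.trans_le (by exact_mod_cast hb)
    simp [cutoff, this]

lemma finprod_nat_eq_zero_mul {z : ℕ → ℂ} (h : (Function.mulSupport z).Finite) :
    ∏ᶠ n, z n = z 0 * ∏ᶠ n, z (n + 1) := by
  have h2 : (Function.mulSupport fun n => z (n + 1)).Finite :=
    h.preimage (f := fun n => n + 1) fun _ _ _ _ => by simp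
  have h3 := (tendsto_prod_range_finprod h).comp (tendsto_add_atTop_nat 1)
  refine tendsto_nhds_unique h3 (((tendsto_prod_range_finprod h2).const_mul (z 0)).congr
      fun N => ?_)
  rw [Function.comp_apply, Finset.prod_range_succ', mul_comm]

/-- The factor attached to the `n`-th nearest BS: `h` for the nearest one if it is distinguished,
and `f` for all others. -/
noncomputable def markSeq (first : Bool) (h f : ℝ → ℝ → ℂ) (n : ℕ) (s x : ℝ) : ℂ :=
  if n = 0 ∧ first = true then h s x else f s x

/-- The expectation of the product of the factors of a tier. -/
noncomputable def tierValue (first : Bool) (F : Measure ℝ) (h f : ℝ → ℝ → ℂ) : ℂ :=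
  if first = true then
    ∫ s in Ioi (0 : ℝ), Complex.exp (-s) * (markMean F h s * tailPGF (markMean F f) s)
  else tailPGF (markMean F f) 0

lemma integrableOn_cexp_neg_Ioi : IntegrableOn (fun s : ℝ => Real.exp (-s)) (Ioi 0) := by
  simpa using exp_neg_integrableOn_Ioi 0 one_pos

/-- The cutoff acts on `f` only, so a distinguished first factor stays intact and the formula for
the first point applies. -/
lemma IsUnitPoisson.integral_finprod_markSeq [IsProbabilityMeasure μ] {T : ℕ → Ω → ℝ}
    (hT : IsUnitPoisson T μ) {F : Measure ℝ} [IsProbabilityMeasure F] {h f : ℝ → ℝ → ℂ}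
    (hh : MarkFun F h) (hf : MarkFun F f) (first : Bool) (b : ℕ) :
    ∫ ω, ∏ᶠ n, markMean F (markSeq first h (fun s x => cutoff b (fun r => f r x) s) n) (T n ω) ∂μ =
      if first = true then ∫ s in Ioi (0 : ℝ), Complex.exp (-s) *
        (markMean F h s * tailPGF (cutoff b (markMean F f)) s)
      else tailPGF (cutoff b (markMean F f)) 0 := by
  have hcut : markMean F (fun s x => cutoff b (fun r => f r x) s) = cutoff b (markMean F f) := by
    ext s
    by_cases hs : s < b <;> simp [markMean, cutoff, hs]
  have h1 : ∀ t, ‖cutoff b (markMean F f) t‖ ≤ 1 :=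
    norm_cutoff_le_one hf.norm_markMean_le_one b
  have hm := measurable_cutoff hf.measurable_markMean b
  have hc : ∀ t, 0 < t → ContinuousWithinAt (cutoff b (markMean F f)) (Ici t) t := fun t ht =>
    continuousWithinAt_cutoff (hf.continuousWithinAt_markMean ht) b
  have hB : ∀ t : ℝ, b ≤ t → cutoff b (markMean F f) t = 1 := fun t ht => cutoff_eq_one _ ht
  cases first with
  | false =>
    have : ∀ n, markSeq false h (fun s x => cutoff b (fun r => f r x) s) n =
        fun s x => cutoff b (fun r => f r x) s := by
      intro n; ext s x; simp [markSeq]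
    simp_rw [this, hcut]
    simpa [tailPGF] using hT.integral_finprod hm h1 hc hB
  | true =>
    have h0 : markSeq true h (fun s x => cutoff b (fun r => f r x) s) 0 = h := by
      ext s x; simp [markSeq]
    have hS : ∀ n, markSeq true h (fun s x => cutoff b (fun r => f r x) s) (n + 1) =
        fun s x => cutoff b (fun r => f r x) s := by
      intro n; ext s x; simp [markSeq]
    simp only [if_true]
    rw [← hT.integral_zero_mul_finprod hm h1 hc hB hh.measurable_markMean
      hh.norm_markMean_le_one fun t ht => hh.continuousWithinAt_markMean ht]
    refine integral_congr_ae ?_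
    filter_upwards [hT.ae_finite] with ω hfin
    rw [finprod_nat_eq_zero_mul, h0]
    · simp_rw [hS, hcut]
    · refine ((hfin b).union (finite_singleton 0)).subset fun n hn => ?_
      by_contra hcon
      simp only [mem_union, mem_ofPred_eq, mem_singleton_iff, not_or, not_le] at hcon
      obtain ⟨k, rfl⟩ := Nat.exists_eq_succ_of_ne_zero hcon.2
      refine hn ?_
      show markMean F (markSeq true h (fun s x => cutoff b (fun r => f r x) s) (k + 1)) _ = 1
      rw [hS, hcut]
      exact hB _ hcon.1.le

/-- By monotonicity, cutting off at `b` leaves the partial product up to the first index whose time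
is at least `b`. Convergence of the partial products therefore suffices, without any absolute
convergence. -/
lemma tendsto_finprod_cutoff {τ : ℕ → ℝ} (hmono : Monotone τ) (hfin : ∀ B : ℝ, {n | τ n ≤ B}.Finite)
    {first : Bool} {h f : ℝ → ℝ → ℂ} {ψ : ℕ → ℝ} {z : ℂ}
    (hz : Tendsto (fun N => ∏ n ∈ Finset.range N, markSeq first h f n (τ n) (ψ n)) atTop (𝓝 z)) :
    Tendsto (fun b : ℕ => ∏ᶠ n,
      markSeq first h (fun s x => cutoff b (fun r => f r x) s) n (τ n) (ψ n)) atTop (𝓝 z) := by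
  set ν : ℕ → ℕ := fun b => sInf {n | (b : ℝ) ≤ τ n} with hν
  have hne : ∀ b : ℕ, {n | (b : ℝ) ≤ τ n}.Nonempty := by
    intro b
    by_contra hcon
    rw [Set.not_nonempty_iff_eq_empty, Set.eq_empty_iff_forall_notMem] at hcon
    exact Set.infinite_univ ((hfin b).subset fun n _ => le_of_lt (a := τ n) (not_le.1 (hcon n)))
  have hlt : ∀ b n, n < ν b → τ n < b := fun b n hn => not_le.1 (Nat.notMem_of_lt_sInf hn)
  have hge : ∀ b n, ν b ≤ n → b ≤ τ n := fun b n hn =>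
    le_trans (Nat.sInf_mem (hne b)) (hmono hn)
  have hνt : Tendsto ν atTop atTop := by
    refine tendsto_atTop.2 fun M => ?_
    obtain ⟨B, hB⟩ := exists_nat_gt (τ M)
    filter_upwards [eventually_ge_atTop B] with b hb
    by_contra hcon
    have h1 := hge b M (not_le.1 hcon).le
    have h2 : (B : ℝ) ≤ b := by exact_mod_cast hb
    linarith
  refine (hz.comp hνt).congr' ?_
  -- A distinguished factor of index 0 is never cut off, so the range must contain this index.
  filter_upwards [hνt.eventually_gt_atTop 0] with b hb
  rw [Function.comp_apply, finprod_eq_prod_of_mulSupport_subset (s := Finset.range (ν b))]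
  · refine Finset.prod_congr rfl fun n hn => ?_
    simp [markSeq, cutoff, hlt b n (Finset.mem_range.1 hn)]
  · intro n hn
    simp only [Finset.coe_range, mem_Iio]
    by_contra hcon
    refine hn ?_
    have hn0 : n ≠ 0 := by omega
    simp [markSeq, cutoff, hn0, not_lt.2 (hge b n (not_lt.1 hcon))]

/-- The expectation of a product over all BSs of all tiers. -/
theorem IsNetwork.integral_prod_eq [IsProbabilityMeasure μ] {p : Params K L} (hp : p.Admissible)
    {X : Tier K L → ℕ → Ω → Plane} {Ψ : Tier K L → ℕ → Ω → ℝ} (hnet : IsNetwork p μ X Ψ)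
    (first : Tier K L → Bool) (h f : Tier K L → ℝ → ℝ → ℂ)
    (hh : ∀ t, MarkFun (p.fading t) (h t)) (hf : ∀ t, MarkFun (p.fading t) (f t))
    (hint : ∀ t, IntegrableOn (fun s => 1 - markMean (p.fading t) (f t) s) (Ioi 0))
    (Z : Tier K L → Ω → ℂ)
    (hZ : ∀ t, ∀ᵐ ω ∂μ, Tendsto (fun N => ∏ n ∈ Finset.range N,
      markSeq (first t) (h t) (f t) n (arrival p X t n ω) (Ψ t n ω)) atTop (𝓝 (Z t ω))) :
    ∫ ω, ∏ t, Z t ω ∂μ = ∏ t, tierValue (first t) (p.fading t) (h t) (f t) := by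
  have hprob := hp.fading_prob
  have hT := hnet.isUnitPoisson hp
  set w : ℕ → Tier K L → ℕ → ℝ → ℝ → ℂ := fun b t n =>
    markSeq (first t) (h t) (fun s x => cutoff b (fun r => f t r x) s) n with hw
  have hw1 : ∀ b t n s x, ‖w b t n s x‖ ≤ 1 := by
    intro b t n s x
    simp only [hw, markSeq, cutoff]
    split_ifs
    · exact (hh t).norm_le_one _ _
    · exact (hf t).norm_le_one _ _
    · simp
  have hwm : ∀ b t n, Measurable (Function.uncurry (w b t n)) := by
    intro b t n
    by_cases hc : n = 0 ∧ first t = true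
    · convert (hh t).measurable using 2
      ext s x
      simp [hw, markSeq, hc]
    · have : Function.uncurry (w b t n) =
          fun z : ℝ × ℝ => if z.1 < b then Function.uncurry (f t) z else 1 := by
        ext ⟨s, x⟩
        simp [hw, markSeq, hc, cutoff]
      rw [this]
      exact Measurable.ite (measurableSet_lt measurable_fst measurable_const) (hf t).measurable
        measurable_const
  have hwone : ∀ (b : ℕ) t n s x, n ≠ 0 → (b : ℝ) ≤ s → w b t n s x = 1 := by
    intro b t n s x hn hs
    simp [hw, markSeq, hn, cutoff, not_lt.2 hs]
  have hgm : ∀ b t n, Measurable (markMean (p.fading t) (w b t n)) := fun b t n =>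
    (StronglyMeasurable.integral_prod_right (f := w b t n)
      (hwm b t n).stronglyMeasurable).measurable
  have hg1 : ∀ b t n s, ‖markMean (p.fading t) (w b t n) s‖ ≤ 1 := by
    intro b t n s
    refine (norm_integral_le_of_norm_le_const (Eventually.of_forall (hw1 b t n s))).trans ?_
    simp
  have hgone : ∀ (b : ℕ) t n s, n ≠ 0 → (b : ℝ) ≤ s → markMean (p.fading t) (w b t n) s = 1 := by
    intro b t n s hn hs
    simp [markMean, hwone b t n s _ hn hs]
  have hsupp : ∀ (b : ℕ) t ω (q : ℕ → ℂ), (∀ B : ℝ, {n | arrival p X t n ω ≤ B}.Finite) →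
      (∀ n, n ≠ 0 → (b : ℝ) ≤ arrival p X t n ω → q n = 1) → (Function.mulSupport q).Finite := by
    intro b t ω q hfin hq
    refine ((hfin b).union (finite_singleton 0)).subset fun n hn => ?_
    by_contra hcon
    simp only [mem_union, mem_ofPred_eq, mem_singleton_iff, not_or, not_le] at hcon
    exact hn (hq n hcon.2 hcon.1.le)
  have hprod1 : ∀ (S : Finset ℕ) (q : ℕ → ℂ), (∀ n, ‖q n‖ ≤ 1) → ‖∏ n ∈ S, q n‖ ≤ 1 := by
    intro S q hq
    rw [norm_prod]
    exact Finset.prod_le_one (fun _ _ => norm_nonneg _) fun n _ => hq n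
  have hprodT : ∀ q : Tier K L → ℂ, (∀ n, ‖q n‖ ≤ 1) → ‖∏ n, q n‖ ≤ 1 := by
    intro q hq
    rw [norm_prod]
    exact Finset.prod_le_one (fun _ _ => norm_nonneg _) fun n _ => hq n
  have hΨm := hnet.fading_measurable
  have hAm : ∀ t n, Measurable (arrival p X t n) := fun t => (hT t).measurable
  have hterm : ∀ b t n, Measurable fun ω => w b t n (arrival p X t n ω) (Ψ t n ω) := fun b t n =>
    (hwm b t n).comp ((hAm t n).prodMk (hΨm t n))
  have hmeasP : ∀ b t, AEStronglyMeasurable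
      (fun ω => ∏ᶠ n, w b t n (arrival p X t n ω) (Ψ t n ω)) μ := by
    intro b t
    refine aestronglyMeasurable_finprod (hterm b t) ?_
    filter_upwards [(hT t).ae_finite] with ω hfin
    exact hsupp b t ω _ hfin fun n hn hs => hwone b t n _ _ hn hs
  -- Averaging over the gains is available for finitely many BSs; with a cutoff almost surely only
  -- finitely many factors matter, and all products are bounded by 1.
  have stepA : ∀ b : ℕ, ∫ ω, ∏ t, ∏ᶠ n, w b t n (arrival p X t n ω) (Ψ t n ω) ∂μ =
      ∏ t, ∫ ω, ∏ᶠ n, markMean (p.fading t) (w b t n) (arrival p X t n ω) ∂μ := by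
    intro b
    have l1 : Tendsto (fun N => ∫ ω, ∏ t, ∏ n ∈ Finset.range N,
        w b t n (arrival p X t n ω) (Ψ t n ω) ∂μ) atTop
        (𝓝 (∫ ω, ∏ t, ∏ᶠ n, w b t n (arrival p X t n ω) (Ψ t n ω) ∂μ)) := by
      refine tendsto_integral_of_dominated_convergence (fun _ => 1) (fun N => ?_)
        (integrable_const _) (fun N => Eventually.of_forall fun ω => ?_) ?_
      · exact (Finset.measurable_prod _ fun t _ => Finset.measurable_prod _ fun n _ =>
          hterm b t n).aestronglyMeasurable
      · exact hprodT _ fun t => hprod1 _ _ fun n => hw1 _ _ _ _ _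
      · filter_upwards [ae_all_iff.2 fun t => (hT t).ae_finite] with ω hfin
        exact tendsto_finsetProd _ fun t _ => tendsto_prod_range_finprod
          (hsupp b t ω _ (hfin t) fun n hn hs => hwone b t n _ _ hn hs)
    have l2 : Tendsto (fun N => ∏ t, ∫ ω, ∏ n ∈ Finset.range N,
        markMean (p.fading t) (w b t n) (arrival p X t n ω) ∂μ) atTop
        (𝓝 (∏ t, ∫ ω, ∏ᶠ n, markMean (p.fading t) (w b t n) (arrival p X t n ω) ∂μ)) := by
      refine tendsto_finsetProd _ fun t _ => ?_
      refine tendsto_integral_of_dominated_convergence (fun _ => 1) (fun N => ?_)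
        (integrable_const _) (fun N => Eventually.of_forall fun ω => ?_) ?_
      · exact (Finset.measurable_prod _ fun n _ =>
          (hgm b t n).comp (hAm t n)).aestronglyMeasurable
      · exact hprod1 _ _ fun n => hg1 _ _ _ _
      · filter_upwards [(hT t).ae_finite] with ω hfin
        exact tendsto_prod_range_finprod
          (hsupp b t ω _ hfin fun n hn hs => hgone b t n _ hn hs)
    refine tendsto_nhds_unique l1 (l2.congr fun N => ?_)
    exact (hnet.integral_prod_marks hp (w b) (hwm b) (hw1 b) N).symm
  -- Removal of the cutoff, inside the expectation by `tendsto_finprod_cutoff` and in the closed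
  -- form by `tendsto_tailPGF_cutoff`.
  have l3 : Tendsto (fun b : ℕ => ∫ ω, ∏ t, ∏ᶠ n, w b t n (arrival p X t n ω) (Ψ t n ω) ∂μ) atTop
      (𝓝 (∫ ω, ∏ t, Z t ω ∂μ)) := by
    refine tendsto_integral_of_dominated_convergence (fun _ => 1) (fun b => ?_)
      (integrable_const _) (fun N => Eventually.of_forall fun ω => ?_) ?_
    · exact Finset.aestronglyMeasurable_fun_prod _ fun t _ => hmeasP b t
    · exact hprodT _ fun t => norm_finprod_le_one fun n => hw1 _ _ _ _ _
    · filter_upwards [ae_all_iff.2 fun t => (hT t).ae_finite, ae_all_iff.2 fun t => (hT t).mono,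
        ae_all_iff.2 hZ] with ω hfin hmono hZ
      exact tendsto_finsetProd _ fun t _ => tendsto_finprod_cutoff (hmono t) (hfin t) (hZ t)
  have l4 : Tendsto (fun b : ℕ => ∏ t, ∫ ω, ∏ᶠ n,
      markMean (p.fading t) (w b t n) (arrival p X t n ω) ∂μ) atTop
      (𝓝 (∏ t, tierValue (first t) (p.fading t) (h t) (f t))) := by
    refine tendsto_finsetProd _ fun t _ => ?_
    simp only [hw]
    simp_rw [(hT t).integral_finprod_markSeq (hh t) (hf t)]
    unfold tierValue
    split_ifs with hft
    · have hgf := (hf t).norm_markMean_le_one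
      have hci := fun b : ℕ => integrableOn_one_sub_of_eq_one
        (measurable_cutoff (hf t).measurable_markMean b) (norm_cutoff_le_one hgf b)
        (fun s hs => cutoff_eq_one _ hs)
      refine tendsto_integral_of_dominated_convergence (fun s => Real.exp (-s)) (fun b => ?_)
        integrableOn_cexp_neg_Ioi (fun b => ?_) ?_
      · refine AEStronglyMeasurable.mul (by fun_prop) (AEStronglyMeasurable.mul
          (hh t).measurable_markMean.aestronglyMeasurable ?_)
        exact ((continuousOn_tailPGF (hci b 0)).mono Ioi_subset_Ici_self).aestronglyMeasurable
          measurableSet_Ioi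
      · refine Eventually.of_forall fun s => ?_
        rw [norm_mul, norm_mul, Complex.norm_exp]
        simp only [Complex.neg_re, Complex.ofReal_re]
        refine mul_le_of_le_one_right (Real.exp_pos _).le (mul_le_one₀
          ((hh t).norm_markMean_le_one s) (norm_nonneg _)
          (norm_tailPGF_le_one (norm_cutoff_le_one hgf b) (hci b s)))
      · refine (ae_restrict_iff' measurableSet_Ioi).2 (Eventually.of_forall fun s hs => ?_)
        exact ((tendsto_tailPGF_cutoff ((hint t).mono_set (Ioi_subset_Ioi (le_of_lt hs)))).const_mul
          _).const_mul _
    · exact tendsto_tailPGF_cutoff (hint t)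
  simp_rw [stepA] at l3
  exact tendsto_nhds_unique l3 l4

end

/-! ### Gamma and Lévy integrals with a complex scale. -/

section Calculus

variable {E : Type*} [NormedAddCommGroup E] [NormedSpace ℝ E]

/-- The substitution s = k x^(-a), by which arrival times are exchanged for received powers. -/
lemma integral_Ioi_eq_integral_comp_rpow_neg {a k : ℝ} (ha : 0 < a) (hk : 0 < k) (φ : ℝ → E) :
    ∫ s in Ioi 0, φ s = ∫ x in Ioi 0, (k * a * x ^ (-a - 1)) • φ (k * x ^ (-a)) := by
  have h1 := integral_comp_rpow_Ioi (fun y => φ (k * y)) (neg_ne_zero.2 ha.ne')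
  have h2 := integral_comp_mul_left_Ioi φ 0 hk
  rw [mul_zero] at h2
  rw [← h1] at h2
  have h3 : ∫ s in Ioi 0, φ s = k • ∫ x in Ioi 0, (|-a| * x ^ (-a - 1)) • φ (k * x ^ (-a)) := by
    rw [h2, smul_smul, mul_inv_cancel₀ hk.ne', one_smul]
  rw [h3, ← integral_smul]
  simp_rw [smul_smul, abs_neg, abs_of_pos ha, mul_assoc]

lemma integrableOn_Ioi_iff_comp_rpow_neg {a k : ℝ} (ha : 0 < a) (hk : 0 < k) (φ : ℝ → E) :
    IntegrableOn φ (Ioi 0) ↔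
      IntegrableOn (fun x => (k * a * x ^ (-a - 1)) • φ (k * x ^ (-a))) (Ioi 0) := by
  have h1 := integrableOn_Ioi_comp_rpow_iff (fun y => φ (k * y)) (neg_ne_zero.2 ha.ne')
  have h2 := integrableOn_Ioi_comp_mul_left_iff φ 0 hk
  rw [mul_zero] at h2
  rw [← h2, ← h1]
  have h3 : (fun x : ℝ => (k * a * x ^ (-a - 1)) • φ (k * x ^ (-a))) =
      k • fun x : ℝ => (|-a| * x ^ (-a - 1)) • φ (k * x ^ (-a)) := by
    ext x
    simp only [Pi.smul_apply, smul_smul, abs_neg, abs_of_pos ha, mul_assoc]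
  rw [h3, IntegrableOn, IntegrableOn, integrable_smul_iff hk.ne']

/-- Linear vanishing at 0 gives x^(-a), integrable there since a < 1; boundedness at infinity leaves
x^(-a-1), integrable there since a > 0. -/
lemma integrableOn_rpow_smul {a M : ℝ} (ha0 : 0 < a) (ha1 : a < 1) {φ : ℝ → E}
    (hm : AEStronglyMeasurable φ (volume.restrict (Ioi 0))) (h1 : ∀ x, 0 < x → x ≤
        1 → ‖φ x‖ ≤ M * x)
    (h2 : ∀ x, 1 < x → ‖φ x‖ ≤ M) :
    IntegrableOn (fun x => x ^ (-a - 1) • φ x) (Ioi 0) := by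
  have hm' : AEStronglyMeasurable (fun x : ℝ => x ^ (-a - 1) • φ x) (volume.restrict (Ioi 0)) := by
    refine AEStronglyMeasurable.smul ?_ hm
    exact Measurable.aestronglyMeasurable (by fun_prop)
  rw [← Ioc_union_Ioi_eq_Ioi zero_le_one]
  refine IntegrableOn.union ?_ ?_
  · have hi : IntegrableOn (fun x : ℝ => M * x ^ (-a)) (Ioc 0 1) := by
      have := intervalIntegral.intervalIntegrable_rpow' (a := 0) (b := 1) (r := -a) (by linarith)
      rw [intervalIntegrable_iff_integrableOn_Ioc_of_le zero_le_one] at this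
      exact this.const_mul M
    refine hi.mono' (hm'.mono_set Ioc_subset_Ioi_self) ?_
    refine (ae_restrict_iff' measurableSet_Ioc).2 (Eventually.of_forall fun x hx => ?_)
    have hx0 : 0 < x := hx.1
    rw [norm_smul, Real.norm_of_nonneg (by positivity)]
    calc x ^ (-a - 1) * ‖φ x‖ ≤ x ^ (-a - 1) * (M * x) := by gcongr; exact h1 x hx.1 hx.2
      _ = M * (x ^ (-a - 1) * x ^ (1 : ℝ)) := by rw [Real.rpow_one]; ring
      _ = M * x ^ (-a) := by rw [← Real.rpow_add hx0]; ring_nf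
  · have hi : IntegrableOn (fun x : ℝ => x ^ (-a - 1) * M) (Ioi 1) :=
      (integrableOn_Ioi_rpow_of_lt (by linarith) one_pos).mul_const M
    refine hi.mono' (hm'.mono_set (Ioi_subset_Ioi zero_le_one)) ?_
    refine (ae_restrict_iff' measurableSet_Ioi).2 (Eventually.of_forall fun x hx => ?_)
    have hx0 : 0 < x := one_pos.trans hx
    rw [norm_smul, Real.norm_of_nonneg (by positivity)]
    gcongr
    exact h2 x hx

/-- Mean value inequality on the half-plane of nonnegative real part, which is convex and where the
derivative of exp(-w) has norm at most 1. -/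
lemma norm_one_sub_exp_neg_le {z : ℂ} (hz : 0 ≤ z.re) : ‖1 - Complex.exp (-z)‖ ≤ ‖z‖ := by
  have h := Convex.norm_image_sub_le_of_norm_hasDerivWithin_le (𝕜 := ℂ) (s := {w : ℂ | 0 ≤ w.re})
    (f := fun w => Complex.exp (-w)) (f' := fun w => -Complex.exp (-w)) (C := 1) (x := z) (y := 0)
    (fun w _ => by
      have := ((hasDerivAt_neg w).cexp).hasDerivWithinAt (s := {w : ℂ | 0 ≤ w.re})
      simpa using this)
    (fun w hw => by
      have : 0 ≤ w.re := hw
      rw [norm_neg, Complex.norm_exp]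
      simpa using this) (convex_halfSpace_re_ge 0) hz (by simp)
  simpa using h

lemma norm_one_sub_exp_neg_le_two {z : ℂ} (hz : 0 ≤ z.re) : ‖1 - Complex.exp (-z)‖ ≤ 2 := by
  refine (norm_sub_le _ _).trans ?_
  rw [norm_one, Complex.norm_exp, Complex.neg_re]
  have := Real.exp_le_one_iff.2 (neg_nonpos.2 hz)
  linarith

lemma integrableOn_rpow_smul_one_sub_exp {a : ℝ} (ha0 : 0 < a) (ha1 : a < 1) {z : ℂ}
    (hz : 0 ≤ z.re) :
    IntegrableOn (fun x : ℝ => x ^ (-a - 1) • (1 - Complex.exp (-(z * x)))) (Ioi 0) := by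
  have hre : ∀ x : ℝ, 0 ≤ x → 0 ≤ (z * x).re := fun x hx => by
    simpa using mul_nonneg hz hx
  refine integrableOn_rpow_smul (M := max 2 ‖z‖) ha0 ha1
    (Continuous.aestronglyMeasurable (by fun_prop)) (fun x hx0 hx1 => ?_) (fun x hx => ?_)
  · refine (norm_one_sub_exp_neg_le (hre x hx0.le)).trans ?_
    rw [norm_mul, Complex.norm_real, Real.norm_of_nonneg hx0.le]
    gcongr
    exact le_max_right _ _
  · exact (norm_one_sub_exp_neg_le_two (hre x (by linarith))).trans (le_max_left _ _)

lemma integrableOn_cpow_mul_exp_neg_mul {b : ℝ} (hb : 0 < b) {z : ℂ} (hz : 0 < z.re) :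
    IntegrableOn (fun x : ℝ => (x : ℂ) ^ ((b : ℂ) - 1) * Complex.exp (-(z * x))) (Ioi 0) := by
  have h := integrableOn_rpow_mul_exp_neg_mul_rpow (p := 1) (s := b - 1) (b := z.re)
    (by linarith) one_pos hz
  refine h.mono' (Measurable.aestronglyMeasurable (by fun_prop)) ?_
  refine (ae_restrict_iff' measurableSet_Ioi).2 (Eventually.of_forall fun x hx => ?_)
  have hx0 : 0 < x := hx
  rw [norm_mul, Complex.norm_exp, Complex.norm_cpow_eq_rpow_re_of_pos hx0]
  simp

/-- Differentiation under the integral: on the ball of radius Re z / 2 around z the exponential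
decays at rate at least Re z / 2. -/
lemma differentiableOn_integral_cpow_mul_exp_neg_mul {b : ℝ} (hb : 0 < b) :
    DifferentiableOn ℂ (fun z : ℂ => ∫ x in Ioi (0 : ℝ),
      (x : ℂ) ^ ((b : ℂ) - 1) * Complex.exp (-(z * x))) {z | 0 < z.re} := by
  intro z hz
  have hz' : 0 < z.re := hz
  have hbd := integrableOn_rpow_mul_exp_neg_mul_rpow (p := 1) (s := b) (b := z.re / 2)
    (by linarith) one_pos (by linarith)
  refine (hasDerivAt_integral_of_dominated_loc_of_deriv_le (μ := volume.restrict (Ioi (0 : ℝ)))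
    (s := Metric.ball z (z.re / 2)) (x₀ := z)
    (F := fun z x => (x : ℂ) ^ ((b : ℂ) - 1) * Complex.exp (-(z * x)))
    (F' := fun z x => (x : ℂ) ^ ((b : ℂ) - 1) * (Complex.exp (-(z * x)) * (-x)))
    (bound := fun x => x ^ b * Real.exp (-(z.re / 2) * x ^ (1 : ℝ)))
    (Metric.ball_mem_nhds _ (by linarith))
    (Eventually.of_forall fun w => Measurable.aestronglyMeasurable (by fun_prop))
    (integrableOn_cpow_mul_exp_neg_mul hb hz') (Measurable.aestronglyMeasurable (by fun_prop))
    ?_ hbd ?_).2.differentiableAt.differentiableWithinAt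
  · refine (ae_restrict_iff' measurableSet_Ioi).2 (Eventually.of_forall fun x hx w hw => ?_)
    have hx0 : 0 < x := hx
    have hw1 : z.re / 2 ≤ w.re := by
      have h1 := (Complex.abs_re_le_norm (w - z)).trans (le_of_lt (mem_ball_iff_norm.1 hw))
      rw [Complex.sub_re] at h1
      linarith [(abs_le.1 h1).1]
    rw [norm_mul, norm_mul, Complex.norm_exp, Complex.norm_cpow_eq_rpow_re_of_pos hx0, norm_neg,
      Complex.norm_real, Real.norm_of_nonneg hx0.le]
    simp only [Complex.sub_re, Complex.ofReal_re, Complex.one_re, Complex.neg_re, Complex.mul_re,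
      Complex.ofReal_im, mul_zero, sub_zero, Real.rpow_one]
    have h2 : x ^ b = x ^ (b - 1) * x := by
      rw [Real.rpow_sub_one hx0.ne', div_mul_cancel₀ _ hx0.ne']
    rw [h2]
    calc x ^ (b - 1) * (Real.exp (-(w.re * x)) * x)
        ≤ x ^ (b - 1) * (Real.exp (-(z.re / 2) * x) * x) := by
          gcongr
          nlinarith
      _ = _ := by ring
  · refine Eventually.of_forall fun x w _ => HasDerivAt.const_mul _ ?_
    have := ((hasDerivAt_id w).mul_const (x : ℂ)).neg.cexp
    simpa using this

/-- Euler's integral with a complex scale. -/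
lemma integral_cpow_mul_exp_neg_mul_Ioi_of_re_pos {b : ℝ} (hb : 0 < b) {z : ℂ} (hz : 0 < z.re) :
    ∫ x in Ioi (0 : ℝ), (x : ℂ) ^ ((b : ℂ) - 1) * Complex.exp (-(z * x)) =
      (1 / z) ^ (b : ℂ) * Complex.Gamma b := by
  have hopen : IsOpen {z : ℂ | 0 < z.re} := isOpen_lt continuous_const Complex.continuous_re
  have h1 := (differentiableOn_integral_cpow_mul_exp_neg_mul hb).analyticOnNhd hopen
  have h2 : DifferentiableOn ℂ (fun z : ℂ => (1 / z) ^ (b : ℂ) * Complex.Gamma b)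
      {z | 0 < z.re} := by
    intro z hz
    have hz' : 0 < z.re := hz
    have hz0 : z ≠ 0 := fun h => by simp [h] at hz'
    have hs : 1 / z ∈ Complex.slitPlane := by
      left
      rw [one_div, Complex.inv_re]
      exact div_pos hz' (Complex.normSq_pos.2 hz0)
    exact (((differentiableAt_const 1).div differentiableAt_id hz0).cpow_const
      hs).mul_const _ |>.differentiableWithinAt
  -- Identity theorem: both sides are analytic on the right half-plane and agree at real points near
  -- 1.
  refine h1.eqOn_of_preconnected_of_frequently_eq (h2.analyticOnNhd hopen)
    (convex_halfSpace_re_gt 0).isPreconnected (z₀ := 1) (by simp) ?_ hz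
  have ht : Tendsto (fun x : ℝ => (x : ℂ)) (𝓝[≠] 1) (𝓝[≠] 1) := by
    refine tendsto_nhdsWithin_iff.2 ⟨?_, ?_⟩
    · exact (Complex.continuous_ofReal.tendsto' 1 1 (by simp)).mono_left nhdsWithin_le_nhds
    · filter_upwards [self_mem_nhdsWithin] with x hx
      simpa using hx
  refine ht.frequently (Eventually.frequently ?_)
  filter_upwards [mem_nhdsWithin_of_mem_nhds (Ioi_mem_nhds (zero_lt_one (α := ℝ)))] with x hx
  exact Complex.integral_cpow_mul_exp_neg_mul_Ioi (by simpa using hb) hx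

/-- Integration by parts with the primitive -x^(-a) of a x^(-a-1) reduces the claim to Euler's
integral with exponent 1 - a. The boundary terms vanish at both ends because 0 < a < 1. -/
lemma integral_rpow_smul_one_sub_exp_of_re_pos {a : ℝ} (ha0 : 0 < a) (ha1 : a < 1) {z : ℂ}
    (hz : 0 < z.re) :
    ∫ x in Ioi (0 : ℝ), (a * x ^ (-a - 1)) • (1 - Complex.exp (-(z * x))) =
      z ^ (a : ℂ) * Real.Gamma (1 - a) := by
  have hz0 : z ≠ 0 := fun h => by simp [h] at hz
  have hre : ∀ x : ℝ, 0 ≤ x → 0 ≤ (z * x).re := fun x hx => by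
    simpa using mul_nonneg hz.le hx
  have hG : ∫ x in Ioi (0 : ℝ), (x : ℂ) ^ (((1 - a : ℝ) : ℂ) - 1) * Complex.exp (-(z * x)) =
      (1 / z) ^ (((1 - a : ℝ) : ℂ)) * Complex.Gamma ((1 - a : ℝ) : ℂ) :=
    integral_cpow_mul_exp_neg_mul_Ioi_of_re_pos (by linarith) hz
  have e1 : ∀ x ∈ Ioi (0 : ℝ), (x : ℂ) ^ (((1 - a : ℝ) : ℂ) - 1) * Complex.exp (-(z * x)) =
      x ^ (-a) • Complex.exp (-(z * x)) := by
    intro x hx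
    rw [Complex.real_smul, Complex.ofReal_cpow (le_of_lt hx)]
    congr 2
    push_cast; ring
  have hI1 : IntegrableOn (fun x : ℝ => x ^ (-a) • Complex.exp (-(z * x))) (Ioi 0) := by
    have h := integrableOn_rpow_mul_exp_neg_mul_rpow (p := 1) (s := -a) (b := z.re)
      (by linarith) one_pos hz
    refine h.mono' (Measurable.aestronglyMeasurable (by fun_prop)) ?_
    refine (ae_restrict_iff' measurableSet_Ioi).2 (Eventually.of_forall fun x hx => ?_)
    have hx0 : 0 < x := hx
    rw [norm_smul, Real.norm_of_nonneg (by positivity), Complex.norm_exp]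
    simp
  have hI2 : IntegrableOn (fun x : ℝ => a • x ^ (-a - 1) • (1 - Complex.exp (-(z * x)))) (Ioi 0) :=
    (integrableOn_rpow_smul_one_sub_exp ha0 ha1 hz.le).smul a
  have hFTC := integral_Ioi_of_hasDerivAt_of_tendsto (a := (0 : ℝ)) (m := 0)
    (f := fun x : ℝ => -(x ^ (-a) • (1 - Complex.exp (-(z * x)))))
    (f' := fun x : ℝ => a • (x ^ (-a - 1) • (1 - Complex.exp (-(z * x)))) -
      z * (x ^ (-a) • Complex.exp (-(z * x)))) ?_ ?_ ?_ ?_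
  · rw [integral_sub hI2 (hI1.const_mul z), integral_const_mul] at hFTC
    simp only [neg_zero, Real.zero_rpow (neg_ne_zero.2 ha0.ne'), zero_smul, sub_zero] at hFTC
    rw [sub_eq_zero, ← setIntegral_congr_fun measurableSet_Ioi e1, hG] at hFTC
    simp_rw [mul_smul]
    rw [hFTC, Complex.Gamma_ofReal, ← mul_assoc]
    congr 1
    have hslit : z.arg ≠ Real.pi := fun h => by
      rw [Complex.arg_eq_pi_iff] at h; linarith [h.1]
    rw [one_div, Complex.inv_cpow _ _ hslit, ← Complex.cpow_neg]
    nth_rewrite 1 [← Complex.cpow_one z]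
    rw [← Complex.cpow_add _ _ hz0]
    congr 1
    push_cast; ring
  -- Near 0 the function is O(x^(1-a)), so its limit is the conventional value 0 at x = 0.
  · refine ContinuousWithinAt.neg ?_
    have : Tendsto (fun x : ℝ => x ^ (-a) • (1 - Complex.exp (-(z * x)))) (𝓝[≥] 0) (𝓝 0) := by
      refine squeeze_zero_norm' (a := fun x : ℝ => ‖z‖ * x ^ (1 - a)) ?_ ?_
      · filter_upwards [self_mem_nhdsWithin] with x hx
        rcases eq_or_lt_of_le (mem_Ici.1 hx) with rfl | hx0
        · simp [Real.zero_rpow (sub_ne_zero.2 ha1.ne')]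
        · rw [norm_smul, Real.norm_of_nonneg (by positivity)]
          calc x ^ (-a) * ‖1 - Complex.exp (-(z * x))‖ ≤ x ^ (-a) * (‖z‖ * x) := by
                gcongr
                refine (norm_one_sub_exp_neg_le (hre x hx0.le)).trans_eq ?_
                rw [norm_mul, Complex.norm_real, Real.norm_of_nonneg hx0.le]
            _ = ‖z‖ * (x ^ (-a) * x ^ (1 : ℝ)) := by rw [Real.rpow_one]; ring
            _ = ‖z‖ * x ^ (1 - a) := by rw [← Real.rpow_add hx0]; ring_nf
      · have h := (Real.continuousAt_rpow_const 0 (1 - a) (Or.inr (by linarith))).tendsto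
        rw [Real.zero_rpow (by linarith)] at h
        have := (h.mono_left (nhdsWithin_le_nhds (s := Ici 0))).const_mul ‖z‖
        simpa using this
    unfold ContinuousWithinAt
    simpa [Real.zero_rpow (neg_ne_zero.2 ha0.ne')] using this
  · intro x hx
    have hx0 : x ≠ 0 := (ne_of_gt hx)
    have h1 := Real.hasDerivAt_rpow_const (x := x) (p := -a) (Or.inl hx0)
    have h2 : HasDerivAt (fun x : ℝ => 1 - Complex.exp (-(z * x))) (z *
        Complex.exp (-(z * x))) x := by
      have h3 : HasDerivAt (fun x : ℝ => -(z * (x : ℂ))) (-(z * 1)) x :=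
        ((Complex.ofRealCLM.hasDerivAt (x := x)).const_mul z).neg
      refine HasDerivAt.congr_deriv ((h3.cexp).const_sub 1) ?_
      ring
    refine HasDerivAt.congr_deriv (h1.smul h2).neg ?_
    simp only [Complex.real_smul]
    push_cast
    ring
  · exact hI2.sub (hI1.const_mul z)
  · refine squeeze_zero_norm' (a := fun x : ℝ => x ^ (-a) * 2) ?_ ?_
    · filter_upwards [eventually_gt_atTop 0] with x hx
      rw [norm_neg, norm_smul, Real.norm_of_nonneg (by positivity)]
      gcongr
      exact norm_one_sub_exp_neg_le_two (hre x hx.le)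
    · simpa using (tendsto_rpow_neg_atTop ha0).mul_const 2

/-- The Lévy integral of a positive stable law. -/
theorem integral_rpow_smul_one_sub_exp {a : ℝ} (ha0 : 0 < a) (ha1 : a < 1) {w : ℝ} (hw : w ≠ 0) :
    ∫ x in Ioi (0 : ℝ), (a * x ^ (-a - 1)) • (1 - Complex.exp (-(Complex.I * w * x))) =
      (Complex.I * w) ^ (a : ℂ) * Real.Gamma (1 - a) := by
  -- The point iw is approached from the right half-plane; for w ≠ 0 it lies in the slit plane,
  -- where the principal power is continuous.
  set z : ℕ → ℂ := fun n => (1 / ((n : ℝ) + 1) : ℝ) + Complex.I * w with hz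
  have hzre : ∀ n, (z n).re = 1 / ((n : ℝ) + 1) := fun n => by
    rw [hz, Complex.add_re, Complex.ofReal_re]; simp
  have hzpos : ∀ n, 0 < (z n).re := fun n => by rw [hzre]; positivity
  have hzt : Tendsto z atTop (𝓝 (Complex.I * w)) := by
    have h1 := (Complex.continuous_ofReal.tendsto _).comp
      (tendsto_one_div_add_atTop_nhds_zero_nat (𝕜 := ℝ))
    simpa [Function.comp_def, hz] using h1.add_const (Complex.I * w)
  have hznorm : ∀ n, ‖z n‖ ≤ 1 + |w| := by
    intro n
    refine (norm_add_le _ _).trans ?_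
    rw [Complex.norm_real, norm_mul, Complex.norm_I, one_mul, Complex.norm_real, Real.norm_eq_abs,
      Real.norm_eq_abs, abs_of_nonneg (by positivity)]
    gcongr
    rw [div_le_one (by positivity)]
    have : (0 : ℝ) ≤ n := by positivity
    linarith
  have hslit : Complex.I * w ∈ Complex.slitPlane := Or.inr (by simpa using hw)
  have hR : Tendsto (fun n => z n ^ (a : ℂ) * (Real.Gamma (1 - a) : ℂ)) atTop
      (𝓝 ((Complex.I * w) ^ (a : ℂ) * Real.Gamma (1 - a))) :=
    (((continuousAt_cpow_const hslit).tendsto.comp hzt)).mul_const _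
  refine tendsto_nhds_unique ?_ hR
  simp_rw [← fun n => integral_rpow_smul_one_sub_exp_of_re_pos ha0 ha1 (hzpos n)]
  -- A dominating function uniform in n, since ‖z n‖ ≤ 1 + |w|.
  have hb : IntegrableOn (fun x : ℝ => x ^ (-a - 1) • (a * min 2 ((1 + |w|) * x))) (Ioi 0) := by
    refine integrableOn_rpow_smul (M := a * (2 + |w|)) ha0 ha1
      (Continuous.aestronglyMeasurable (by fun_prop)) (fun x hx0 hx1 => ?_) (fun x hx => ?_)
    · rw [Real.norm_of_nonneg (by positivity), mul_assoc]
      gcongr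
      exact (min_le_right _ _).trans (by gcongr; linarith)
    · have hx0 : 0 < x := by linarith
      rw [Real.norm_of_nonneg (by positivity)]
      gcongr
      exact (min_le_left _ _).trans (by linarith [abs_nonneg w])
  refine tendsto_integral_of_dominated_convergence _ (fun n => ?_) hb (fun n => ?_) ?_
  · exact Measurable.aestronglyMeasurable (by fun_prop)
  · refine (ae_restrict_iff' measurableSet_Ioi).2 (Eventually.of_forall fun x hx => ?_)
    have hx0 : 0 < x := hx
    have hre : 0 ≤ (z n * x).re := by
      simpa using mul_nonneg (hzpos n).le hx0.le
    rw [norm_smul, Real.norm_of_nonneg (by positivity), smul_eq_mul, mul_comm a, mul_assoc]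
    gcongr
    refine le_min (norm_one_sub_exp_neg_le_two hre) ((norm_one_sub_exp_neg_le hre).trans ?_)
    rw [norm_mul, Complex.norm_real, Real.norm_of_nonneg hx0.le]
    gcongr
    exact hznorm n
  · refine Eventually.of_forall fun x => Tendsto.const_smul ?_ _
    refine tendsto_const_nhds.sub ((Complex.continuous_exp.tendsto _).comp ?_)
    exact (hzt.mul_const _).neg

end Calculus

/-! ### Incomplete Gamma integrals and the received powers of one tier. -/

lemma ofReal_mul_cpow {r : ℝ} (hr : 0 < r) {z : ℂ} (hz : z ≠ 0) (b : ℂ) :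
    ((r : ℂ) * z) ^ b = (r : ℂ) ^ b * z ^ b := by
  have hr' : (r : ℂ) ≠ 0 := by exact_mod_cast hr.ne'
  rw [Complex.cpow_def_of_ne_zero (mul_ne_zero hr' hz), Complex.cpow_def_of_ne_zero hr',
    Complex.cpow_def_of_ne_zero hz, Complex.log_ofReal_mul hr hz, ← Complex.exp_add,
    ← Complex.ofReal_log hr.le]
  ring_nf

/-- The upper incomplete Gamma function on a ray. -/
lemma incGamma_eq (a : ℝ) {z : ℂ} {ρ : ℝ} (hz : z ≠ 0) (hρ : 0 < ρ) :
    incGamma (-(a : ℂ)) (z * ρ) = z ^ (-(a : ℂ)) *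
      ∫ x in Ioi ρ, x ^ (-a - 1) • Complex.exp (-(z * x)) := by
  have h := integral_comp_mul_left_Ioi (fun x : ℝ => x ^ (-a - 1) • Complex.exp (-(z * x))) 1 hρ
  rw [mul_one] at h
  have h2 : ∫ x in Ioi ρ, x ^ (-a - 1) • Complex.exp (-(z * x)) =
      ρ • ∫ r in Ioi (1 : ℝ), (ρ * r) ^ (-a - 1) • Complex.exp (-(z * (ρ * r : ℝ))) := by
    rw [h, smul_smul, mul_inv_cancel₀ hρ.ne', one_smul]
  rw [h2, incGamma, Complex.real_smul, ← mul_assoc, ← integral_const_mul]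
  refine setIntegral_congr_fun measurableSet_Ioi fun r hr => ?_
  have hr0 : 0 < r := one_pos.trans hr
  have e1 : (r : ℂ) * (z * ρ) = ((ρ * r : ℝ) : ℂ) * z := by push_cast; ring
  have e2 : (((ρ * r : ℝ) : ℂ)) ^ (-(a : ℂ) - 1) = (((ρ * r) ^ (-a - 1) : ℝ) : ℂ) := by
    rw [Complex.ofReal_cpow (by positivity)]
    push_cast; rfl
  have e3 : z ^ (-(a : ℂ) - 1) * z = z ^ (-(a : ℂ)) := by
    rw [Complex.cpow_sub _ _ hz, Complex.cpow_one, div_mul_cancel₀ _ hz]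
  rw [e1, ofReal_mul_cpow (by positivity) hz, e2, ← e3, Complex.real_smul,
    mul_comm z ((ρ * r : ℝ) : ℂ)]
  ring

/-- The path gain, including the transmit power, of a BS in terms of its arrival time `s`. -/
noncomputable def gain (a c s : ℝ) : ℝ := (c / s) ^ (1 / a)

/-- The data of a tier: the exponent `a = 2 / ε`, the intensity `c = λ π P ^ a` and the law of the
fading gain. -/
structure StableTier (a c : ℝ) (F : Measure ℝ) : Prop where
  exp_pos : 0 < a
  exp_lt_one : a < 1
  int_pos : 0 < c
  prob : IsProbabilityMeasure F
  pos : ∀ᵐ x ∂F, 0 < x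
  moment : Integrable (fun x : ℝ => x ^ a) F

lemma gain_pos {a c s : ℝ} (hc : 0 < c) (hs : 0 < s) : 0 < gain a c s := by
  unfold gain; positivity

/-- The time c ψ^a x^(-a) is the one at which a BS with fading gain ψ is received with power x. -/
lemma gain_mul_rpow {a c ψ x : ℝ} (ha : 0 < a) (hc : 0 < c) (hψ : 0 < ψ) (hx : 0 < x) :
    gain a c (c * ψ ^ a * x ^ (-a)) = x / ψ := by
  unfold gain
  have h1 : c / (c * ψ ^ a * x ^ (-a)) = (x / ψ) ^ a := by
    rw [Real.rpow_neg hx.le, Real.div_rpow hx.le hψ.le]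
    field_simp
  rw [h1, ← Real.rpow_mul (by positivity), mul_one_div_cancel ha.ne', Real.rpow_one]

lemma mul_gain_mul_rpow {a c ψ x : ℝ} (ha : 0 < a) (hc : 0 < c) (hψ : 0 < ψ) (hx : 0 < x) :
    ψ * gain a c (c * ψ ^ a * x ^ (-a)) = x := by
  rw [gain_mul_rpow ha hc hψ hx, mul_div_cancel₀ _ hψ.ne']

lemma gain_antitone {a c s t : ℝ} (ha : 0 < a) (hc : 0 < c) (hs : 0 < s) (hst : s ≤ t) :
    gain a c t ≤ gain a c s := by
  unfold gain
  gcongr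
  have : 0 < t := hs.trans_le hst
  positivity

lemma continuousAt_gain {a c s : ℝ} (ha : 0 < a) (hs : 0 < s) : ContinuousAt (gain a c) s := by
  unfold gain
  exact (continuousAt_const.div continuousAt_id hs.ne').rpow_const (Or.inr (by positivity))

@[fun_prop]
lemma measurable_gain (a c : ℝ) : Measurable (gain a c) := by
  unfold gain; fun_prop

namespace StableTier

variable {a c : ℝ} {F : Measure ℝ} {E : Type*} [NormedAddCommGroup E] [NormedSpace ℝ E]

/-- The received power decreases with the arrival time, so left-continuity in the power becomes
right-continuity in time. -/
lemma markFun (hS : StableTier a c F) {φ : ℝ → ℂ} (hm : Measurable φ) (h1 : ∀ x, ‖φ x‖ ≤ 1)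
    (hc : ∀ x, 0 < x → ContinuousWithinAt φ (Iic x) x) :
    MarkFun F (fun s ψ => φ (ψ * gain a c s)) where
  measurable := by
    unfold Function.uncurry
    fun_prop
  norm_le_one _ _ := h1 _
  right_cont s hs := by
    filter_upwards [hS.pos] with ψ hψ
    have hx : 0 < ψ * gain a c s := mul_pos hψ (gain_pos hS.int_pos hs)
    refine (hc _ hx).tendsto.comp (tendsto_nhdsWithin_iff.2 ⟨?_, ?_⟩)
    · exact (continuousAt_const.mul (continuousAt_gain hS.exp_pos hs)).tendsto.mono_left
        nhdsWithin_le_nhds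
    · filter_upwards [self_mem_nhdsWithin] with r hr
      have := gain_antitone hS.exp_pos hS.int_pos hs (mem_Ici.1 hr)
      exact mul_le_mul_of_nonneg_left this hψ.le

/-- The integrand may also depend on the time itself: for the nearest BS the interference of the
later ones does. -/
lemma integral_comp_gain (hS : StableTier a c F) {ψ : ℝ} (hψ : 0 < ψ) (φ : ℝ → ℝ → E) :
    ∫ s in Ioi 0, φ s (ψ * gain a c s) =
      ∫ x in Ioi 0, (c * ψ ^ a * a * x ^ (-a - 1)) • φ (c * ψ ^ a * x ^ (-a)) x := by
  have hc := hS.int_pos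
  rw [integral_Ioi_eq_integral_comp_rpow_neg hS.exp_pos (by positivity : 0 < c * ψ ^ a)]
  refine setIntegral_congr_fun measurableSet_Ioi fun x hx => ?_
  rw [mul_gain_mul_rpow hS.exp_pos hS.int_pos hψ hx]

lemma integrableOn_comp_gain_iff (hS : StableTier a c F) {ψ : ℝ} (hψ : 0 < ψ) (φ : ℝ → ℝ → E) :
    IntegrableOn (fun s => φ s (ψ * gain a c s)) (Ioi 0) ↔
      IntegrableOn (fun x => (c * ψ ^ a * a * x ^ (-a - 1)) • φ (c * ψ ^ a * x ^ (-a)) x)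
        (Ioi 0) := by
  have hc := hS.int_pos
  rw [integrableOn_Ioi_iff_comp_rpow_neg hS.exp_pos (by positivity : 0 < c * ψ ^ a)]
  refine integrableOn_congr_fun (fun x hx => ?_) measurableSet_Ioi
  rw [mul_gain_mul_rpow hS.exp_pos hS.int_pos hψ hx]

/-- After the substitution the gain enters only as the factor ψ^a, which is where the moment of
order a is used. -/
lemma integrable_prod_comp_gain (hS : StableTier a c F) {φ : ℝ → ℂ} (hm : Measurable φ)
    (hi : IntegrableOn (fun x => x ^ (-a - 1) • φ x) (Ioi 0)) :
    Integrable (fun z : ℝ × ℝ => φ (z.2 * gain a c z.1)) ((volume.restrict (Ioi 0)).prod F) := by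
  have := hS.prob
  have hsm : AEStronglyMeasurable (fun z : ℝ × ℝ => φ (z.2 * gain a c z.1))
      ((volume.restrict (Ioi 0)).prod F) := Measurable.aestronglyMeasurable (by fun_prop)
  rw [integrable_prod_iff' hsm]
  constructor
  · filter_upwards [hS.pos] with ψ hψ
    refine (hS.integrableOn_comp_gain_iff hψ (fun _ y => φ y)).2 ?_
    have := hi.smul (c * ψ ^ a * a)
    refine this.congr (Eventually.of_forall fun x => ?_)
    simp only [Pi.smul_apply, smul_smul]
  · have h1 : ∀ᵐ ψ ∂F, ψ ^ a * (c * a * ∫ x in Ioi 0, ‖x ^ (-a - 1) • φ x‖) =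
        ∫ s in Ioi 0, ‖φ (ψ * gain a c s)‖ := by
      filter_upwards [hS.pos] with ψ hψ
      rw [hS.integral_comp_gain hψ (fun _ y => ‖φ y‖), ← integral_const_mul, ← integral_const_mul]
      refine setIntegral_congr_fun measurableSet_Ioi fun x hx => ?_
      have hx0 : 0 < x := hx
      simp only [norm_smul, Real.norm_of_nonneg (Real.rpow_nonneg hx0.le _), smul_eq_mul]
      ring
    exact (hS.moment.mul_const _).congr h1

/-- Campbell's formula for the received powers of a tier. -/
lemma integral_markMean (hS : StableTier a c F) {φ : ℝ → ℂ} (hm : Measurable φ)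
    (hi : IntegrableOn (fun x => x ^ (-a - 1) • φ x) (Ioi 0)) :
    ∫ s in Ioi 0, ∫ ψ, φ (ψ * gain a c s) ∂F =
      (c * ∫ ψ, ψ ^ a ∂F : ℝ) * ∫ x in Ioi 0, (a * x ^ (-a - 1)) • φ x := by
  have := hS.prob
  rw [integral_integral_swap (f := fun s ψ => φ (ψ * gain a c s))
    (hS.integrable_prod_comp_gain hm hi)]
  have h1 : ∀ᵐ ψ ∂F, ∫ s in Ioi 0, φ (ψ * gain a c s) =
      ((ψ ^ a : ℝ) : ℂ) * (c * ∫ x in Ioi 0, (a * x ^ (-a - 1)) • φ x) := by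
    filter_upwards [hS.pos] with ψ hψ
    rw [hS.integral_comp_gain hψ (fun _ y => φ y), ← integral_const_mul, ← integral_const_mul]
    refine setIntegral_congr_fun measurableSet_Ioi fun x hx => ?_
    simp only [Complex.real_smul]
    push_cast
    ring
  rw [integral_congr_ae h1, integral_mul_const, integral_complex_ofReal]
  push_cast
  ring

lemma integrableOn_one_sub_markMean (hS : StableTier a c F) {φ : ℝ → ℂ} (hm : Measurable φ)
    (h1 : ∀ x, ‖φ x‖ ≤ 1) (hi : IntegrableOn (fun x => x ^ (-a - 1) • (1 - φ x)) (Ioi 0)) :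
    IntegrableOn (fun s => 1 - markMean F (fun s ψ => φ (ψ * gain a c s)) s) (Ioi 0) := by
  have := hS.prob
  have h := (hS.integrable_prod_comp_gain (φ := fun x => 1 - φ x) (by fun_prop)
      hi).integral_prod_left
  refine h.congr (Eventually.of_forall fun s => ?_)
  have hint : Integrable (fun ψ => φ (ψ * gain a c s)) F :=
    Integrable.of_bound (Measurable.aestronglyMeasurable (by fun_prop)) 1
      (Eventually.of_forall fun _ => h1 _)
  simp only [markMean]
  rw [integral_sub (integrable_const _) hint]
  simp

lemma tailPGF_zero (hS : StableTier a c F) {φ : ℝ → ℂ} (hm : Measurable φ)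
    (h1 : ∀ x, ‖φ x‖ ≤ 1) (hi : IntegrableOn (fun x => x ^ (-a - 1) • (1 - φ x)) (Ioi 0)) :
    tailPGF (markMean F (fun s ψ => φ (ψ * gain a c s))) 0 =
      Complex.exp (-((c * ∫ ψ, ψ ^ a ∂F : ℝ) * ∫ x in Ioi 0, (a * x ^ (-a - 1)) • (1 - φ x))) := by
  have := hS.prob
  rw [tailPGF, ← hS.integral_markMean (φ := fun x => 1 - φ x) (by fun_prop) hi]
  congr 2
  refine integral_congr_ae (Eventually.of_forall fun s => ?_)
  have hint : Integrable (fun ψ => φ (ψ * gain a c s)) F :=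
    Integrable.of_bound (Measurable.aestronglyMeasurable (by fun_prop)) 1
      (Eventually.of_forall fun _ => h1 _)
  simp only [markMean]
  rw [integral_sub (integrable_const _) hint]
  simp

end StableTier

/-! ### Transforms of the interference of one tier. -/

/-- `exp (-i w x)` -/
noncomputable def osc (w x : ℝ) : ℂ := Complex.exp (-(Complex.I * w * x))

/-- `exp (-i w x)` for `x ≤ v`, and zero for larger `x`. -/
noncomputable def oscCut (w v x : ℝ) : ℂ := if x ≤ v then osc w x else 0

lemma norm_osc (w x : ℝ) : ‖osc w x‖ = 1 := by
  rw [osc, Complex.norm_exp]; simp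

lemma norm_oscCut_le_one (w v x : ℝ) : ‖oscCut w v x‖ ≤ 1 := by
  unfold oscCut; split_ifs <;> simp [norm_osc]

lemma continuous_osc : Continuous (Function.uncurry osc) := by
  unfold osc Function.uncurry; fun_prop

lemma continuous_osc_right (w : ℝ) : Continuous (osc w) := by
  unfold osc; fun_prop

lemma measurable_oscCut (w v : ℝ) : Measurable (oscCut w v) :=
  Measurable.ite measurableSet_Iic (continuous_osc_right w).measurable measurable_const

lemma continuousWithinAt_oscCut (w v x : ℝ) : ContinuousWithinAt (oscCut w v) (Iic x) x := by
  rcases le_or_gt x v with h | h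
  · refine (continuous_osc_right w).continuousWithinAt.congr_of_eventuallyEq ?_ (if_pos h)
    filter_upwards [self_mem_nhdsWithin] with y hy using if_pos (le_trans hy h)
  · refine (continuousWithinAt_const (b := (0 : ℂ))).congr_of_eventuallyEq ?_ (if_neg (not_le.2 h))
    filter_upwards [mem_nhdsWithin_of_mem_nhds (Ioi_mem_nhds h)] with y hy using
      if_neg (not_le.2 hy)

namespace StableTier

variable {a c : ℝ} {F : Measure ℝ}

lemma integrableOn_osc (hS : StableTier a c F) (w : ℝ) :
    IntegrableOn (fun x => x ^ (-a - 1) • (1 - osc w x)) (Ioi 0) := by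
  have := integrableOn_rpow_smul_one_sub_exp hS.exp_pos hS.exp_lt_one (z := Complex.I * w) (by simp)
  simpa [osc] using this

lemma integrableOn_tail (hS : StableTier a c F) (w : ℝ) {v : ℝ} (hv : 0 < v) :
    IntegrableOn (fun x => x ^ (-a - 1) • osc w x) (Ioi v) := by
  have hi := integrableOn_Ioi_rpow_of_lt (by linarith [hS.exp_pos] : -a - 1 < -1) hv
  have hm := (continuous_osc_right w).measurable
  refine hi.mono' (Measurable.aestronglyMeasurable (by fun_prop)) ?_
  refine (ae_restrict_iff' measurableSet_Ioi).2 (Eventually.of_forall fun x hx => ?_)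
  have hx0 : 0 < x := hv.trans hx
  rw [norm_smul, norm_osc, mul_one, Real.norm_of_nonneg (by positivity)]

lemma rpow_smul_one_sub_oscCut (w v : ℝ) : (fun x : ℝ => x ^ (-a - 1) • (1 - oscCut w v x)) =
    fun x => x ^ (-a - 1) • (1 - osc w x) + (Ioi v).indicator (fun x =>
        x ^ (-a - 1) • osc w x) x := by
  ext x
  by_cases h : x ≤ v
  · simp [oscCut, h]
  · simp only [oscCut, if_neg h, indicator_of_mem (mem_Ioi.2 (not_le.1 h)), smul_sub]
    simp

lemma integrableOn_oscCut (hS : StableTier a c F) (w : ℝ) {v : ℝ} (hv : 0 < v) :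
    IntegrableOn (fun x => x ^ (-a - 1) • (1 - oscCut w v x)) (Ioi 0) := by
  rw [rpow_smul_one_sub_oscCut]
  refine (hS.integrableOn_osc w).add ?_
  exact ((hS.integrableOn_tail w hv).integrable_indicator measurableSet_Ioi).integrableOn

/-- The stable exponent `c E[ψ ^ a] (i w) ^ a Γ(1 - a)` of the interference of a tier. -/
noncomputable def levy (a c : ℝ) (F : Measure ℝ) (w : ℝ) : ℂ :=
  (c * ∫ ψ, ψ ^ a ∂F : ℝ) * ((Complex.I * w) ^ (a : ℂ) * Real.Gamma (1 - a))

/-- The part of the exponent that comes from received powers larger than `v`. -/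
noncomputable def levyTail (a c : ℝ) (F : Measure ℝ) (w v : ℝ) : ℂ :=
  (c * ∫ ψ, ψ ^ a ∂F : ℝ) * ∫ x in Ioi v, (a * x ^ (-a - 1)) • osc w x

lemma moment_pos (hS : StableTier a c F) : 0 < ∫ ψ, ψ ^ a ∂F := by
  have := hS.prob
  rw [integral_pos_iff_support_of_nonneg_ae (by
    filter_upwards [hS.pos] with x hx; positivity) hS.moment]
  have : (Function.support fun x : ℝ => x ^ a) =ᵐ[F] univ := by
    filter_upwards [hS.pos] with x hx
    refine propext ⟨fun _ => trivial, fun _ => ?_⟩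
    exact (Real.rpow_pos_of_pos hx a).ne'
  rw [measure_congr this]
  simp

lemma tailPGF_osc (hS : StableTier a c F) {w : ℝ} (hw : w ≠ 0) :
    tailPGF (markMean F (fun s ψ => osc w (ψ * gain a c s))) 0 = Complex.exp (-levy a c F w) := by
  rw [hS.tailPGF_zero (continuous_osc_right w).measurable (fun x => (norm_osc w x).le)
    (hS.integrableOn_osc w), levy, ← integral_rpow_smul_one_sub_exp hS.exp_pos hS.exp_lt_one hw]
  rfl

/-- Beyond v the cut function is 0 instead of exp(-iwx), so 1 minus it exceeds 1 - exp(-iwx) by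
exactly exp(-iwx). -/
lemma levy_add_levyTail_eq (hS : StableTier a c F) {w v : ℝ} (hw : w ≠ 0) (hv : 0 < v) :
    levy a c F w + levyTail a c F w v =
      (c * ∫ ψ, ψ ^ a ∂F : ℝ) * ∫ x in Ioi 0, (a * x ^ (-a - 1)) • (1 - oscCut w v x) := by
  rw [levy, levyTail, ← integral_rpow_smul_one_sub_exp hS.exp_pos hS.exp_lt_one hw, ← mul_add]
  congr 1
  symm
  have h1 : ∀ φ : ℝ → ℂ, ∀ S : Set ℝ, ∫ x in S, (a * x ^ (-a - 1)) • φ x =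
      a • ∫ x in S, x ^ (-a - 1) • φ x := by
    intro φ S
    rw [← integral_smul]
    simp_rw [smul_smul]
  have h2 : Integrable ((Ioi v).indicator fun x => x ^ (-a - 1) • osc w x)
      (volume.restrict (Ioi 0)) :=
    ((hS.integrableOn_tail w hv).integrable_indicator measurableSet_Ioi).integrableOn
  rw [h1 (fun x => 1 - oscCut w v x), h1 (fun x => 1 - Complex.exp (-(Complex.I * w * x))),
    h1 (osc w), rpow_smul_one_sub_oscCut, integral_add (hS.integrableOn_osc w) h2, smul_add,
    setIntegral_indicator measurableSet_Ioi, inter_eq_self_of_subset_right (Ioi_subset_Ioi hv.le)]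
  rfl

lemma tailPGF_oscCut (hS : StableTier a c F) {w v : ℝ} (hw : w ≠ 0) (hv : 0 < v) :
    tailPGF (markMean F (fun s ψ => oscCut w v (ψ * gain a c s))) 0 =
      Complex.exp (-(levy a c F w + levyTail a c F w v)) := by
  rw [hS.tailPGF_zero (measurable_oscCut w v) (norm_oscCut_le_one w v)
    (hS.integrableOn_oscCut w hv), hS.levy_add_levyTail_eq hw hv]

/-- The rate of decay of the transform of the interference of a tier. -/
noncomputable def rate (a c : ℝ) (F : Measure ℝ) : ℝ :=
  c * (∫ ψ, ψ ^ a ∂F) * Real.Gamma (1 - a) * Real.cos (a * (Real.pi / 2))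

/-- The principal power of ±i is exp(±iπa/2), with real part cos(πa/2) for either sign. -/
lemma levy_re (a c : ℝ) (F : Measure ℝ) {w : ℝ} (hw : w ≠ 0) :
    (levy a c F w).re = rate a c F * |w| ^ a := by
  have hw' : 0 < |w| := abs_pos.2 hw
  have key : ((Complex.I * w) ^ (a : ℂ)).re = |w| ^ a * Real.cos (a * (Real.pi / 2)) := by
    have h1 : ∃ z : ℂ, z ≠ 0 ∧ Complex.I * w = (|w| : ℝ) * z ∧
        (z ^ (a : ℂ)).re = Real.cos (a * (Real.pi / 2)) := by
      rcases lt_or_gt_of_ne hw with h | h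
      · refine ⟨-Complex.I, by simp, by rw [abs_of_neg h]; push_cast; ring, ?_⟩
        rw [Complex.cpow_def_of_ne_zero (by simp), Complex.log_neg_I,
          show -(Real.pi / 2 : ℂ) * Complex.I * a = ((-(a * (Real.pi / 2)) : ℝ) : ℂ) * Complex.I by
            push_cast; ring, Complex.exp_ofReal_mul_I_re, Real.cos_neg]
      · refine ⟨Complex.I, by simp, by rw [abs_of_pos h]; ring, ?_⟩
        rw [Complex.cpow_def_of_ne_zero (by simp), Complex.log_I,
          show (Real.pi / 2 : ℂ) * Complex.I * a = ((a * (Real.pi / 2) : ℝ) : ℂ) * Complex.I by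
            push_cast; ring, Complex.exp_ofReal_mul_I_re]
    obtain ⟨z, hz, hzw, hre⟩ := h1
    rw [hzw, ofReal_mul_cpow hw' hz, ← Complex.ofReal_cpow hw'.le, Complex.re_ofReal_mul, hre]
  rw [levy, Complex.re_ofReal_mul, Complex.re_mul_ofReal, key, rate]
  ring

lemma rate_pos (hS : StableTier a c F) : 0 < rate a c F := by
  have h1 := hS.moment_pos
  have h2 := hS.int_pos
  have h3 : 0 < Real.Gamma (1 - a) := Real.Gamma_pos_of_pos (by linarith [hS.exp_lt_one])
  have h4 : 0 < Real.cos (a * (Real.pi / 2)) := by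
    refine Real.cos_pos_of_mem_Ioo ⟨?_, ?_⟩
    · have := mul_pos hS.exp_pos Real.pi_div_two_pos
      linarith [Real.pi_div_two_pos]
    · have := mul_lt_mul_of_pos_right hS.exp_lt_one Real.pi_div_two_pos
      linarith
  unfold rate
  positivity

end StableTier

/-! ### The nearest BS of a tier: survival factor, kernel and decay bounds. -/

namespace StableTier

variable {a c : ℝ} {F : Measure ℝ}

/-- The mean of `exp (-i w p)`, where `p` is the received power from a BS with arrival time `s`. -/
noncomputable def oscMean (a c : ℝ) (F : Measure ℝ) (w : ℝ) : ℝ → ℂ :=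
  markMean F (fun s ψ => osc w (ψ * gain a c s))

/-- The transform of the interference from the BSs that arrive later than `s`, times the
probability that there are no earlier BSs. -/
noncomputable def survival (a c : ℝ) (F : Measure ℝ) (w s : ℝ) : ℂ :=
  Complex.exp (-s) * tailPGF (oscMean a c F w) s

lemma markFun_osc (hS : StableTier a c F) (w : ℝ) :
    MarkFun F (fun s ψ => osc w (ψ * gain a c s)) :=
  hS.markFun (continuous_osc_right w).measurable (fun x => (norm_osc w x).le)
    fun _ _ => (continuous_osc_right w).continuousWithinAt

lemma markFun_oscCut (hS : StableTier a c F) (w v : ℝ) :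
    MarkFun F (fun s ψ => oscCut w v (ψ * gain a c s)) :=
  hS.markFun (measurable_oscCut w v) (norm_oscCut_le_one w v)
    fun _ _ => continuousWithinAt_oscCut _ _ _

lemma integrableOn_one_sub_oscMean (hS : StableTier a c F) (w : ℝ) :
    IntegrableOn (fun s => 1 - oscMean a c F w s) (Ioi 0) :=
  hS.integrableOn_one_sub_markMean (continuous_osc_right w).measurable
    (fun x => (norm_osc w x).le) (hS.integrableOn_osc w)

lemma norm_oscMean_le_one (hS : StableTier a c F) (w s : ℝ) : ‖oscMean a c F w s‖ ≤ 1 :=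
  have := hS.prob
  (hS.markFun_osc w).norm_markMean_le_one s

lemma measurable_oscMean (hS : StableTier a c F) :
    Measurable (Function.uncurry (oscMean a c F)) := by
  have := hS.prob
  have h : StronglyMeasurable fun z : ℝ × ℝ => ∫ ψ, osc z.1 (ψ * gain a c z.2) ∂F := by
    refine StronglyMeasurable.integral_prod_right
      (f := fun (z : ℝ × ℝ) ψ => osc z.1 (ψ * gain a c z.2)) ?_
    refine Measurable.stronglyMeasurable ?_
    exact continuous_osc.measurable.comp (by fun_prop :
      Measurable fun y : (ℝ × ℝ) × ℝ => (y.1.1, y.2 * gain a c y.1.2))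
  exact h.measurable

lemma measurable_survival (hS : StableTier a c F) :
    Measurable (Function.uncurry (survival a c F)) := by
  have h : StronglyMeasurable fun z : ℝ × ℝ =>
      ∫ x, (Ioi z.2).indicator (fun x => 1 - oscMean a c F z.1 x) x := by
    refine StronglyMeasurable.integral_prod_right
      (f := fun (z : ℝ × ℝ) x => (Ioi z.2).indicator (fun x => 1 - oscMean a c F z.1 x) x) ?_
    have e : (Function.uncurry fun (z : ℝ × ℝ) x =>
        (Ioi z.2).indicator (fun x => 1 - oscMean a c F z.1 x) x) =
        {y : (ℝ × ℝ) × ℝ | y.1.2 < y.2}.indicator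
          fun y => 1 - Function.uncurry (oscMean a c F) (y.1.1, y.2) := by
      ext ⟨z, x⟩; simp [indicator_apply]
    rw [e]
    refine Measurable.stronglyMeasurable (Measurable.indicator ?_
      (measurableSet_lt (by fun_prop) (by fun_prop)))
    exact measurable_const.sub (hS.measurable_oscMean.comp (by fun_prop))
  simp_rw [integral_indicator measurableSet_Ioi] at h
  unfold survival tailPGF Function.uncurry
  have := h.measurable
  fun_prop

lemma tailPGF_oscMean_eq (hS : StableTier a c F) {w s : ℝ} (hw : w ≠ 0) (hs : 0 ≤ s) :
    tailPGF (oscMean a c F w) s =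
      Complex.exp (-levy a c F w) * Complex.exp (∫ x in (0 : ℝ)..s, (1 - oscMean a c F w x)) := by
  have hI := hS.integrableOn_one_sub_oscMean w
  have h0 := hS.tailPGF_osc hw
  rw [← h0]
  change _ = tailPGF (oscMean a c F w) 0 * _
  rw [tailPGF, tailPGF, ← Complex.exp_add, intervalIntegral.integral_of_le hs,
    ← Ioc_union_Ioi_eq_Ioi hs, setIntegral_union (Ioc_disjoint_Ioi le_rfl) measurableSet_Ioi
      (hI.mono_set Ioc_subset_Ioi_self) (hI.mono_set (Ioi_subset_Ioi hs))]
  congr 1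
  ring

/-- The constant 1 in 1 - `oscMean` integrates to s over (0, s) and cancels the factor e^(-s). This
form, of total exponent `levy` corrected on a finite interval, exhibits the decay in w and matches
the closed formulas. -/
lemma survival_eq (hS : StableTier a c F) {w s : ℝ} (hw : w ≠ 0) (hs : 0 ≤ s) :
    survival a c F w s =
      Complex.exp (-levy a c F w) * Complex.exp (-∫ x in (0 : ℝ)..s, oscMean a c F w x) := by
  have hm : Measurable (oscMean a c F w) := hS.measurable_oscMean.comp measurable_prodMk_left
  have hi : IntervalIntegrable (oscMean a c F w) volume 0 s := by
    rw [intervalIntegrable_iff_integrableOn_Ioc_of_le hs]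
    exact Measure.integrableOn_of_bounded (M := 1) (by simp) hm.aestronglyMeasurable
      (Eventually.of_forall fun x => hS.norm_oscMean_le_one w x)
  rw [survival, hS.tailPGF_oscMean_eq hw hs, intervalIntegral.integral_sub (by simp) hi,
    intervalIntegral.integral_const, mul_left_comm, ← Complex.exp_add]
  congr 2
  simp only [sub_zero, Complex.real_smul, mul_one]
  ring

lemma continuousOn_survival (hS : StableTier a c F) (w : ℝ) :
    ContinuousOn (survival a c F w) (Ici 0) := by
  unfold survival
  refine ContinuousOn.mul (Continuous.continuousOn (by fun_prop)) ?_
  exact continuousOn_tailPGF (hS.integrableOn_one_sub_oscMean w)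

lemma norm_survival_le_exp_neg (hS : StableTier a c F) (w : ℝ) {s : ℝ} (hs : 0 ≤ s) :
    ‖survival a c F w s‖ ≤ Real.exp (-s) := by
  rw [survival, norm_mul, Complex.norm_exp]
  simp only [Complex.neg_re, Complex.ofReal_re]
  exact mul_le_of_le_one_right (Real.exp_pos _).le (norm_tailPGF_le_one (hS.norm_oscMean_le_one w)
    ((hS.integrableOn_one_sub_oscMean w).mono_set (Ioi_subset_Ioi hs)))

/-- The first bound is used for s ≥ R/2 and the second for s ≤ R/2. -/
lemma exp_neg_le_of_le {x s R : ℝ} (h1 : x ≤ Real.exp (-s)) (h2 : x ≤ Real.exp (s - R)) :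
    x ≤ Real.exp (-(R / 4)) * Real.exp (-(s / 2)) := by
  rw [← Real.exp_add]
  rcases le_total (R / 2) s with h | h
  · exact h1.trans (Real.exp_le_exp.2 (by linarith))
  · exact h2.trans (Real.exp_le_exp.2 (by linarith))

/-- The bound e^(-s) is good for late arrivals. For early ones the stable exponent gives exp(s - R)
with R = `rate a c F * |w| ^ a`, as |`oscMean`| ≤ 1 costs at most e^s. Their combination decays in s
and in w at once. -/
lemma norm_survival_le (hS : StableTier a c F) {w s : ℝ} (hw : w ≠ 0) (hs : 0 ≤ s) :
    ‖survival a c F w s‖ ≤ Real.exp (-(rate a c F * |w| ^ a / 4)) * Real.exp (-(s / 2)) := by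
  refine exp_neg_le_of_le (hS.norm_survival_le_exp_neg w hs) ?_
  rw [hS.survival_eq hw hs, norm_mul, Complex.norm_exp, Complex.norm_exp, ← Real.exp_add,
    Complex.neg_re, levy_re a c F hw]
  refine Real.exp_le_exp.2 ?_
  have h1 : ‖∫ x in (0 : ℝ)..s, oscMean a c F w x‖ ≤ 1 * |s - 0| :=
    intervalIntegral.norm_integral_le_of_norm_le_const fun x _ => hS.norm_oscMean_le_one w x
  rw [one_mul, sub_zero, abs_of_nonneg hs] at h1
  have h2 := (Complex.abs_re_le_norm _).trans h1
  rw [Complex.neg_re]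
  linarith [(abs_le.1 h2).1]

/-- The density, in the received power from the nearest BS, of the transform of the
interference of a tier. -/
noncomputable def kernel (a c : ℝ) (F : Measure ℝ) (w x : ℝ) : ℂ :=
  ∫ ψ, (c * ψ ^ a * a * x ^ (-a - 1)) • (osc w x * survival a c F w (c * ψ ^ a * x ^ (-a))) ∂F

/-- An envelope of the kernels. -/
noncomputable def envelope (a c : ℝ) (F : Measure ℝ) (x : ℝ) : ℝ :=
  ∫ ψ, c * ψ ^ a * a * x ^ (-a - 1) * Real.exp (-(c * ψ ^ a * x ^ (-a) / 2)) ∂F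

lemma measurable_kernel (hS : StableTier a c F) : Measurable (Function.uncurry (kernel a c F)) := by
  have := hS.prob
  refine StronglyMeasurable.measurable ?_
  refine StronglyMeasurable.integral_prod_right (f := fun (z : ℝ × ℝ) ψ =>
    (c * ψ ^ a * a * z.2 ^ (-a - 1)) • (osc z.1 z.2 *
      survival a c F z.1 (c * ψ ^ a * z.2 ^ (-a)))) ?_
  refine Measurable.stronglyMeasurable ?_
  have h1 : Measurable fun y : (ℝ × ℝ) × ℝ => osc y.1.1 y.1.2 :=
    continuous_osc.measurable.comp measurable_fst
  have h2 : Measurable fun y : (ℝ × ℝ) × ℝ => survival a c F y.1.1 (c * y.2 ^ a * y.1.2 ^ (-a)) :=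
    hS.measurable_survival.comp (by fun_prop :
      Measurable fun y : (ℝ × ℝ) × ℝ => (y.1.1, c * y.2 ^ a * y.1.2 ^ (-a)))
  unfold Function.uncurry
  fun_prop

lemma integrable_kernel_integrand (hS : StableTier a c F) (w : ℝ) {x : ℝ} (hx : 0 < x) :
    Integrable (fun ψ => (c * ψ ^ a * a * x ^ (-a - 1)) •
      (osc w x * survival a c F w (c * ψ ^ a * x ^ (-a)))) F := by
  have hc := hS.int_pos
  have ha := hS.exp_pos
  have hm : Measurable fun ψ : ℝ => survival a c F w (c * ψ ^ a * x ^ (-a)) :=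
    hS.measurable_survival.comp (by fun_prop : Measurable fun ψ : ℝ => (w, c * ψ ^ a * x ^ (-a)))
  refine (hS.moment.mul_const (c * a * x ^ (-a - 1))).mono'
    (Measurable.aestronglyMeasurable (by fun_prop)) ?_
  filter_upwards [hS.pos] with ψ hψ
  rw [norm_smul, norm_mul (osc _ _), norm_osc, one_mul, Real.norm_of_nonneg (by positivity)]
  calc _ ≤ c * ψ ^ a * a * x ^ (-a - 1) * 1 := by
        gcongr
        refine (hS.norm_survival_le_exp_neg w (by positivity)).trans ?_
        rw [Real.exp_le_one_iff]
        have : 0 ≤ c * ψ ^ a * x ^ (-a) := by positivity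
        linarith
    _ = _ := by ring

/-- This gives differentiability of the nearest-BS transform at every level, not only at almost
every one. -/
lemma continuousAt_kernel (hS : StableTier a c F) (w : ℝ) {x : ℝ} (hx : 0 < x) :
    ContinuousAt (kernel a c F w) x := by
  have hc := hS.int_pos
  have ha := hS.exp_pos
  refine tendsto_integral_filter_of_dominated_convergence
    (fun ψ => ψ ^ a * (c * a * (x / 2) ^ (-a - 1))) ?_ ?_ (hS.moment.mul_const _) ?_
  · filter_upwards [Ioi_mem_nhds hx] with y hy
    exact (hS.integrable_kernel_integrand w hy).aestronglyMeasurable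
  · filter_upwards [Ioi_mem_nhds (half_lt_self hx)] with y hy
    have hy0 : 0 < y := (half_pos hx).trans hy
    filter_upwards [hS.pos] with ψ hψ
    rw [norm_smul, norm_mul (osc _ _), norm_osc, one_mul, Real.norm_of_nonneg (by positivity)]
    calc _ ≤ c * ψ ^ a * a * (x / 2) ^ (-a - 1) * 1 := by
          gcongr ?_ * ?_
          · gcongr ?_ * ?_
            exact Real.rpow_le_rpow_of_nonpos (half_pos hx) (le_of_lt hy) (by linarith)
          · refine (hS.norm_survival_le_exp_neg w (by positivity)).trans ?_
            rw [Real.exp_le_one_iff]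
            have : 0 ≤ c * ψ ^ a * y ^ (-a) := by positivity
            linarith
      _ = _ := by ring
  · filter_upwards [hS.pos] with ψ hψ
    have h1 : ∀ r : ℝ, ContinuousAt (fun y : ℝ => y ^ r) x := fun r =>
      Real.continuousAt_rpow_const _ _ (Or.inl hx.ne')
    refine ContinuousAt.tendsto ?_
    refine ContinuousAt.smul (continuousAt_const.mul (h1 _))
      ((continuous_osc_right w).continuousAt.mul ?_)
    have h2 : ContinuousAt (survival a c F w) (c * ψ ^ a * x ^ (-a)) :=
      (hS.continuousOn_survival w).continuousAt (Ici_mem_nhds (by positivity))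
    exact ContinuousAt.comp (f := fun y : ℝ => c * ψ ^ a * y ^ (-a)) h2
      (continuousAt_const.mul (h1 _))

lemma norm_kernel_le (hS : StableTier a c F) {w x : ℝ} (hw : w ≠ 0) (hx : 0 < x) :
    ‖kernel a c F w x‖ ≤ Real.exp (-(rate a c F * |w| ^ a / 4)) * envelope a c F x := by
  have hc := hS.int_pos
  have ha := hS.exp_pos
  rw [envelope, ← integral_const_mul]
  refine norm_integral_le_of_norm_le ?_ ?_
  · refine Integrable.const_mul ?_ _
    refine (hS.moment.mul_const (c * a * x ^ (-a - 1))).mono'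
      (Measurable.aestronglyMeasurable (by fun_prop)) ?_
    filter_upwards [hS.pos] with ψ hψ
    rw [norm_mul, Real.norm_of_nonneg (by positivity), Real.norm_of_nonneg (by positivity)]
    calc _ ≤ c * ψ ^ a * a * x ^ (-a - 1) * 1 := by
          gcongr
          rw [Real.exp_le_one_iff]
          have : 0 ≤ c * ψ ^ a * x ^ (-a) := by positivity
          linarith
      _ = _ := by ring
  · filter_upwards [hS.pos] with ψ hψ
    rw [norm_smul, norm_mul (osc _ _), norm_osc, one_mul, Real.norm_of_nonneg (by positivity)]
    calc _ ≤ c * ψ ^ a * a * x ^ (-a - 1) * (Real.exp (-(rate a c F * |w| ^ a / 4)) *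
          Real.exp (-(c * ψ ^ a * x ^ (-a) / 2))) := by
          gcongr
          exact hS.norm_survival_le hw (by positivity)
      _ = _ := by ring

/-- Tonelli with the gain outside: for fixed gain the inner integral is undone to an integral over
arrival times, where it is bounded by `C`. -/
lemma integrable_prod_of_comp (hS : StableTier a c F) {E : Type*} [NormedAddCommGroup E]
    [NormedSpace ℝ E] {Φ : ℝ → ℝ → E} {C : ℝ → ℝ} (hC : Integrable C F)
    (hm : AEStronglyMeasurable (fun z : ℝ × ℝ => (c * z.1 ^ a * a * z.2 ^ (-a - 1)) •
      Φ (c * z.1 ^ a * z.2 ^ (-a)) z.2) (F.prod (volume.restrict (Ioi 0))))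
    (hi : ∀ ψ, 0 < ψ → IntegrableOn (fun s => Φ s (ψ * gain a c s)) (Ioi 0))
    (hb : ∀ ψ, 0 < ψ → ∫ s in Ioi 0, ‖Φ s (ψ * gain a c s)‖ ≤ C ψ) :
    Integrable (fun z : ℝ × ℝ => (c * z.1 ^ a * a * z.2 ^ (-a - 1)) •
      Φ (c * z.1 ^ a * z.2 ^ (-a)) z.2) (F.prod (volume.restrict (Ioi 0))) := by
  have := hS.prob
  have hc := hS.int_pos
  have ha := hS.exp_pos
  rw [integrable_prod_iff hm]
  constructor
  · filter_upwards [hS.pos] with ψ hψ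
    exact (hS.integrableOn_comp_gain_iff hψ Φ).1 (hi ψ hψ)
  · refine hC.mono' hm.norm.integral_prod_right' ?_
    filter_upwards [hS.pos] with ψ hψ
    rw [Real.norm_of_nonneg (integral_nonneg fun _ => norm_nonneg _)]
    refine le_trans (le_of_eq ?_) (hb ψ hψ)
    rw [hS.integral_comp_gain hψ (fun s x => ‖Φ s x‖)]
    refine setIntegral_congr_fun measurableSet_Ioi fun x hx => ?_
    have hx0 : 0 < x := hx
    simp only [norm_smul, smul_eq_mul]
    rw [Real.norm_of_nonneg (by positivity)]

lemma integrableOn_exp_neg_Ioi' : IntegrableOn (fun s : ℝ => Real.exp (-(s / 2))) (Ioi 0) := by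
  have := exp_neg_integrableOn_Ioi 0 (half_pos (one_pos (α := ℝ)))
  refine this.congr_fun (fun s _ => ?_) measurableSet_Ioi
  ring_nf

lemma integrable_kernel_prod (hS : StableTier a c F) (w : ℝ) :
    Integrable (fun z : ℝ × ℝ => (c * z.1 ^ a * a * z.2 ^ (-a - 1)) •
      (osc w z.2 * survival a c F w (c * z.1 ^ a * z.2 ^ (-a))))
      (F.prod (volume.restrict (Ioi 0))) := by
  have := hS.prob
  have hsm : ∀ s : ℝ → ℝ, Measurable s → Measurable fun y => survival a c F w (s y) := fun s hs =>
    hS.measurable_survival.comp (by fun_prop : Measurable fun y => (w, s y))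
  have hom := (continuous_osc_right w).measurable
  have hn : ∀ ψ : ℝ, ∀ s ∈ Ioi (0 : ℝ), ‖osc w (ψ * gain a c s) * survival a c F w s‖ ≤
      Real.exp (-s) := by
    intro ψ s hs
    rw [norm_mul, norm_osc, one_mul]
    exact hS.norm_survival_le_exp_neg w (le_of_lt hs)
  have hii : ∀ ψ, 0 < ψ → IntegrableOn (fun s => osc w (ψ * gain a c s) * survival a c F w s)
      (Ioi 0) := by
    intro ψ hψ
    have := hsm (fun s => s) measurable_id
    refine integrableOn_cexp_neg_Ioi.mono' (Measurable.aestronglyMeasurable (by fun_prop)) ?_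
    exact (ae_restrict_iff' measurableSet_Ioi).2 (Eventually.of_forall (hn ψ))
  refine hS.integrable_prod_of_comp (Φ := fun s x => osc w x * survival a c F w s)
    (C := fun _ => ∫ s in Ioi (0 : ℝ), Real.exp (-s)) (integrable_const _) ?_ hii ?_
  · have : Measurable fun z : ℝ × ℝ => survival a c F w (c * z.1 ^ a * z.2 ^ (-a)) :=
      hS.measurable_survival.comp (by fun_prop :
        Measurable fun z : ℝ × ℝ => (w, c * z.1 ^ a * z.2 ^ (-a)))
    exact Measurable.aestronglyMeasurable (by fun_prop)
  · intro ψ hψ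
    exact setIntegral_mono_on (hii ψ hψ).norm integrableOn_cexp_neg_Ioi measurableSet_Ioi (hn ψ)

lemma integrableOn_kernel (hS : StableTier a c F) (w : ℝ) :
    IntegrableOn (kernel a c F w) (Ioi 0) := by
  have := hS.prob
  exact (hS.integrable_kernel_prod w).integral_prod_right

/-- The transform of the interference of a tier when the received power from the nearest BS is at
most `v`. -/
theorem tierValue_nearest (hS : StableTier a c F) (w : ℝ) {v : ℝ} (hv : 0 ≤ v) :
    tierValue true F (fun s ψ => oscCut w v (ψ * gain a c s))
      (fun s ψ => osc w (ψ * gain a c s)) = ∫ x in (0 : ℝ)..v, kernel a c F w x := by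
  have := hS.prob
  have hsm : Measurable (survival a c F w) := hS.measurable_survival.comp measurable_prodMk_left
  have hcm := measurable_oscCut w v
  have h1 : tierValue true F (fun s ψ => oscCut w v (ψ * gain a c s))
      (fun s ψ => osc w (ψ * gain a c s)) =
      ∫ s in Ioi (0 : ℝ), ∫ ψ, oscCut w v (ψ * gain a c s) * survival a c F w s ∂F := by
    rw [tierValue, if_pos rfl]
    congr 1
    ext s
    rw [integral_mul_const, survival, markMean]
    change _ * (_ * tailPGF (oscMean a c F w) s) = _
    ring
  have hi1 : Integrable (fun z : ℝ × ℝ => oscCut w v (z.2 * gain a c z.1) * survival a c F w z.1)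
      ((volume.restrict (Ioi 0)).prod F) := by
    have hb : Integrable (fun z : ℝ × ℝ => Real.exp (-z.1) * 1)
        ((volume.restrict (Ioi 0)).prod F) :=
      Integrable.mul_prod integrableOn_cexp_neg_Ioi (integrable_const 1)
    refine hb.mono' (Measurable.aestronglyMeasurable (by fun_prop)) ?_
    have hae : ∀ᵐ z ∂((volume.restrict (Ioi (0 : ℝ))).prod F), z.1 ∈ Ioi (0 : ℝ) :=
      Measure.quasiMeasurePreserving_fst.ae (ae_restrict_mem measurableSet_Ioi)
    filter_upwards [hae] with z hz
    rw [norm_mul, mul_comm]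
    exact mul_le_mul (hS.norm_survival_le_exp_neg w (le_of_lt hz)) (norm_oscCut_le_one _ _ _)
      (norm_nonneg _) (Real.exp_pos _).le
  have h2 : ∀ᵐ ψ ∂F, ∫ s in Ioi 0, oscCut w v (ψ * gain a c s) * survival a c F w s =
      ∫ x in Ioi 0, (Iic v).indicator (fun x => (c * ψ ^ a * a * x ^ (-a - 1)) •
        (osc w x * survival a c F w (c * ψ ^ a * x ^ (-a)))) x := by
    filter_upwards [hS.pos] with ψ hψ
    rw [hS.integral_comp_gain hψ (fun s x => oscCut w v x * survival a c F w s)]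
    congr 1
    ext x
    by_cases hx : x ≤ v <;> simp [oscCut, hx]
  have hi2 : Integrable (fun z : ℝ × ℝ => (Iic v).indicator (fun x =>
      (c * z.1 ^ a * a * x ^ (-a - 1)) • (osc w x * survival a c F w (c * z.1 ^ a * x ^ (-a)))) z.2)
      (F.prod (volume.restrict (Ioi 0))) :=
    (hS.integrable_kernel_prod w).indicator (measurable_snd measurableSet_Iic)
  -- Fubini brings the time inside, the substitution replaces it by the received power for each
  -- gain, and Fubini brings the gain back inside.
  rw [h1, integral_integral_swap (f := fun s ψ => oscCut w v (ψ * gain a c s) * survival a c F w s)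
    hi1, integral_congr_ae h2, integral_integral_swap hi2, intervalIntegral.integral_of_le hv,
    ← Ioi_inter_Iic, ← setIntegral_indicator measurableSet_Iic]
  congr 1
  ext x
  by_cases hx : x ≤ v <;> simp [kernel, hx]

lemma integrableOn_rpow_mul_exp_neg_half {r : ℝ} (hr : -1 < r) :
    IntegrableOn (fun s : ℝ => s ^ r * Real.exp (-(s / 2))) (Ioi 0) := by
  have := integrableOn_rpow_mul_exp_neg_mul_rpow (p := 1) (s := r) (b := 1 / 2) hr one_pos
    (by norm_num)
  refine this.congr_fun (fun s _ => ?_) measurableSet_Ioi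
  simp only [Real.rpow_one]
  ring_nf

/-- The envelope is integrable against a small power. -/
lemma integrableOn_envelope (hS : StableTier a c F) :
    IntegrableOn (fun x => (1 + x ^ (a / 2)) * envelope a c F x) (Ioi 0) := by
  have := hS.prob
  have hc := hS.int_pos
  have ha := hS.exp_pos
  -- ψ^(a/2) is dominated by 1 + ψ^a.
  have hmom : Integrable (fun ψ : ℝ => ψ ^ (a / 2)) F := by
    refine ((integrable_const 1).add hS.moment).mono' (Measurable.aestronglyMeasurable
        (by fun_prop)) ?_
    filter_upwards [hS.pos] with ψ hψ
    rw [Real.norm_of_nonneg (by positivity), Pi.add_apply]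
    have h1 : ψ ^ a = (ψ ^ (a / 2)) ^ 2 := by
      rw [← Real.rpow_natCast, ← Real.rpow_mul hψ.le]; congr 1; push_cast; ring
    rw [h1]
    nlinarith [sq_nonneg (ψ ^ (a / 2) - 1), Real.rpow_pos_of_pos hψ (a / 2)]
  set J : ℝ := ∫ s in Ioi (0 : ℝ), Real.exp (-(s / 2))
  set J' : ℝ := ∫ s in Ioi (0 : ℝ), s ^ (-(1 / 2) : ℝ) * Real.exp (-(s / 2))
  -- In arrival time x^(a/2) is a multiple of s^(-1/2), integrable at 0. The full power a would give
  -- s^(-1), which is not.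
  have hg : ∀ ψ : ℝ, 0 < ψ → ∀ s ∈ Ioi (0 : ℝ),
      (1 + (ψ * gain a c s) ^ (a / 2)) * Real.exp (-(s / 2)) =
      Real.exp (-(s / 2)) + (ψ ^ (a / 2) * c ^ (1 / 2 : ℝ)) *
        (s ^ (-(1 / 2) : ℝ) * Real.exp (-(s / 2))) := by
    intro ψ hψ s hs
    have hs0 : 0 < s := hs
    have h1 : (gain a c s) ^ (a / 2) = c ^ (1 / 2 : ℝ) * s ^ (-(1 / 2) : ℝ) := by
      unfold gain
      rw [← Real.rpow_mul (by positivity), Real.div_rpow hc.le hs0.le, Real.rpow_neg hs0.le]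
      have : 1 / a * (a / 2) = 1 / 2 := by field_simp
      rw [this, div_eq_mul_inv]
    rw [Real.mul_rpow hψ.le (gain_pos hc hs0).le, h1]
    ring
  have hI1 : IntegrableOn (fun s : ℝ => Real.exp (-(s / 2))) (Ioi 0) := integrableOn_exp_neg_Ioi'
  have hI2 : IntegrableOn (fun s : ℝ => s ^ (-(1 / 2) : ℝ) * Real.exp (-(s / 2))) (Ioi 0) :=
    integrableOn_rpow_mul_exp_neg_half (by norm_num)
  have key := hS.integrable_prod_of_comp
    (Φ := fun s x => (1 + x ^ (a / 2)) * Real.exp (-(s / 2)))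
    (C := fun ψ => J + (ψ ^ (a / 2) * c ^ (1 / 2 : ℝ)) * J')
    ((integrable_const _).add ((hmom.mul_const _).mul_const _))
    (Measurable.aestronglyMeasurable (by fun_prop)) (fun ψ hψ => ?_) (fun ψ hψ => ?_)
  · refine key.integral_prod_right.congr (Eventually.of_forall fun x => ?_)
    simp only [envelope, smul_eq_mul]
    rw [← integral_const_mul]
    congr 1
    ext ψ
    ring
  · exact (hI1.add (hI2.const_mul _)).congr_fun (fun s hs => (hg ψ hψ s hs).symm) measurableSet_Ioi
  · refine le_of_eq ?_
    rw [setIntegral_congr_fun (g := fun s => Real.exp (-(s / 2)) + (ψ ^ (a / 2) * c ^ (1 / 2 : ℝ)) *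
        (s ^ (-(1 / 2) : ℝ) * Real.exp (-(s / 2)))) measurableSet_Ioi fun s hs => ?_,
      integral_add hI1 (hI2.const_mul _), integral_const_mul]
    have h0 : 0 < gain a c s := gain_pos hc hs
    rw [Real.norm_of_nonneg (by positivity)]
    exact hg ψ hψ s hs

end StableTier

/-! ### Fourier inversion for the probability that J is less than Y. -/

section Inversion

variable {Ω : Type*} [MeasurableSpace Ω] {μ : Measure Ω}

/-- Half-lines form a π-system generating the Borel sets, and both sides are countably additive in
the set. Complements need the total masses to agree, which follows by letting the level tend to
infinity. -/
lemma setIntegral_preimage_eq_of_Iic [IsFiniteMeasure μ] {f : Ω → ℂ} {Y : Ω → ℝ} {D : ℝ → ℂ}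
    (hf : Integrable f μ) (hY : AEMeasurable Y μ) (hpos : ∀ᵐ ω ∂μ, 0 < Y ω)
    (hD : IntegrableOn D (Ioi 0))
    (h : ∀ u, 0 < u → ∫ ω, {ω' | Y ω' ≤ u}.indicator f ω ∂μ = ∫ y in 0..u, D y)
    {S : Set ℝ} (hS : MeasurableSet S) :
    ∫ ω in Y ⁻¹' S, f ω ∂μ = ∫ y in S, D y ∂(volume.restrict (Ioi 0)) := by
  have hm : ∀ {S : Set ℝ}, MeasurableSet S → NullMeasurableSet (Y ⁻¹' S) μ :=
    fun hS => hY.nullMeasurable hS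
  have hlim : ∫ ω, f ω ∂μ = ∫ y in Ioi 0, D y := by
    have h1 : Tendsto (fun n : ℕ => ∫ ω, {ω' | Y ω' ≤ (n : ℝ) + 1}.indicator f ω ∂μ) atTop
        (𝓝 (∫ ω, f ω ∂μ)) := by
      refine tendsto_integral_of_dominated_convergence (fun ω => ‖f ω‖)
        (fun n => hf.aestronglyMeasurable.indicator₀ (nullMeasurableSet_le hY aemeasurable_const))
        hf.norm (fun n => ae_of_all _ fun ω => norm_indicator_le_norm_self _ _)
        (ae_of_all _ fun ω => tendsto_const_nhds.congr' ?_)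
      filter_upwards [eventually_ge_atTop ⌈Y ω⌉₊] with n hn
      rw [indicator_of_mem]
      have := Nat.ceil_le.mp hn
      show Y ω ≤ n + 1
      linarith
    have h2 : Tendsto (fun n : ℕ => ∫ y in (0 : ℝ)..((n : ℝ) + 1), D y) atTop
        (𝓝 (∫ y in Ioi 0, D y)) :=
      intervalIntegral_tendsto_integral_Ioi 0 hD
        (tendsto_atTop_add_const_right _ _ tendsto_natCast_atTop_atTop)
    refine tendsto_nhds_unique h1 (h2.congr fun n => (h _ ?_).symm)
    positivity
  induction S, hS using MeasurableSpace.induction_on_inter (borel_eq_generateFrom_Iic ℝ)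
    isPiSystem_Iic with
  | empty => simp
  | basic S hS =>
    obtain ⟨u, rfl⟩ := hS
    rw [Measure.restrict_restrict measurableSet_Iic, inter_comm, Ioi_inter_Iic,
      ← integral_indicator₀ (hm measurableSet_Iic)]
    rcases lt_or_ge 0 u with hu | hu
    · rw [← intervalIntegral.integral_of_le hu.le, ← h u hu]
      rfl
    · rw [Ioc_eq_empty (not_lt.mpr hu), setIntegral_empty]
      refine integral_eq_zero_of_ae ?_
      filter_upwards [hpos] with ω hω
      exact indicator_of_notMem (by simpa using hu.trans_lt hω) _
  | compl S hS ih =>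
    have e1 := integral_add_compl₀ (hm hS) hf
    have e2 := integral_add_compl hS hD
    rw [preimage_compl, eq_sub_of_add_eq' e1, eq_sub_of_add_eq' e2, ih, hlim]
  | iUnion S hd hS ih =>
    have h1 := hasSum_integral_iUnion_ae (fun i => hm (hS i))
      (fun i j hij => ((hd hij).preimage Y).aedisjoint) hf.integrableOn
    have h2 := hasSum_integral_iUnion hS hd (f := D) (μ := volume.restrict (Ioi 0))
      (Integrable.integrableOn hD)
    simp_rw [ih] at h1
    rw [preimage_iUnion]
    exact h1.unique h2

/-- A bounded random variable weighted by `φ ∘ Y` integrates to the integral of `φ` against the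
density, if this is so for the indicators of half-lines. -/
lemma integral_mul_comp_eq_of_Iic [IsFiniteMeasure μ] {f : Ω → ℂ} {Y : Ω → ℝ} {D : ℝ → ℂ}
    (hf : Integrable f μ) (hY : AEMeasurable Y μ) (hpos : ∀ᵐ ω ∂μ, 0 < Y ω)
    (hD : IntegrableOn D (Ioi 0))
    (h : ∀ u, 0 < u → ∫ ω, {ω' | Y ω' ≤ u}.indicator f ω ∂μ = ∫ y in 0..u, D y)
    {φ : ℝ → ℂ} (hφ : Measurable φ) {C : ℝ} (hC : ∀ y, ‖φ y‖ ≤ C) :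
    ∫ ω, f ω * φ (Y ω) ∂μ = ∫ y in Ioi 0, D y * φ y := by
  have hC0 : 0 ≤ C := (norm_nonneg _).trans (hC 0)
  have hi : ∀ g : SimpleFunc ℝ ℂ, Integrable (fun ω => f ω * g (Y ω)) μ ∧
      IntegrableOn (fun y => D y * g y) (Ioi 0) := fun g => by
    obtain ⟨B, hB⟩ := g.exists_forall_norm_le
    exact ⟨hf.mul_bdd (c := B) (g.measurable.comp_aemeasurable hY).aestronglyMeasurable
        (ae_of_all _ fun ω => hB _),
      hD.mul_bdd (c := B) g.measurable.aestronglyMeasurable (ae_of_all _ hB)⟩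
  have hsimple : ∀ g : SimpleFunc ℝ ℂ, ∫ ω, f ω * g (Y ω) ∂μ = ∫ y in Ioi 0, D y * g y := by
    intro g
    induction g using SimpleFunc.induction with
    | const c hS =>
      rename_i S
      have e1 : ∀ ω, f ω * (SimpleFunc.piecewise S hS (SimpleFunc.const ℝ c)
          (SimpleFunc.const ℝ 0)) (Y ω) = (Y ⁻¹' S).indicator (fun ω => f ω * c) ω := fun ω => by
        by_cases hy : Y ω ∈ S <;> simp [hy]
      have e2 : ∀ y, D y * (SimpleFunc.piecewise S hS (SimpleFunc.const ℝ c)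
          (SimpleFunc.const ℝ 0)) y = S.indicator (fun y => D y * c) y := fun y => by
        by_cases hy : y ∈ S <;> simp [hy]
      simp_rw [e1, e2]
      rw [integral_indicator₀ (hY.nullMeasurable hS), integral_indicator hS,
        integral_mul_const, integral_mul_const,
        setIntegral_preimage_eq_of_Iic hf hY hpos hD h hS]
    | add _ h₁ h₂ =>
      rename_i g₁ g₂ _
      simp_rw [SimpleFunc.coe_add, Pi.add_apply, mul_add]
      rw [integral_add (hi g₁).1 (hi g₂).1, integral_add (hi g₁).2 (hi g₂).2, h₁, h₂]
  -- Bounded approximation by simple functions, dominated on both sides by a multiple of the norm.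
  have hs := hφ.stronglyMeasurable
  have hlim : ∀ y, Tendsto (fun n => hs.approxBounded C n y) atTop (𝓝 (φ y)) :=
    fun y => hs.tendsto_approxBounded_of_norm_le (hC y)
  have h1 : Tendsto (fun n => ∫ ω, f ω * hs.approxBounded C n (Y ω) ∂μ) atTop
      (𝓝 (∫ ω, f ω * φ (Y ω) ∂μ)) := by
    refine tendsto_integral_of_dominated_convergence (fun ω => ‖f ω‖ * C)
      (fun n => (hi _).1.aestronglyMeasurable) (hf.norm.mul_const C)
      (fun n => ae_of_all _ fun ω => ?_) (ae_of_all _ fun ω => (hlim _).const_mul _)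
    rw [norm_mul]
    gcongr
    exact hs.norm_approxBounded_le hC0 n _
  have h2 : Tendsto (fun n => ∫ y in Ioi 0, D y * hs.approxBounded C n y) atTop
      (𝓝 (∫ y in Ioi 0, D y * φ y)) := by
    refine tendsto_integral_of_dominated_convergence (fun y => ‖D y‖ * C)
      (fun n => (hi _).2.aestronglyMeasurable) (hD.norm.mul_const C)
      (fun n => ae_of_all _ fun y => ?_) (ae_of_all _ fun y => (hlim _).const_mul _)
    rw [norm_mul]
    gcongr
    exact hs.norm_approxBounded_le hC0 n _
  exact tendsto_nhds_unique h1 (h2.congr fun n => (hsimple _).symm)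

lemma integrable_comp_abs {g : ℝ → ℝ} (hg : IntegrableOn g (Ioi 0)) :
    Integrable (fun w : ℝ => g |w|) := by
  have h1 : IntegrableOn (fun w : ℝ => g |w|) (Ioi 0) :=
    hg.congr_fun (fun w hw => by simp only [abs_of_pos (mem_Ioi.mp hw)]) measurableSet_Ioi
  have h2 : IntegrableOn (fun w : ℝ => g |w|) (Iic 0) := by
    have m : MeasurableEmbedding fun x : ℝ => -x := (Homeomorph.neg ℝ).measurableEmbedding
    rw [← Measure.map_neg_eq_self (volume : Measure ℝ), m.integrableOn_map_iff]
    simp only [Function.comp_def, abs_neg, neg_preimage, neg_Iic, neg_zero]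
    exact Iff.mpr integrableOn_Ici_iff_integrableOn_Ioi h1
  rw [← integrableOn_univ, ← Iic_union_Ioi (a := (0 : ℝ))]
  exact h2.union h1

lemma integrable_exp_neg_mul_abs {ε : ℝ} (hε : 0 < ε) :
    Integrable (fun w : ℝ => Real.exp (-(ε * |w|))) := by
  have := exp_neg_integrableOn_Ioi 0 hε
  simp only [neg_mul] at this
  exact integrable_comp_abs this

lemma norm_exp_I_mul_mul (w t : ℝ) : ‖Complex.exp (Complex.I * w * t)‖ = 1 := by
  rw [show Complex.I * w * t = ((w * t : ℝ) : ℂ) * Complex.I by push_cast; ring,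
    Complex.norm_exp_ofReal_mul_I]

/-- Two half-line exponential integrals add up to the Poisson kernel, an approximate identity as ε →
0. -/
lemma integral_exp_neg_mul_abs_mul_exp {ε : ℝ} (hε : 0 < ε) (t : ℝ) :
    ∫ w : ℝ, (Real.exp (-(ε * |w|)) : ℂ) * Complex.exp (Complex.I * w * t) =
      ((2 * ε / (ε ^ 2 + t ^ 2) : ℝ) : ℂ) := by
  have hi : Integrable fun w : ℝ => (Real.exp (-(ε * |w|)) : ℂ) * Complex.exp (Complex.I * w * t) :=
    (integrable_exp_neg_mul_abs hε).ofReal.mul_bdd (c := 1)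
      (by fun_prop : Continuous fun w : ℝ => Complex.exp (Complex.I * w * t)).aestronglyMeasurable
      (ae_of_all _ fun w => (norm_exp_I_mul_mul w t).le)
  have h1 := integral_exp_mul_complex_Ioi (a := -ε + Complex.I * t) (by simpa using hε) 0
  have h2 := integral_exp_mul_complex_Iic (a := ε + Complex.I * t) (by simpa using hε) 0
  rw [← integral_add_compl (measurableSet_Iic (a := (0 : ℝ))) hi, compl_Iic,
    setIntegral_congr_fun (g := fun w : ℝ => Complex.exp ((ε + Complex.I * t) * w))
      measurableSet_Iic,
    setIntegral_congr_fun (s := Ioi 0) (g := fun w : ℝ => Complex.exp ((-ε + Complex.I * t) * w))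
      measurableSet_Ioi, h1, h2]
  · have hz1 : (ε + Complex.I * t : ℂ) ≠ 0 := fun h => by
      have := congrArg Complex.re h; simp at this; linarith
    have hz2 : (-ε + Complex.I * t : ℂ) ≠ 0 := fun h => by
      have := congrArg Complex.re h; simp at this; linarith
    have hz3 : (ε ^ 2 + t ^ 2 : ℂ) ≠ 0 := by
      exact_mod_cast (by positivity : ε ^ 2 + t ^ 2 ≠ 0)
    push_cast
    simp only [mul_zero, Complex.exp_zero]
    field_simp
    linear_combination (-(2 * ε * t ^ 2) : ℂ) * Complex.I_sq
  · intro w hw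
    simp only
    rw [abs_of_pos hw, Complex.ofReal_exp, ← Complex.exp_add]
    push_cast
    ring_nf
  · intro w hw
    simp only
    rw [abs_of_nonpos hw, Complex.ofReal_exp, ← Complex.exp_add]
    push_cast
    ring_nf

/-- The Fourier kernel of the interval from `a` to `b`. -/
noncomputable def fourierKernel (a b w : ℝ) : ℂ :=
  (Complex.exp (Complex.I * w * b) - Complex.exp (Complex.I * w * a)) /
    (2 * Real.pi * Complex.I * w)

lemma fourierKernel_eq (a b : ℝ) {w : ℝ} (hw : w ≠ 0) :
    fourierKernel a b w = (2 * Real.pi : ℂ)⁻¹ * ∫ t in a..b, Complex.exp (Complex.I * w * t) := by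
  have hw' : (w : ℂ) ≠ 0 := by exact_mod_cast hw
  rw [integral_exp_mul_complex (mul_ne_zero Complex.I_ne_zero hw'), fourierKernel]
  field_simp

/-- The bound for small w, where the quotient form looks singular; the next lemma is the one for
large w. -/
lemma norm_fourierKernel_le (a b : ℝ) {w : ℝ} (hw : w ≠ 0) :
    ‖fourierKernel a b w‖ ≤ |b - a| / (2 * Real.pi) := by
  rw [fourierKernel_eq a b hw, norm_mul, norm_inv, norm_mul, Complex.norm_ofNat, Complex.norm_real,
    Real.norm_of_nonneg Real.pi_pos.le, div_eq_inv_mul]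
  gcongr
  have := intervalIntegral.norm_integral_le_of_norm_le_const (a := a) (b := b) (C := 1)
    (f := fun t : ℝ => Complex.exp (Complex.I * w * t)) (fun t _ => (norm_exp_I_mul_mul w t).le)
  simpa using this

lemma norm_fourierKernel_le' (a b w : ℝ) : ‖fourierKernel a b w‖ ≤ 1 / (Real.pi * |w|) := by
  have h2 : ‖Complex.exp (Complex.I * w * b) - Complex.exp (Complex.I * w * a)‖ ≤ 2 := by
    refine (norm_sub_le _ _).trans ?_
    rw [norm_exp_I_mul_mul, norm_exp_I_mul_mul]
    norm_num
  rw [fourierKernel, norm_div, norm_mul, norm_mul, norm_mul, Complex.norm_ofNat, Complex.norm_real,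
    Complex.norm_I, Complex.norm_real, Real.norm_of_nonneg Real.pi_pos.le, Real.norm_eq_abs]
  calc _ ≤ 2 / (2 * Real.pi * 1 * |w|) := by gcongr
    _ = 1 / (Real.pi * |w|) := by
      rw [mul_one, mul_assoc, ← div_div, div_self two_ne_zero]

@[fun_prop]
lemma measurable_fourierKernel {α : Type*} [MeasurableSpace α] {f g h : α → ℝ} (hf : Measurable f)
    (hg : Measurable g) (hh : Measurable h) :
    Measurable fun x => fourierKernel (f x) (g x) (h x) := by
  unfold fourierKernel
  fun_prop

@[fun_prop]
lemma aemeasurable_fourierKernel {α : Type*} [MeasurableSpace α] {ν : Measure α} {f g h : α → ℝ}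
    (hf : AEMeasurable f ν) (hg : AEMeasurable g ν) (hh : AEMeasurable h ν) :
    AEMeasurable (fun x => fourierKernel (f x) (g x) (h x)) ν := by
  unfold fourierKernel
  fun_prop

/-- A transform factor exp(-iwx) translates the interval by -x, so the regularized integral compares
x with the endpoints. -/
lemma exp_mul_fourierKernel (a b w x : ℝ) :
    Complex.exp (-(Complex.I * w) * x) * fourierKernel a b w =
      fourierKernel (a - x) (b - x) w := by
  rw [fourierKernel, fourierKernel, mul_div_assoc', mul_sub, ← Complex.exp_add, ← Complex.exp_add]
  congr 3 <;> push_cast <;> ring_nf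

/-- The kernel is an average of exponentials over the interval; after Fubini the Poisson kernel is
integrated over it. -/
lemma integral_exp_mul_fourierKernel {ε : ℝ} (hε : 0 < ε) (a b : ℝ) :
    ∫ w : ℝ, (Real.exp (-(ε * |w|)) : ℂ) * fourierKernel a b w =
      (((Real.arctan (b / ε) - Real.arctan (a / ε)) / Real.pi : ℝ) : ℂ) := by
  have h0 : ∀ᵐ w : ℝ, w ≠ 0 := by simp [ae_iff]
  have hi : Integrable (Function.uncurry fun (t : ℝ) (w : ℝ) =>
      (Real.exp (-(ε * |w|)) : ℂ) * Complex.exp (Complex.I * w * t))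
      ((volume.restrict (uIoc a b)).prod volume) := by
    have h1 : Integrable (fun _ : ℝ => (1 : ℂ)) (volume.restrict (uIoc a b)) :=
      integrableOn_const measure_Ioc_lt_top.ne
    refine (h1.mul_prod (integrable_exp_neg_mul_abs hε).ofReal).mono
      (by unfold Function.uncurry; fun_prop) (ae_of_all _ fun z => ?_)
    simp only [Function.uncurry, norm_mul, norm_exp_I_mul_mul, mul_one, one_mul]
    exact le_rfl
  have hswap := intervalIntegral_integral_swap hi
  calc ∫ w : ℝ, (Real.exp (-(ε * |w|)) : ℂ) * fourierKernel a b w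
      = ∫ w : ℝ, (2 * Real.pi : ℂ)⁻¹ *
          ∫ t in a..b, (Real.exp (-(ε * |w|)) : ℂ) * Complex.exp (Complex.I * w * t) := by
        refine integral_congr_ae ?_
        filter_upwards [h0] with w hw
        rw [fourierKernel_eq a b hw, intervalIntegral.integral_const_mul]
        ring
    _ = (2 * Real.pi : ℂ)⁻¹ * ∫ t in a..b, ((2 * ε / (ε ^ 2 + t ^ 2) : ℝ) : ℂ) := by
        rw [integral_const_mul, ← hswap]
        simp_rw [integral_exp_neg_mul_abs_mul_exp hε]
    _ = _ := by
        rw [intervalIntegral.integral_ofReal]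
        have e : ∀ t : ℝ, 2 * ε / (ε ^ 2 + t ^ 2) = (2 / ε) * (1 + (t / ε) ^ 2)⁻¹ := fun t => by
          field_simp
        simp_rw [e]
        rw [intervalIntegral.integral_const_mul,
          intervalIntegral.integral_comp_div (fun t => (1 + t ^ 2)⁻¹) hε.ne',
          integral_inv_one_add_sq, smul_eq_mul]
        push_cast
        have : (ε : ℂ) ≠ 0 := by exact_mod_cast hε.ne'
        have : (Real.pi : ℂ) ≠ 0 := by exact_mod_cast Real.pi_ne_zero
        field_simp

/-- A random variable whose transform is integrable has no atom at zero. -/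
lemma measure_eq_zero_of_integrable_transform [IsProbabilityMeasure μ] {Z : Ω → ℝ}
    (hZ : AEMeasurable Z μ)
    (hi : Integrable fun w : ℝ => ∫ ω, Complex.exp (Complex.I * w * Z ω) ∂μ) :
    μ {ω | Z ω = 0} = 0 := by
  set B := ∫ w : ℝ, ‖∫ ω, Complex.exp (Complex.I * w * Z ω) ∂μ‖
  -- Pairing the transform with exp(-ε|w|) gives the mean of 2ε/(ε² + Z²). It is at most `B`, while
  -- the integrand equals 2/ε on the event Z = 0.
  have key : ∀ ε : ℝ, 0 < ε → μ.real {ω | Z ω = 0} ≤ ε * (B / 2) := by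
    intro ε hε
    have hprod : Integrable (Function.uncurry fun (ω : Ω) (w : ℝ) =>
        (Real.exp (-(ε * |w|)) : ℂ) * Complex.exp (Complex.I * w * Z ω)) (μ.prod volume) := by
      have hm : AEMeasurable (fun z : Ω × ℝ => Z z.1) (μ.prod volume) := hZ.comp_fst
      refine ((integrable_const (1 : ℂ) (μ := μ)).mul_prod
        (integrable_exp_neg_mul_abs hε).ofReal).mono
        (AEMeasurable.aestronglyMeasurable (by unfold Function.uncurry; fun_prop))
        (ae_of_all _ fun z => ?_)
      simp only [Function.uncurry, norm_mul, norm_exp_I_mul_mul, mul_one, one_mul]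
      exact le_rfl
    have hswap := integral_integral_swap hprod
    simp_rw [integral_exp_neg_mul_abs_mul_exp hε, integral_const_mul] at hswap
    rw [integral_complex_ofReal] at hswap
    have h1 : ∫ ω, 2 * ε / (ε ^ 2 + Z ω ^ 2) ∂μ ≤ B := by
      have : ‖((∫ ω, 2 * ε / (ε ^ 2 + Z ω ^ 2) ∂μ : ℝ) : ℂ)‖ ≤ B := by
        rw [hswap]
        refine (norm_integral_le_integral_norm _).trans
          (integral_mono_of_nonneg (ae_of_all _ fun w => norm_nonneg _) hi.norm
            (ae_of_all _ fun w => ?_))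
        simp only [norm_mul, Complex.norm_real, Real.norm_eq_abs, Real.abs_exp]
        refine mul_le_of_le_one_left (norm_nonneg _) (Real.exp_le_one_iff.mpr ?_)
        have := abs_nonneg w
        nlinarith
      rw [Complex.norm_real] at this
      exact (le_abs_self _).trans this
    have h2 : ∫ ω, {ω' | Z ω' = 0}.indicator (fun _ => 2 / ε) ω ∂μ ≤
        ∫ ω, 2 * ε / (ε ^ 2 + Z ω ^ 2) ∂μ := by
      refine integral_mono_of_nonneg (ae_of_all _ fun ω => indicator_nonneg
        (fun _ _ => by positivity) _) ?_ (ae_of_all _ fun ω => ?_)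
      · refine Integrable.of_bound (C := 2 / ε) (AEMeasurable.aestronglyMeasurable (by fun_prop))
          (ae_of_all _ fun ω => ?_)
        rw [Real.norm_of_nonneg (by positivity), div_le_div_iff₀ (by positivity) hε]
        nlinarith [sq_nonneg (Z ω)]
      · by_cases h : Z ω = 0
        · simp only [indicator, mem_ofPred_eq, h, if_true]
          apply le_of_eq
          field_simp
          ring
        · rw [indicator_of_notMem (by exact h)]
          positivity
    rw [integral_indicator₀ (nullMeasurableSet_eq_fun hZ aemeasurable_const),
      setIntegral_const, smul_eq_mul] at h2
    have h3 := h2.trans h1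
    rw [mul_div_assoc', div_le_iff₀ hε] at h3
    linarith
  have h0 : μ.real {ω | Z ω = 0} = 0 := by
    refine le_antisymm (le_of_forall_pos_le_add fun δ hδ => ?_) measureReal_nonneg
    have hB : 0 ≤ B := integral_nonneg fun w => norm_nonneg _
    have := key (δ / (B + 1)) (by positivity)
    refine this.trans ?_
    rw [zero_add, div_mul_eq_mul_div, div_le_iff₀ (by positivity)]
    nlinarith
  exact (measureReal_eq_zero_iff).mp h0

/-- The indicator function of the interval `(0, n]`. -/
noncomputable def levelCutoff (n : ℕ) : ℝ → ℂ := (Ioc 0 (n : ℝ)).indicator 1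

lemma measurable_levelCutoff (n : ℕ) : Measurable (levelCutoff n) :=
  measurable_one.indicator measurableSet_Ioc

lemma norm_levelCutoff_le_one (n : ℕ) (y : ℝ) : ‖levelCutoff n y‖ ≤ 1 := by
  by_cases hy : y ∈ Ioc 0 (n : ℝ) <;> simp [levelCutoff, hy]

lemma tendsto_levelCutoff (y : ℝ) (hy : 0 < y) : Tendsto (fun n => levelCutoff n y) atTop
    (𝓝 1) := by
  refine tendsto_const_nhds.congr' ?_
  filter_upwards [eventually_ge_atTop ⌈y⌉₊] with n hn
  exact (indicator_of_mem (f := (1 : ℝ → ℂ))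
    (show y ∈ Ioc 0 (n : ℝ) from ⟨hy, Nat.ceil_le.mp hn⟩)).symm

/-- Absolute integrability of the product of density and kernel permits both removing the damping
and exchanging the order of integration. -/
lemma tendsto_integral_regularized {D k : ℝ → ℝ → ℂ}
    (hDK : Integrable (fun z : ℝ × ℝ => D z.1 z.2 * k z.1 z.2)
      (volume.prod (volume.restrict (Ioi 0)))) :
    Tendsto (fun n : ℕ => ∫ w, ∫ y in Ioi 0,
      D w y * ((Real.exp (-((1 / ((n : ℝ) + 1)) * |w|)) : ℂ) * (levelCutoff n y * k w y))) atTop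
      (𝓝 (∫ y in Ioi 0, ∫ w, D w y * k w y)) := by
  have hε : ∀ n : ℕ, 0 < 1 / ((n : ℝ) + 1) := fun n => by positivity
  have hm : ∀ n : ℕ, AEStronglyMeasurable (fun z : ℝ × ℝ =>
      (Real.exp (-((1 / ((n : ℝ) + 1)) * |z.1|)) : ℂ) *
      levelCutoff n z.2) (volume.prod (volume.restrict (Ioi 0))) := fun n => by
    refine Measurable.aestronglyMeasurable ?_
    exact Measurable.mul (by fun_prop) ((measurable_levelCutoff n).comp measurable_snd)
  have hb : ∀ (n : ℕ) (z : ℝ × ℝ), ‖(Real.exp (-((1 / ((n : ℝ) + 1)) * |z.1|)) : ℂ) *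
      levelCutoff n z.2‖ ≤ 1 := fun n z => by
    rw [norm_mul, Complex.norm_real, Real.norm_eq_abs, Real.abs_exp]
    refine mul_le_one₀ (Real.exp_le_one_iff.mpr ?_) (norm_nonneg _) (norm_levelCutoff_le_one _ _)
    have := mul_nonneg (hε n).le (abs_nonneg z.1)
    linarith
  have e : ∀ (n : ℕ) w y, D w y * ((Real.exp (-((1 / ((n : ℝ) + 1)) * |w|)) : ℂ) *
      (levelCutoff n y * k w y)) =
      D w y * k w y * ((Real.exp (-((1 / ((n : ℝ) + 1)) * |w|)) : ℂ) * levelCutoff n y) :=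
          fun n w y => by ring
  have hn : ∀ n : ℕ, Integrable (fun z : ℝ × ℝ => D z.1 z.2 * k z.1 z.2 *
      ((Real.exp (-((1 / ((n : ℝ) + 1)) * |z.1|)) : ℂ) * levelCutoff n z.2)) (volume.prod
          (volume.restrict (Ioi 0))) :=
    fun n => hDK.mul_bdd (c := 1) (hm n) (ae_of_all _ (hb n))
  simp_rw [e]
  rw [← integral_integral_swap (f := fun w y => D w y * k w y) hDK, integral_integral hDK]
  have := fun n : ℕ => integral_integral (f := fun w y => D w y * k w y *
    ((Real.exp (-((1 / ((n : ℝ) + 1)) * |w|)) : ℂ) * levelCutoff n y)) (hn n)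
  simp_rw [this]
  refine tendsto_integral_of_dominated_convergence (fun z => ‖D z.1 z.2 * k z.1 z.2‖)
    (fun n => (hn n).aestronglyMeasurable) hDK.norm
    (fun n => ae_of_all _ fun z => ?_) ?_
  · rw [norm_mul]
    exact mul_le_of_le_one_right (norm_nonneg _) (hb n z)
  · have hz : ∀ᵐ z : ℝ × ℝ ∂(volume.prod (volume.restrict (Ioi 0))), 0 < z.2 :=
      Measure.quasiMeasurePreserving_snd.ae (ae_restrict_mem measurableSet_Ioi)
    filter_upwards [hz] with z hz
    have h1 : Tendsto (fun n : ℕ => (Real.exp (-((1 / ((n : ℝ) + 1)) * |z.1|)) : ℂ)) atTop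
        (𝓝 1) := by
      have : Tendsto (fun n : ℕ => Real.exp (-((1 / ((n : ℝ) + 1)) * |z.1|))) atTop
          (𝓝 (Real.exp (-(0 * |z.1|)))) :=
        (Real.continuous_exp.tendsto _).comp
            (tendsto_one_div_add_atTop_nhds_zero_nat.mul_const _).neg
      rw [zero_mul, neg_zero, Real.exp_zero] at this
      exact_mod_cast (Complex.continuous_ofReal.tendsto _).comp this
    simpa using (h1.mul (tendsto_levelCutoff z.2 hz)).const_mul (D z.1 z.2 * k z.1 z.2)

/-- For fixed w the density represents expectations of exp(-iwJ) φ(Y). With the Fourier kernel as φ,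
Fubini and the arctangent formula evaluate the w-integral pathwise. The cutoff in y bounds the
length of the interval and so makes Fubini legitimate. -/
lemma integral_regularized_eq [IsProbabilityMeasure μ] {J Y : Ω → ℝ} (hJ : AEMeasurable J μ)
    (hY : AEMeasurable Y μ) {κ η : ℝ} {D : ℝ → ℝ → ℂ}
    (hrep : ∀ᵐ w : ℝ, ∀ φ : ℝ → ℂ, Measurable φ → ∀ C : ℝ, (∀ y, ‖φ y‖ ≤ C) →
      ∫ ω, Complex.exp (-(Complex.I * w) * J ω) * φ (Y ω) ∂μ = ∫ y in Ioi 0, D w y * φ y)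
    (n : ℕ) {ε : ℝ} (hε : 0 < ε) :
    ∫ w, ∫ y in Ioi 0, D w y * ((Real.exp (-(ε * |w|)) : ℂ) *
        (levelCutoff n y * fourierKernel (y / κ + η) y w)) =
      ∫ ω, levelCutoff n (Y ω) * (((Real.arctan ((Y ω - J ω) / ε) -
        Real.arctan ((Y ω / κ + η - J ω) / ε)) / Real.pi : ℝ) : ℂ) ∂μ := by
  have h0 : ∀ᵐ w : ℝ, w ≠ 0 := by simp [ae_iff]
  have hprod : Integrable (Function.uncurry fun (ω : Ω) (w : ℝ) => levelCutoff n (Y ω) *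
      ((Real.exp (-(ε * |w|)) : ℂ) *
        fourierKernel (Y ω / κ + η - J ω) (Y ω - J ω) w)) (μ.prod volume) := by
    have hYm : AEMeasurable (fun z : Ω × ℝ => Y z.1) (μ.prod volume) := hY.comp_fst
    have hJm : AEMeasurable (fun z : Ω × ℝ => J z.1) (μ.prod volume) := hJ.comp_fst
    have hf : AEMeasurable (fun z : Ω × ℝ => fourierKernel (Y z.1 / κ + η - J z.1)
        (Y z.1 - J z.1) z.2) (μ.prod volume) := by fun_prop
    have hc : AEMeasurable (fun z : Ω × ℝ => levelCutoff n (Y z.1)) (μ.prod volume) :=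
      (measurable_levelCutoff n).comp_aemeasurable hYm
    -- A bound of the interval length |y - y/κ - η| for 0 < y ≤ n, divided by 2π.
    set C := (n + n * |κ|⁻¹ + |η|) / (2 * Real.pi)
    refine ((integrable_const (C : ℂ) (μ := μ)).mul_prod
      (integrable_exp_neg_mul_abs (hε)).ofReal).mono
      (AEMeasurable.aestronglyMeasurable (hc.mul (AEMeasurable.mul (by fun_prop) hf))) ?_
    have hz : ∀ᵐ z : Ω × ℝ ∂(μ.prod volume), z.2 ≠ 0 :=
      Measure.quasiMeasurePreserving_snd.ae h0
    filter_upwards [hz] with z hz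
    have hC : 0 ≤ C := by positivity
    by_cases hy : Y z.1 ∈ Ioc 0 (n : ℝ)
    · have hb : ‖fourierKernel (Y z.1 / κ + η - J z.1) (Y z.1 - J z.1) z.2‖ ≤ C := by
        refine (norm_fourierKernel_le _ _ hz).trans ?_
        refine div_le_div_of_nonneg_right ?_ (by positivity)
        rw [sub_sub_sub_cancel_right, sub_add_eq_sub_sub]
        refine (abs_sub _ _).trans (add_le_add ((abs_sub _ _).trans (add_le_add ?_ ?_)) le_rfl)
        · rw [abs_of_pos hy.1]
          exact hy.2
        · rw [abs_div, abs_of_pos hy.1, div_eq_mul_inv]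
          exact mul_le_mul_of_nonneg_right hy.2 (by positivity)
      simp only [Function.uncurry, norm_mul]
      calc _ ≤ 1 * (‖((Real.exp (-(ε * |z.2|)) : ℝ) : ℂ)‖ * C) := by
            gcongr
            exact norm_levelCutoff_le_one _ _
        _ = ‖(C : ℂ)‖ * ‖((Real.exp (-(ε * |z.2|)) : ℝ) : ℂ)‖ := by
            rw [Complex.norm_of_nonneg hC]
            ring
        _ ≤ _ := le_rfl
    · have : levelCutoff n (Y z.1) = 0 := indicator_of_notMem hy _
      simp only [Function.uncurry, this, zero_mul, norm_zero]
      exact norm_nonneg _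
  have hswap := integral_integral_swap hprod
  simp_rw [integral_const_mul, integral_exp_mul_fourierKernel (hε)] at hswap
  rw [hswap]
  refine integral_congr_ae ?_
  filter_upwards [h0, hrep] with w hw hr
  -- For the given w ≠ 0 the test function is bounded by 1/(π|w|); uniformity in w is not required
  -- here.
  have := hr (fun y => (Real.exp (-(ε * |w|)) : ℂ) * (levelCutoff n y *
      fourierKernel (y / κ + η) y w))
    (Measurable.mul measurable_const ((measurable_levelCutoff n).mul (by fun_prop)))
    (1 * (1 * (1 / (Real.pi * |w|)))) (fun y => by
      rw [norm_mul, norm_mul]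
      gcongr
      · rw [Complex.norm_real, Real.norm_eq_abs, Real.abs_exp]
        refine Real.exp_le_one_iff.mpr ?_
        have := mul_nonneg (hε).le (abs_nonneg w)
        linarith
      · exact norm_levelCutoff_le_one _ _
      · exact norm_fourierKernel_le' _ _ _)
  rw [← this]
  refine integral_congr_ae (ae_of_all _ fun ω => ?_)
  simp only
  rw [← exp_mul_fourierKernel]
  ring
-- The lower endpoint lies below J, so its arctangent tends to -π/2. The upper one tends to π/2 or
-- -π/2 according as J < Y or J > Y. This stays correct for a reversed interval, where J > Y as
-- well.
lemma tendsto_integral_arctan [IsProbabilityMeasure μ] {J Y : Ω → ℝ} (hJ : AEMeasurable J μ)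
    (hY : AEMeasurable Y μ) (hpos : ∀ᵐ ω ∂μ, 0 < Y ω) {κ η : ℝ}
    (hlt : ∀ᵐ ω ∂μ, Y ω / κ + η < J ω) (hne : ∀ᵐ ω ∂μ, Y ω - J ω ≠ 0) :
    Tendsto (fun n : ℕ => ∫ ω, levelCutoff n (Y ω) *
        (((Real.arctan ((Y ω - J ω) / (1 / ((n : ℝ) + 1))) -
        Real.arctan ((Y ω / κ + η - J ω) / (1 / ((n : ℝ) + 1)))) / Real.pi : ℝ) : ℂ) ∂μ) atTop
      (𝓝 (∫ ω, {ω' | J ω' < Y ω'}.indicator (fun _ => (1 : ℂ)) ω ∂μ)) := by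
  have harg : Tendsto (fun n : ℕ => (1 / ((n : ℝ) + 1))⁻¹) atTop atTop := by
    simp_rw [one_div, inv_inv]
    exact tendsto_atTop_add_const_right _ _ tendsto_natCast_atTop_atTop
  refine tendsto_integral_of_dominated_convergence (fun _ => 1) (fun n => ?_)
    (integrable_const _) (fun n => ae_of_all _ fun ω => ?_) ?_
  · exact (((measurable_levelCutoff n).comp_aemeasurable hY).mul (by fun_prop)).aestronglyMeasurable
  · rw [norm_mul, Complex.norm_real, Real.norm_eq_abs]
    refine mul_le_one₀ (norm_levelCutoff_le_one _ _) (abs_nonneg _) ?_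
    rw [abs_div, abs_of_pos Real.pi_pos, div_le_one Real.pi_pos, abs_le]
    have h1 := Real.arctan_lt_pi_div_two ((Y ω - J ω) / (1 / ((n : ℝ) + 1)))
    have h2 := Real.neg_pi_div_two_lt_arctan ((Y ω - J ω) / (1 / ((n : ℝ) + 1)))
    have h3 := Real.arctan_lt_pi_div_two ((Y ω / κ + η - J ω) / (1 / ((n : ℝ) + 1)))
    have h4 := Real.neg_pi_div_two_lt_arctan ((Y ω / κ + η - J ω) / (1 / ((n : ℝ) + 1)))
    constructor <;> linarith
  · have hne : ∀ᵐ ω ∂μ, Y ω - J ω ≠ 0 := hne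
    filter_upwards [hpos, hlt, hne] with ω h1 h2 h3
    have htop : ∀ x : ℝ, 0 < x → Tendsto (fun n : ℕ => Real.arctan (x / (1 / ((n : ℝ) + 1)))) atTop
        (𝓝 (Real.pi / 2)) := fun x hx =>
      (Real.tendsto_arctan_atTop.mono_right nhdsWithin_le_nhds).comp
        (harg.const_mul_atTop hx)
    have hbot : ∀ x : ℝ, x < 0 → Tendsto (fun n : ℕ => Real.arctan (x / (1 / ((n : ℝ) + 1)))) atTop
        (𝓝 (-(Real.pi / 2))) := fun x hx =>
      (Real.tendsto_arctan_atBot.mono_right nhdsWithin_le_nhds).comp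
        (harg.const_mul_atTop_of_neg hx)
    have hb := hbot (Y ω / κ + η - J ω) (by linarith)
    by_cases hc : J ω < Y ω
    · have ha := htop (Y ω - J ω) (by linarith)
      have := (tendsto_levelCutoff _ h1).mul
        ((Complex.continuous_ofReal.tendsto _).comp ((ha.sub hb).div_const Real.pi))
      rw [indicator_of_mem (by exact hc)]
      have e : (Real.pi / 2 - -(Real.pi / 2)) / Real.pi = 1 := by
        rw [sub_neg_eq_add, add_halves, div_self Real.pi_ne_zero]
      rw [e, Complex.ofReal_one, mul_one] at this
      exact this
    · have ha := hbot (Y ω - J ω) (lt_of_le_of_ne (by linarith) h3)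
      have := (tendsto_levelCutoff _ h1).mul
        ((Complex.continuous_ofReal.tendsto _).comp ((ha.sub hb).div_const Real.pi))
      rw [indicator_of_notMem (by exact hc)]
      rw [sub_self, zero_div, Complex.ofReal_zero, mul_zero] at this
      exact this
/-- The probability that `J < Y`, in terms of the density of the transform of `J` on the range
of `Y`. -/
theorem measureReal_lt_eq_integral [IsProbabilityMeasure μ] {J Y : Ω → ℝ} (hJ : AEMeasurable J μ)
    (hY : AEMeasurable Y μ) (hpos : ∀ᵐ ω ∂μ, 0 < Y ω) {κ η : ℝ}
    (hlt : ∀ᵐ ω ∂μ, Y ω / κ + η < J ω) {D : ℝ → ℝ → ℂ}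
    (hDi : Integrable (Function.uncurry D) (volume.prod (volume.restrict (Ioi 0))))
    (hDK : Integrable (fun z : ℝ × ℝ => D z.1 z.2 * fourierKernel (z.2 / κ + η) z.2 z.1)
      (volume.prod (volume.restrict (Ioi 0))))
    (h : ∀ w : ℝ, w ≠ 0 → ∀ u : ℝ, 0 < u →
      ∫ ω, {ω' | Y ω' ≤ u}.indicator (fun ω' => Complex.exp (-(Complex.I * w) * J ω')) ω ∂μ =
        ∫ y in 0..u, D w y) :
    (μ.real {ω | J ω < Y ω} : ℂ) =
      ∫ y in Ioi 0, ∫ w, D w y * fourierKernel (y / κ + η) y w := by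
  have h0 : ∀ᵐ w : ℝ, w ≠ 0 := by simp [ae_iff]
  have hnorm : ∀ w x : ℝ, ‖Complex.exp (-(Complex.I * w) * x)‖ = 1 := fun w x => by
    rw [← norm_exp_I_mul_mul (-w) x]
    push_cast
    ring_nf
  -- The integrability of D(w, ·) comes from Fubini, hence only for almost every w.
  have hrep : ∀ᵐ w : ℝ, ∀ φ : ℝ → ℂ, Measurable φ → ∀ C : ℝ, (∀ y, ‖φ y‖ ≤ C) →
      ∫ ω, Complex.exp (-(Complex.I * w) * J ω) * φ (Y ω) ∂μ = ∫ y in Ioi 0, D w y * φ y := by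
    filter_upwards [h0, hDi.prod_right_ae] with w hw hDw φ hφ C hC
    refine integral_mul_comp_eq_of_Iic (Integrable.of_bound (C := 1)
      (AEMeasurable.aestronglyMeasurable (by fun_prop)) (ae_of_all _ fun ω => (hnorm w _).le))
      hY hpos hDw (h w hw) hφ hC
  -- The transform of Y - J at w is the integral of D(w, y) exp(iwy) over y, which is integrable in
  -- w.
  have hne : ∀ᵐ ω ∂μ, Y ω - J ω ≠ 0 := by
    rw [ae_iff]
    simp only [ne_eq, not_not]
    refine measure_eq_zero_of_integrable_transform (by fun_prop) ?_
    have hi : Integrable (fun z : ℝ × ℝ => D z.1 z.2 * Complex.exp (Complex.I * z.1 * z.2))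
        (volume.prod (volume.restrict (Ioi 0))) :=
      hDi.mul_bdd (c := 1) (by fun_prop) (ae_of_all _ fun z => (norm_exp_I_mul_mul _ _).le)
    refine hi.integral_prod_left.congr ?_
    filter_upwards [hrep] with w hw
    have := hw (fun y => Complex.exp (Complex.I * w * y)) (by fun_prop) 1
      (fun y => (norm_exp_I_mul_mul _ _).le)
    rw [← this]
    refine integral_congr_ae (ae_of_all _ fun ω => ?_)
    simp only
    rw [← Complex.exp_add]
    push_cast
    ring_nf
  rw [tendsto_nhds_unique ((tendsto_integral_regularized hDK).congr fun n =>
      integral_regularized_eq hJ hY hrep n (by positivity))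
      (tendsto_integral_arctan hJ hY hpos hlt hne),
    integral_indicator₀ (nullMeasurableSet_lt hJ hY), setIntegral_const]
  simp

end Inversion

/-! ### Spectral densities and absolute convergence. -/

/-- A function of the Fourier variable and of a positive level that decays like a stretched
exponential in the former, and is integrable against a small power of the latter. -/
structure SpectralDensity (D : ℝ → ℝ → ℂ) : Prop where
  meas : Measurable (Function.uncurry D)
  bound : ∃ c α δ : ℝ, 0 < c ∧ 0 < α ∧ 0 < δ ∧ δ ≤ 1 ∧ ∃ g : ℝ → ℝ,
    IntegrableOn (fun y => (1 + y ^ δ) * g y) (Ioi 0) ∧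
    ∀ w, w ≠ 0 → ∀ y, 0 < y → ‖D w y‖ ≤ Real.exp (-(c * |w| ^ α)) * g y

/-- With t = |w|(y + η) the kernel is at most min(1, t)/|w|, and min(1, t) ≤ t^δ. Only a small power
of y is spent, at the price of the integrable singularity |w|^(δ-1). -/
lemma norm_fourierKernel_le_rpow {κ η y w δ : ℝ} (hκ : 1 ≤ κ) (hη : 0 ≤ η) (hy : 0 < y)
    (hw : w ≠ 0) (hδ : 0 < δ) (hδ1 : δ ≤ 1) :
    ‖fourierKernel (y / κ + η) y w‖ ≤ |w| ^ (δ - 1) * ((1 + η ^ δ) * (1 + y ^ δ)) := by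
  have hw' : 0 < |w| := abs_pos.mpr hw
  have hyη : 0 < y + η := by linarith
  have hπ := Real.pi_gt_three
  have h1 : ‖fourierKernel (y / κ + η) y w‖ ≤ (|w| * (y + η)) ^ δ / |w| := by
    rcases le_total 1 (|w| * (y + η)) with h | h
    · calc _ ≤ 1 / (Real.pi * |w|) := norm_fourierKernel_le' _ _ _
        _ ≤ 1 / |w| := by
          gcongr
          nlinarith
        _ ≤ _ := by
          gcongr
          exact Real.one_le_rpow h hδ.le
    · calc _ ≤ |y - (y / κ + η)| / (2 * Real.pi) := norm_fourierKernel_le _ _ hw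
        _ ≤ |y - (y / κ + η)| := div_le_self (abs_nonneg _) (by linarith)
        _ ≤ y + η := by
          have h2 : y / κ ≤ y := div_le_self hy.le hκ
          have h3 : 0 ≤ y / κ := by positivity
          rw [abs_le]
          constructor <;> linarith
        _ = |w| * (y + η) / |w| := by field_simp
        _ ≤ _ := by
          gcongr
          exact Real.self_le_rpow_of_le_one (by positivity) h hδ1
  refine h1.trans ?_
  rw [Real.mul_rpow hw'.le hyη.le, mul_div_right_comm, Real.rpow_sub_one hw'.ne']
  gcongr
  have h2 : (y + η) ^ δ ≤ y ^ δ + η ^ δ := Real.rpow_add_le_add_rpow hy.le hη hδ.le hδ1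
  have h3 : 0 ≤ y ^ δ := by positivity
  have h4 : 0 ≤ η ^ δ := by positivity
  nlinarith [mul_nonneg h3 h4]

lemma integrable_abs_rpow_mul_exp_neg {s c α : ℝ} (hs : -1 < s) (hc : 0 < c) (hα : 0 < α) :
    Integrable fun w : ℝ => |w| ^ s * Real.exp (-(c * |w| ^ α)) := by
  have := integrableOn_rpow_mul_exp_neg_mul_rpow hs hα hc
  simp only [neg_mul] at this
  exact integrable_comp_abs this

namespace SpectralDensity

variable {D : ℝ → ℝ → ℂ}

lemma integrable (hD : SpectralDensity D) :
    Integrable (Function.uncurry D) (volume.prod (volume.restrict (Ioi 0))) := by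
  obtain ⟨c, α, δ, hc, hα, hδ, hδ1, g, hg, hb⟩ := hD.bound
  have h1 := integrable_abs_rpow_mul_exp_neg (s := 0) (by norm_num) hc hα
  refine (h1.mul_prod hg).mono hD.meas.aestronglyMeasurable ?_
  have hz : ∀ᵐ z : ℝ × ℝ ∂(volume.prod (volume.restrict (Ioi 0))), 0 < z.2 :=
    Measure.quasiMeasurePreserving_snd.ae (ae_restrict_mem measurableSet_Ioi)
  have hz' : ∀ᵐ z : ℝ × ℝ ∂(volume.prod (volume.restrict (Ioi 0))), z.1 ≠ 0 :=
    Measure.quasiMeasurePreserving_fst.ae (p := fun w : ℝ => w ≠ 0) (by simp [ae_iff])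
  filter_upwards [hz, hz'] with z h1 h2
  have hg0 : 0 ≤ g z.2 := by
    have := (norm_nonneg _).trans (hb z.1 h2 z.2 h1)
    exact nonneg_of_mul_nonneg_right this (Real.exp_pos _)
  have h3 : 0 ≤ z.2 ^ δ := by positivity
  refine (hb z.1 h2 z.2 h1).trans ((?_ : _ ≤ _).trans (le_abs_self _))
  rw [Real.rpow_zero, one_mul]
  gcongr
  nlinarith

lemma norm_mul_kernel_le (hD : SpectralDensity D) {κ η : ℝ} (hκ : 1 ≤ κ) (hη : 0 ≤ η) :
    ∃ G : ℝ → ℝ, Integrable G ∧ ∃ g : ℝ → ℝ, IntegrableOn g (Ioi 0) ∧ ∀ w, w ≠ 0 → ∀ y, 0 < y →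
      ‖D w y * fourierKernel (y / κ + η) y w‖ ≤ G w * g y := by
  obtain ⟨c, α, δ, hc, hα, hδ, hδ1, g, hg, hb⟩ := hD.bound
  refine ⟨_, integrable_abs_rpow_mul_exp_neg (s := δ - 1) (by linarith) hc hα, _,
    hg.const_mul (1 + η ^ δ), fun w hw y hy => ?_⟩
  rw [norm_mul]
  have hg0 : 0 ≤ Real.exp (-(c * |w| ^ α)) * g y := (norm_nonneg _).trans (hb w hw y hy)
  calc _ ≤ (Real.exp (-(c * |w| ^ α)) * g y) *
        (|w| ^ (δ - 1) * ((1 + η ^ δ) * (1 + y ^ δ))) :=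
        mul_le_mul (hb w hw y hy) (norm_fourierKernel_le_rpow hκ hη hy hw hδ hδ1)
          (norm_nonneg _) hg0
    _ = _ := by ring

lemma integrable_mul_kernel (hD : SpectralDensity D) {κ η : ℝ} (hκ : 1 ≤ κ) (hη : 0 ≤ η) :
    Integrable (fun z : ℝ × ℝ => D z.1 z.2 * fourierKernel (z.2 / κ + η) z.2 z.1)
      (volume.prod (volume.restrict (Ioi 0))) := by
  obtain ⟨G, hG, g, hg, hb⟩ := hD.norm_mul_kernel_le hκ hη
  refine (hG.mul_prod hg).mono (Measurable.aestronglyMeasurable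
    (hD.meas.mul (by fun_prop))) ?_
  have hz : ∀ᵐ z : ℝ × ℝ ∂(volume.prod (volume.restrict (Ioi 0))), 0 < z.2 :=
    Measure.quasiMeasurePreserving_snd.ae (ae_restrict_mem measurableSet_Ioi)
  have hz' : ∀ᵐ z : ℝ × ℝ ∂(volume.prod (volume.restrict (Ioi 0))), z.1 ≠ 0 :=
    Measure.quasiMeasurePreserving_fst.ae (p := fun w : ℝ => w ≠ 0) (by simp [ae_iff])
  filter_upwards [hz, hz'] with z h1 h2
  exact (hb z.1 h2 z.2 h1).trans (le_abs_self _)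

lemma integrable_mul_kernel_right (hD : SpectralDensity D) {κ η y : ℝ} (hκ : 1 ≤ κ) (hη : 0 ≤ η)
    (hy : 0 < y) : Integrable fun w => D w y * fourierKernel (y / κ + η) y w := by
  obtain ⟨G, hG, g, hg, hb⟩ := hD.norm_mul_kernel_le hκ hη
  refine (hG.mul_const (g y)).mono (Measurable.aestronglyMeasurable
    ((hD.meas.comp measurable_prodMk_right).mul (by fun_prop))) ?_
  have h0 : ∀ᵐ w : ℝ, w ≠ 0 := by simp [ae_iff]
  filter_upwards [h0] with w hw
  exact (hb w hw y hy).trans (le_abs_self _)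

lemma integrableOn_integral_mul_kernel (hD : SpectralDensity D) {κ η : ℝ} (hκ : 1 ≤ κ)
    (hη : 0 ≤ η) :
    IntegrableOn (fun y => ∫ w, D w y * fourierKernel (y / κ + η) y w) (Ioi 0) :=
  (hD.integrable_mul_kernel hκ hη).integral_prod_right

end SpectralDensity

/-! ### Almost sure summability of the received powers. -/

section

variable {Ω : Type*} [MeasurableSpace Ω] {μ : Measure Ω} {K L : ℕ}

/-- `λ π P ^ (2 / ε)` -/
noncomputable def Params.intensity (p : Params K L) (t : Tier K L) : ℝ :=
  p.dens t * Real.pi * p.pow t ^ p.expo t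

lemma Params.Admissible.stableTier {p : Params K L} (hp : p.Admissible) (t : Tier K L) :
    StableTier (p.expo t) (p.intensity t) (p.fading t) := by
  have h2 := hp.ple_gt_two t
  have h1 := hp.dens_pos t
  have h3 := hp.pow_pos t
  refine ⟨div_pos two_pos (by linarith), ?_, ?_, hp.fading_prob t, hp.fading_pos t,
    hp.fading_moment t⟩
  · rw [Params.expo, div_lt_one (by linarith)]
    exact h2
  · unfold Params.intensity
    positivity

lemma rx_eq {Ω : Type*} {p : Params K L} (hp : p.Admissible) (X : Tier K L → ℕ → Ω → Plane)
    (Ψ : Tier K L → ℕ → Ω → ℝ) (t : Tier K L) (n : ℕ) (ω : Ω) :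
    rx p X Ψ t n ω = Ψ t n ω * gain (p.expo t) (p.intensity t) (arrival p X t n ω) := by
  have h2 := hp.ple_gt_two t
  have h1 := hp.dens_pos t
  have h3 := hp.pow_pos t
  have hπ := Real.pi_pos
  have hr := norm_nonneg (X t n ω)
  have ha := (hp.stableTier t).exp_pos
  have e1 : p.intensity t / arrival p X t n ω = p.pow t ^ p.expo t / ‖X t n ω‖ ^ (2 : ℝ) := by
    rw [Params.intensity, arrival, mul_div_mul_left _ _ (by positivity), Real.rpow_two]
  have e2 : (2 : ℝ) * (1 / p.expo t) = p.ple t := by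
    rw [Params.expo]
    field_simp
  rw [rx, gain, e1, Real.div_rpow (by positivity) (by positivity), ← Real.rpow_mul h3.le,
    mul_one_div_cancel ha.ne', Real.rpow_one, ← Real.rpow_mul hr, e2, Real.rpow_neg hr]
  ring

/-- `exp (-θ |x|)` -/
noncomputable def damp (θ x : ℝ) : ℂ := Complex.exp (-(θ * |x|))

lemma damp_eq (θ x : ℝ) : damp θ x = (Real.exp (-(θ * |x|)) : ℝ) := by
  rw [damp]
  push_cast
  rfl

lemma continuous_damp (θ : ℝ) : Continuous (damp θ) := by
  unfold damp
  fun_prop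

lemma norm_damp_le_one {θ : ℝ} (hθ : 0 ≤ θ) (x : ℝ) : ‖damp θ x‖ ≤ 1 := by
  rw [damp_eq, Complex.norm_real, Real.norm_eq_abs, Real.abs_exp, Real.exp_le_one_iff]
  have := mul_nonneg hθ (abs_nonneg x)
  linarith

namespace StableTier

variable {a c : ℝ} {F : Measure ℝ}

lemma integrableOn_damp (hS : StableTier a c F) {θ : ℝ} (hθ : 0 ≤ θ) :
    IntegrableOn (fun x => x ^ (-a - 1) • (1 - damp θ x)) (Ioi 0) := by
  have := integrableOn_rpow_smul_one_sub_exp hS.exp_pos hS.exp_lt_one (z := (θ : ℂ)) (by simpa)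
  refine this.congr_fun (fun x hx => ?_) measurableSet_Ioi
  simp only [damp, abs_of_pos (mem_Ioi.mp hx)]

lemma markFun_damp (hS : StableTier a c F) {θ : ℝ} (hθ : 0 ≤ θ) :
    MarkFun F (fun s ψ => damp θ (ψ * gain a c s)) :=
  hS.markFun (continuous_damp θ).measurable (norm_damp_le_one hθ)
    fun _ _ => (continuous_damp θ).continuousWithinAt

/-- The function 1 - exp(-θ|x|) increases with θ, so the case θ = 1 dominates and the exponent tends
to 0. -/
lemma tendsto_tailPGF_damp (hS : StableTier a c F) {θ : ℕ → ℝ} (hθ : ∀ n, 0 ≤ θ n)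
    (hθ1 : ∀ n, θ n ≤ 1) (h0 : Tendsto θ atTop (𝓝 0)) :
    Tendsto (fun n => tailPGF (markMean F (fun s ψ => damp (θ n) (ψ * gain a c s))) 0) atTop
      (𝓝 1) := by
  have e := fun n => hS.tailPGF_zero (continuous_damp (θ n)).measurable
    (norm_damp_le_one (hθ n)) (hS.integrableOn_damp (hθ n))
  simp_rw [e]
  have hlim : Tendsto (fun n => ∫ x in Ioi 0, (a * x ^ (-a - 1)) • (1 - damp (θ n) x)) atTop
      (𝓝 (∫ _ in Ioi (0 : ℝ), (0 : ℂ))) := by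
    have hi : ∀ r, 0 ≤ r → IntegrableOn (fun x => (a * x ^ (-a - 1)) • (1 - damp r x)) (Ioi 0) := by
      intro r hr
      refine ((hS.integrableOn_damp hr).smul a).congr (ae_of_all _ fun x => ?_)
      simp only [Pi.smul_apply, smul_smul]
    refine tendsto_integral_of_dominated_convergence
      (fun x => ‖(a * x ^ (-a - 1)) • (1 - damp 1 x)‖) (fun n => (hi _ (hθ n)).aestronglyMeasurable)
      (hi 1 zero_le_one).norm (fun n => ae_of_all _ fun x => ?_) (ae_of_all _ fun x => ?_)
    · rw [norm_smul, norm_smul]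
      gcongr
      rw [damp_eq, damp_eq, ← Complex.ofReal_one, ← Complex.ofReal_sub, ← Complex.ofReal_sub,
        Complex.norm_real, Complex.norm_real]
      have h1 : Real.exp (-(1 * |x|)) ≤ Real.exp (-(θ n * |x|)) := by
        gcongr
        exact hθ1 n
      have h2 : Real.exp (-(θ n * |x|)) ≤ 1 := Real.exp_le_one_iff.mpr
        (neg_nonpos.mpr (mul_nonneg (hθ n) (abs_nonneg x)))
      rw [Real.norm_of_nonneg (by linarith), Real.norm_of_nonneg (by linarith)]
      linarith
    · have h1 : Tendsto (fun n => damp (θ n) x) atTop (𝓝 1) := by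
        have : Continuous fun r : ℝ => damp r x := by
          unfold damp
          fun_prop
        have h2 := (this.tendsto 0).comp h0
        simpa [damp, Function.comp_def] using h2
      simpa using (h1.const_sub 1).const_smul (a * x ^ (-a - 1))
  rw [integral_zero] at hlim
  have := (Complex.continuous_exp.tendsto _).comp
    (hlim.const_mul ((c * ∫ ψ, ψ ^ a ∂F : ℝ) : ℂ)).neg
  rw [mul_zero, neg_zero, Complex.exp_zero] at this
  exact this

end StableTier

namespace IsNetwork

variable [IsProbabilityMeasure μ] {p : Params K L} {X : Tier K L → ℕ → Ω → Plane}
  {Ψ : Tier K L → ℕ → Ω → ℝ}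

lemma measurable_rx (hp : p.Admissible) (hnet : IsNetwork p μ X Ψ) (t : Tier K L) (n : ℕ) :
    Measurable (rx p X Ψ t n) := by
  have h1 := hnet.fading_measurable t n
  have h2 := (hnet.isUnitPoisson hp t).measurable n
  simp_rw [funext (rx_eq hp X Ψ t n)]
  fun_prop

lemma ae_rx_pos (hp : p.Admissible) (hnet : IsNetwork p μ X Ψ) :
    ∀ᵐ ω ∂μ, ∀ t n, 0 < rx p X Ψ t n ω := by
  have h1 : ∀ t n, ∀ᵐ ω ∂μ, 0 < Ψ t n ω := fun t n => by
    have := hp.fading_pos t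
    rw [← hnet.fading_law t n] at this
    exact ae_of_ae_map (hnet.fading_measurable t n).aemeasurable this
  filter_upwards [ae_all_iff.mpr fun t => ae_all_iff.mpr (h1 t),
    ae_all_iff.mpr fun t => (hnet.isUnitPoisson hp t).pos] with ω hΨ hA t n
  rw [rx_eq hp]
  exact mul_pos (hΨ t n) (gain_pos (hp.stableTier t).int_pos (hA t n))

/-- The received powers of all tiers are almost surely summable. -/
theorem ae_summable (hp : p.Admissible) (hnet : IsNetwork p μ X Ψ) :
    ∀ᵐ ω ∂μ, ∀ t, Summable fun n => rx p X Ψ t n ω := by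
  classical
  set θ : ℕ → ℝ := fun m => 1 / ((m : ℝ) + 1)
  have hθ : ∀ m, 0 < θ m := fun m => by positivity
  have hθ1 : ∀ m, θ m ≤ 1 := fun m => by
    rw [div_le_one (by positivity)]
    linarith [(Nat.cast_nonneg m : (0 : ℝ) ≤ m)]
  -- The value 0 for a divergent series is the actual limit of the partial products.
  set z : ℕ → Tier K L → Ω → ℝ := fun m t ω =>
    if Summable fun n => rx p X Ψ t n ω then Real.exp (-(θ m * ∑' n, rx p X Ψ t n ω)) else 0
  have hlim : ∀ m, ∀ᵐ ω ∂μ, ∀ t, Tendsto (fun N => ∏ n ∈ Finset.range N,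
      Real.exp (-(θ m * |rx p X Ψ t n ω|))) atTop (𝓝 (z m t ω)) := by
    intro m
    filter_upwards [hnet.ae_rx_pos hp] with ω hpos t
    simp_rw [abs_of_pos (hpos t _), ← Real.exp_sum, Finset.sum_neg_distrib, ← Finset.mul_sum]
    by_cases hs : Summable fun n => rx p X Ψ t n ω
    · simp only [z, if_pos hs]
      exact (Real.continuous_exp.tendsto _).comp (hs.hasSum.tendsto_sum_nat.const_mul _).neg
    · simp only [z, if_neg hs]
      have h1 := (not_summable_iff_tendsto_nat_atTop_of_nonneg fun n => (hpos t n).le).mp hs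
      exact Real.tendsto_exp_neg_atTop_nhds_zero.comp (h1.const_mul_atTop (hθ m))
  -- No BS is distinguished, and no summability is presupposed: the product formula requires only
  -- that the partial products converge.
  have hE : ∀ m, ∫ ω, ∏ t, (z m t ω : ℂ) ∂μ = ∏ t, tailPGF (markMean (p.fading t)
      (fun s ψ => damp (θ m) (ψ * gain (p.expo t) (p.intensity t) s))) 0 := by
    intro m
    have hS := hp.stableTier
    refine hnet.integral_prod_eq hp (fun _ => false)
      (fun t s ψ => damp (θ m) (ψ * gain (p.expo t) (p.intensity t) s))
      (fun t s ψ => damp (θ m) (ψ * gain (p.expo t) (p.intensity t) s))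
      (fun t => (hS t).markFun_damp (hθ m).le) (fun t => (hS t).markFun_damp (hθ m).le)
      (fun t => (hS t).integrableOn_one_sub_markMean (continuous_damp _).measurable
        (norm_damp_le_one (hθ m).le) ((hS t).integrableOn_damp (hθ m).le))
      (fun t ω => (z m t ω : ℂ)) fun t => ?_
    filter_upwards [hlim m] with ω h
    have := (Complex.continuous_ofReal.tendsto _).comp (h t)
    refine this.congr fun N => ?_
    simp only [Function.comp, Complex.ofReal_prod, markSeq, ← rx_eq hp, damp_eq]
    simp
  have hz0 : ∀ m t ω, 0 ≤ z m t ω := fun m t ω => by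
    simp only [z]
    split_ifs <;> positivity
  have hz1 : ∀ m, ∀ᵐ ω ∂μ, ∀ t, z m t ω ≤ 1 := fun m => by
    filter_upwards [hnet.ae_rx_pos hp] with ω hpos t
    simp only [z]
    split_ifs
    · rw [Real.exp_le_one_iff, neg_nonpos]
      exact mul_nonneg (hθ m).le (tsum_nonneg fun n => (hpos t n).le)
    · exact zero_le_one
  have hzm : ∀ m t, AEMeasurable (z m t) μ := fun m t => by
    refine aemeasurable_of_tendsto_metrizable_ae atTop (f := fun N ω => ∏ n ∈ Finset.range N,
      Real.exp (-(θ m * |rx p X Ψ t n ω|))) (fun N => ?_) ?_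
    · have := hnet.measurable_rx hp t
      exact (Finset.measurable_prod _ fun n _ => by fun_prop).aemeasurable
    · filter_upwards [hlim m] with ω h using h t
  have hzi : ∀ m, Integrable (fun ω => ∏ t, z m t ω) μ := fun m => by
    refine Integrable.of_bound (C := 1)
      (Finset.aemeasurable_fun_prod _ fun t _ => hzm m t).aestronglyMeasurable ?_
    filter_upwards [hz1 m] with ω h
    rw [Real.norm_of_nonneg (Finset.prod_nonneg fun t _ => hz0 m t ω)]
    exact Finset.prod_le_one (fun t _ => hz0 m t ω) fun t _ => h t
  have hE1 : Tendsto (fun m => ∫ ω, (1 - ∏ t, z m t ω) ∂μ) atTop (𝓝 0) := by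
    have h1 : Tendsto (fun m => ((∫ ω, ∏ t, z m t ω ∂μ : ℝ) : ℂ)) atTop (𝓝 1) := by
      simp_rw [← integral_complex_ofReal, Complex.ofReal_prod, hE]
      have := tendsto_finsetProd Finset.univ fun t _ =>
        (hp.stableTier t).tendsto_tailPGF_damp (fun m => (hθ m).le) hθ1
          tendsto_one_div_add_atTop_nhds_zero_nat
      simpa using this
    have h2 : Tendsto (fun m => ∫ ω, ∏ t, z m t ω ∂μ) atTop (𝓝 1) := by
      exact (Complex.continuous_re.tendsto _).comp h1
    have h3 := h2.const_sub 1
    rw [sub_self] at h3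
    refine h3.congr fun m => ?_
    rw [integral_sub (integrable_const _) (hzi m)]
    simp
  rw [ae_iff]
  refine (measureReal_eq_zero_iff).mp (le_antisymm (ge_of_tendsto' hE1 fun m => ?_)
    measureReal_nonneg)
  -- Markov's inequality at level 1: if some tier diverges, one factor is 0 and 1 minus the product
  -- equals 1. The expectation tends to 0.
  refine le_trans ?_ (mul_meas_ge_le_integral_of_nonneg ?_ ((integrable_const _).sub (hzi m)) 1)
  · rw [one_mul]
    refine measureReal_mono fun ω hω => ?_
    simp only [mem_ofPred_eq, not_forall] at hω ⊢
    obtain ⟨t, ht⟩ := hω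
    have h0 : ∏ t, z m t ω = 0 :=
      Finset.prod_eq_zero (Finset.mem_univ t) (by simp only [z, if_neg ht])
    simp only [Pi.sub_apply, h0, sub_zero, le_refl]
  · filter_upwards [hz1 m] with ω h
    exact sub_nonneg.mpr (Finset.prod_le_one (fun t _ => hz0 m t ω) fun t _ => h t)

lemma aemeasurable_tsum_rx (hp : p.Admissible) (hnet : IsNetwork p μ X Ψ) (t : Tier K L) :
    AEMeasurable (fun ω => ∑' n, rx p X Ψ t n ω) μ := by
  refine aemeasurable_of_tendsto_metrizable_ae atTop
    (f := fun N ω => ∑ n ∈ Finset.range N, rx p X Ψ t n ω)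
    (fun N => (Finset.measurable_sum _ fun n _ => hnet.measurable_rx hp t n).aemeasurable) ?_
  filter_upwards [hnet.ae_summable hp] with ω h using (h t).hasSum.tendsto_sum_nat

lemma aemeasurable_total (hp : p.Admissible) (hnet : IsNetwork p μ X Ψ) :
    AEMeasurable (total p X Ψ) μ :=
  ((Finset.aemeasurable_fun_sum _ fun k _ => hnet.aemeasurable_tsum_rx hp (Sum.inl k)).add
    (Finset.aemeasurable_fun_sum _ fun l _ => hnet.aemeasurable_tsum_rx hp (Sum.inr l))).add_const _

lemma measurable_maxBest (hp : p.Admissible) (hnet : IsNetwork p μ X Ψ) :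
    Measurable (maxBest p X Ψ) :=
  Measurable.iSup fun _ => (Measurable.iSup fun n => hnet.measurable_rx hp _ n).const_mul _

lemma measurable_maxNearest (hp : p.Admissible) (hnet : IsNetwork p μ X Ψ) :
    Measurable (maxNearest p X Ψ) :=
  Measurable.iSup fun _ => (hnet.measurable_rx hp _ 0).const_mul _

end IsNetwork

end

/-! ### Coverage events in terms of the total power. -/

section Pathwise

variable {Ω : Type*} {K L : ℕ} {p : Params K L} {X : Tier K L → ℕ → Ω → Plane}
  {Ψ : Tier K L → ℕ → Ω → ℝ} {ω : Ω}

/-- The total received power from tier `t`. -/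
noncomputable def tierPower (p : Params K L) (X : Tier K L → ℕ → Ω → Plane)
    (Ψ : Tier K L → ℕ → Ω → ℝ) (t : Tier K L) (ω : Ω) : ℝ := ∑' n, rx p X Ψ t n ω

/-- The received powers are positive and summable. -/
def IsRegular (p : Params K L) (X : Tier K L → ℕ → Ω → Plane) (Ψ : Tier K L → ℕ → Ω → ℝ)
    (ω : Ω) : Prop :=
  (∀ t n, 0 < rx p X Ψ t n ω) ∧ ∀ t, Summable fun n => rx p X Ψ t n ω

lemma Params.Admissible.one_lt_gam (hp : p.Admissible) (k : Fin K) : 1 < p.gam k := by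
  have := hp.thr_pos k
  rw [Params.gam]
  have : 0 < 1 / p.thr k := by positivity
  linarith

lemma Params.gam_le_kap (p : Params K L) (k : Fin K) : p.gam k ≤ p.kap :=
  le_ciSup (f := p.gam) (finite_range _).bddAbove k

lemma Params.Admissible.one_le_kap [Nonempty (Fin K)] (hp : p.Admissible) : 1 ≤ p.kap :=
  (hp.one_lt_gam (Classical.arbitrary _)).le.trans (p.gam_le_kap _)

namespace IsRegular

lemma rx_add_rx_le (h : IsRegular p X Ψ ω) (t : Tier K L) {m n : ℕ} (hmn : m ≠ n) :
    rx p X Ψ t m ω + rx p X Ψ t n ω ≤ tierPower p X Ψ t ω := by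
  have := (h.2 t).sum_le_tsum {m, n} fun i _ => (h.1 t i).le
  rwa [Finset.sum_pair hmn] at this

/-- Every index differs from 0 or from 1, so a fixed positive amount of power is always left over.
This makes the supremum strictly smaller than the sum without discussing whether it is attained. -/
lemma rx_le (h : IsRegular p X Ψ ω) (t : Tier K L) (n : ℕ) :
    rx p X Ψ t n ω ≤ tierPower p X Ψ t ω -
      min (rx p X Ψ t 0 ω) (rx p X Ψ t 1 ω) := by
  rcases eq_or_ne n 0 with rfl | hn
  · have := h.rx_add_rx_le t zero_ne_one
    linarith [min_le_right (rx p X Ψ t 0 ω) (rx p X Ψ t 1 ω)]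
  · have := h.rx_add_rx_le t hn
    linarith [min_le_left (rx p X Ψ t 0 ω) (rx p X Ψ t 1 ω)]

lemma bddAbove (h : IsRegular p X Ψ ω) (t : Tier K L) :
    BddAbove (range fun n => rx p X Ψ t n ω) :=
  ⟨_, forall_mem_range.mpr (h.rx_le t)⟩

lemma iSup_rx_lt (h : IsRegular p X Ψ ω) (t : Tier K L) :
    ⨆ n, rx p X Ψ t n ω < tierPower p X Ψ t ω := by
  refine (ciSup_le (h.rx_le t)).trans_lt ?_
  have := lt_min (h.1 t 0) (h.1 t 1)
  linarith

lemma tierPower_le_total (h : IsRegular p X Ψ ω) (k : Fin K) :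
    tierPower p X Ψ (Sum.inl k) ω + p.noise ≤ total p X Ψ ω := by
  have h0 : ∀ t, 0 ≤ tierPower p X Ψ t ω := fun t => tsum_nonneg fun n => (h.1 t n).le
  have h1 : tierPower p X Ψ (Sum.inl k) ω ≤ openPower p X Ψ ω :=
    Finset.single_le_sum (f := fun k => tierPower p X Ψ (Sum.inl k) ω) (fun k _ => h0 _)
      (Finset.mem_univ k)
  have h2 : 0 ≤ closedPower p X Ψ ω := Finset.sum_nonneg fun l _ => h0 (Sum.inr l)
  rw [total]
  linarith

lemma maxNearest_le_maxBest (hp : p.Admissible) (h : IsRegular p X Ψ ω) :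
    maxNearest p X Ψ ω ≤ maxBest p X Ψ ω := by
  refine ciSup_mono (finite_range _).bddAbove fun k => ?_
  have := one_pos.trans (hp.one_lt_gam k)
  gcongr
  exact le_ciSup (h.bddAbove (Sum.inl k)) 0

/-- The denominator is the total power minus the signal and is positive. Clearing it gives β I < (β
+ 1) S, and γ = 1 + 1/β. -/
lemma thr_lt_sinr_iff (hp : p.Admissible) (h : IsRegular p X Ψ ω) (k : Fin K) (n : ℕ) :
    p.thr k < sinr p X Ψ k n ω ↔ total p X Ψ ω < p.gam k * rx p X Ψ (Sum.inl k) n ω := by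
  have h1 : rx p X Ψ (Sum.inl k) n ω < total p X Ψ ω :=
    (le_ciSup (h.bddAbove (Sum.inl k)) n).trans_lt (by
      linarith [h.iSup_rx_lt (Sum.inl k), h.tierPower_le_total k, hp.noise_nonneg])
  have e : openPower p X Ψ ω - rx p X Ψ (Sum.inl k) n ω + closedPower p X Ψ ω + p.noise =
      total p X Ψ ω - rx p X Ψ (Sum.inl k) n ω := by
    rw [total]
    ring
  have ht := hp.thr_pos k
  rw [sinr, e, lt_div_iff₀ (by linarith), Params.gam, ← mul_lt_mul_iff_right₀ ht (b :=
      total p X Ψ ω)]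
  have e2 : p.thr k * ((1 + 1 / p.thr k) * rx p X Ψ (Sum.inl k) n ω) =
      p.thr k * rx p X Ψ (Sum.inl k) n ω + rx p X Ψ (Sum.inl k) n ω := by
    field_simp
  rw [e2, mul_sub, sub_lt_iff_lt_add']

variable [Nonempty (Fin K)]

lemma maxNearest_pos (hp : p.Admissible) (h : IsRegular p X Ψ ω) : 0 < maxNearest p X Ψ ω := by
  have k : Fin K := Classical.arbitrary _
  refine (mul_pos (one_pos.trans (hp.one_lt_gam k)) (h.1 (Sum.inl k) 0)).trans_le ?_
  exact le_ciSup (f := fun k => p.gam k * rx p X Ψ (Sum.inl k) 0 ω) (finite_range _).bddAbove k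

/-- If tier k attains the maximum, dividing by κ ≥ γ_k leaves at most the largest power of that
tier, which is strictly below the tier sum. -/
lemma maxBest_lt (hp : p.Admissible) (h : IsRegular p X Ψ ω) :
    maxBest p X Ψ ω / p.kap + p.noise < total p X Ψ ω := by
  obtain ⟨k, hk⟩ := exists_eq_ciSup_of_finite
    (f := fun k : Fin K => p.gam k * ⨆ n : ℕ, rx p X Ψ (Sum.inl k) n ω)
  have hκ := one_pos.trans_le hp.one_le_kap
  have hM : 0 ≤ ⨆ n : ℕ, rx p X Ψ (Sum.inl k) n ω :=
    Real.iSup_nonneg fun n => (h.1 _ n).le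
  have h1 : maxBest p X Ψ ω / p.kap ≤ ⨆ n : ℕ, rx p X Ψ (Sum.inl k) n ω := by
    rw [maxBest, ← hk, div_le_iff₀ hκ, mul_comm]
    gcongr
    exact p.gam_le_kap k
  linarith [h.iSup_rx_lt (Sum.inl k), h.tierPower_le_total k]

lemma maxNearest_lt (hp : p.Admissible) (h : IsRegular p X Ψ ω) :
    maxNearest p X Ψ ω / p.kap + p.noise < total p X Ψ ω := by
  have hκ := one_pos.trans_le hp.one_le_kap
  refine lt_of_le_of_lt ?_ (h.maxBest_lt hp)
  gcongr
  exact h.maxNearest_le_maxBest hp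

lemma exists_thr_lt_sinr_iff (hp : p.Admissible) (h : IsRegular p X Ψ ω) :
    (∃ k n, p.thr k < sinr p X Ψ k n ω) ↔ total p X Ψ ω < maxBest p X Ψ ω := by
  rw [maxBest, lt_ciSup_iff (finite_range _).bddAbove]
  refine exists_congr fun k => ?_
  have hγ := one_pos.trans (hp.one_lt_gam k)
  have e : (total p X Ψ ω < p.gam k * ⨆ n : ℕ, rx p X Ψ (Sum.inl k) n ω) ↔
      ∃ n, total p X Ψ ω / p.gam k < rx p X Ψ (Sum.inl k) n ω := by
    rw [← div_lt_iff₀' hγ, lt_ciSup_iff (h.bddAbove _)]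
  rw [e]
  refine exists_congr fun n => ?_
  rw [h.thr_lt_sinr_iff hp, div_lt_iff₀' hγ]

lemma exists_thr_lt_sinr_zero_iff (hp : p.Admissible) (h : IsRegular p X Ψ ω) :
    (∃ k, p.thr k < sinr p X Ψ k 0 ω) ↔ total p X Ψ ω < maxNearest p X Ψ ω := by
  rw [maxNearest, lt_ciSup_iff (finite_range _).bddAbove]
  exact exists_congr fun k => h.thr_lt_sinr_iff hp k 0

lemma maxBest_le_iff (hp : p.Admissible) (h : IsRegular p X Ψ ω) (u : ℝ) :
    maxBest p X Ψ ω ≤ u ↔ ∀ k n, rx p X Ψ (Sum.inl k) n ω ≤ u / p.gam k := by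
  rw [maxBest, ciSup_le_iff (finite_range _).bddAbove]
  refine forall_congr' fun k => ?_
  rw [← le_div_iff₀' (one_pos.trans (hp.one_lt_gam k)), ciSup_le_iff (h.bddAbove _)]

end IsRegular

lemma maxNearest_le_iff [Nonempty (Fin K)] (hp : p.Admissible) (u : ℝ) :
    maxNearest p X Ψ ω ≤ u ↔ ∀ k, rx p X Ψ (Sum.inl k) 0 ω ≤ u / p.gam k := by
  rw [maxNearest, ciSup_le_iff (finite_range _).bddAbove]
  exact forall_congr' fun k => (le_div_iff₀' (one_pos.trans (hp.one_lt_gam k))).symm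

lemma exp_total_eq (w : ℝ) : Complex.exp (-(Complex.I * w) * total p X Ψ ω) =
    Complex.exp (-(Complex.I * w) * p.noise) * ∏ t, osc w (tierPower p X Ψ t ω) := by
  simp only [osc]
  rw [← Complex.exp_sum, ← Complex.exp_add, Fintype.sum_sum_type, total, openPower, closedPower]
  simp only [tierPower, Finset.sum_neg_distrib, ← Finset.mul_sum]
  congr 1
  push_cast
  ring

end Pathwise

lemma tendsto_prod_osc {r : ℕ → ℝ} (hr : Summable r) (w : ℝ) :
    Tendsto (fun N => ∏ n ∈ Finset.range N, osc w (r n)) atTop (𝓝 (osc w (∑' n, r n))) := by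
  have e : ∀ N, ∏ n ∈ Finset.range N, osc w (r n) = osc w (∑ n ∈ Finset.range N, r n) := fun N => by
    simp only [osc]
    rw [← Complex.exp_sum, Finset.sum_neg_distrib, ← Finset.mul_sum]
    push_cast
    rfl
  simp_rw [e]
  exact ((continuous_osc_right w).tendsto _).comp hr.hasSum.tendsto_sum_nat

/-- One received power above v makes all later partial products vanish, so the product encodes the
indicator of the event. -/
lemma tendsto_prod_oscCut {r : ℕ → ℝ} (hr : Summable r) (w v : ℝ) [Decidable (∀ n, r n ≤ v)] :
    Tendsto (fun N => ∏ n ∈ Finset.range N, oscCut w v (r n)) atTop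
      (𝓝 (if ∀ n, r n ≤ v then osc w (∑' n, r n) else 0)) := by
  split_ifs with h
  · simp only [oscCut, if_pos (h _)]
    exact tendsto_prod_osc hr w
  · push Not at h
    obtain ⟨m, hm⟩ := h
    refine tendsto_const_nhds.congr' ?_
    filter_upwards [eventually_gt_atTop m] with N hN
    exact (Finset.prod_eq_zero (Finset.mem_range.mpr hN) (if_neg (not_le.mpr hm))).symm

lemma tendsto_prod_osc_zero_oscCut {r : ℕ → ℝ} (hr : Summable r) (w v : ℝ) :
    Tendsto (fun N => ∏ n ∈ Finset.range N, if n = 0 then oscCut w v (r n) else osc w (r n)) atTop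
      (𝓝 (if r 0 ≤ v then osc w (∑' n, r n) else 0)) := by
  split_ifs with h
  · refine (tendsto_prod_osc hr w).congr fun N => Finset.prod_congr rfl fun n _ => ?_
    split_ifs with hn
    · rw [hn, oscCut, if_pos h]
    · rfl
  · refine tendsto_const_nhds.congr' ?_
    filter_upwards [eventually_gt_atTop 0] with N hN
    exact (Finset.prod_eq_zero (Finset.mem_range.mpr hN) (by rw [if_pos rfl, oscCut,
        if_neg h])).symm

/-! ### Joint transforms of the network as products over tiers. -/

namespace IsNetwork

variable {Ω : Type*} [MeasurableSpace Ω] {μ : Measure Ω} {K L : ℕ} [IsProbabilityMeasure μ]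
  {p : Params K L} {X : Tier K L → ℕ → Ω → Plane} {Ψ : Tier K L → ℕ → Ω → ℝ}

lemma ae_isRegular (hp : p.Admissible) (hnet : IsNetwork p μ X Ψ) :
    ∀ᵐ ω ∂μ, IsRegular p X Ψ ω := by
  filter_upwards [hnet.ae_rx_pos hp, hnet.ae_summable hp] with ω h1 h2 using ⟨h1, h2⟩

/-- The transform of the total received power on the event that the largest received powers are
bounded. -/
theorem jointLT_maxBest_eq [Nonempty (Fin K)] (hp : p.Admissible) (hnet : IsNetwork p μ X Ψ)
    {w u : ℝ} (hw : w ≠ 0) (hu : 0 < u) :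
    jointLT p X Ψ μ (maxBest p X Ψ) (Complex.I * w) u =
      Complex.exp (-(Complex.I * w) * p.noise) *
      ((∏ k : Fin K, Complex.exp
          (-(StableTier.levy (p.expo (Sum.inl k)) (p.intensity (Sum.inl k))
              (p.fading (Sum.inl k)) w +
            StableTier.levyTail (p.expo (Sum.inl k)) (p.intensity (Sum.inl k))
                (p.fading (Sum.inl k))
              w (u / p.gam k)))) *
        ∏ l : Fin L, Complex.exp (-StableTier.levy (p.expo (Sum.inr l)) (p.intensity (Sum.inr l))
          (p.fading (Sum.inr l)) w)) := by
  classical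
  have hS := hp.stableTier
  have hv : ∀ k, 0 < u / p.gam k := fun k => div_pos hu (one_pos.trans (hp.one_lt_gam k))
  set φ : Tier K L → ℝ → ℂ := Sum.elim (fun k => oscCut w (u / p.gam k)) (fun _ => osc w) with hφ
  set Z : Tier K L → Ω → ℂ := fun t ω => Sum.elim
    (fun k => if ∀ n, rx p X Ψ (Sum.inl k) n ω ≤ u / p.gam k then
      osc w (tierPower p X Ψ (Sum.inl k) ω) else 0)
    (fun l => osc w (tierPower p X Ψ (Sum.inr l) ω)) t with hZ
  have hmark : ∀ t, MarkFun (p.fading t)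
      (fun s ψ => φ t (ψ * gain (p.expo t) (p.intensity t) s)) := by
    rintro (k | l)
    · exact (hS _).markFun_oscCut _ _
    · exact (hS _).markFun_osc _
  have key := hnet.integral_prod_eq hp (fun _ => false)
    (fun t s ψ => φ t (ψ * gain (p.expo t) (p.intensity t) s))
    (fun t s ψ => φ t (ψ * gain (p.expo t) (p.intensity t) s)) hmark hmark (by
      rintro (k | l)
      · exact (hS _).integrableOn_one_sub_markMean (measurable_oscCut _ _)
          (norm_oscCut_le_one _ _) ((hS _).integrableOn_oscCut _ (hv k))
      · exact (hS _).integrableOn_one_sub_oscMean _) Z (by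
      intro t
      filter_upwards [hnet.ae_isRegular hp] with ω h
      simp only [markSeq, ← rx_eq hp, ite_self]
      rcases t with k | l
      · exact tendsto_prod_oscCut (h.2 _) _ _
      · exact tendsto_prod_osc (h.2 _) _)
  have e : ∀ᵐ ω ∂μ, {ω' | maxBest p X Ψ ω' ≤ u}.indicator
      (fun ω' => Complex.exp (-(Complex.I * w) * (total p X Ψ ω' : ℂ))) ω =
      Complex.exp (-(Complex.I * w) * p.noise) * ∏ t, Z t ω := by
    filter_upwards [hnet.ae_isRegular hp] with ω h
    by_cases hm : maxBest p X Ψ ω ≤ u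
    · have h1 := (h.maxBest_le_iff hp u).mp hm
      rw [indicator_of_mem (by exact hm), exp_total_eq, Fintype.prod_sum_type,
        Fintype.prod_sum_type]
      simp only [hZ, Sum.elim_inl, Sum.elim_inr, if_pos (h1 _)]
    · have h1 := (h.maxBest_le_iff hp u).not.mp hm
      rw [not_forall] at h1
      obtain ⟨k, hk⟩ := h1
      rw [indicator_of_notMem (by exact hm), Finset.prod_eq_zero (Finset.mem_univ (Sum.inl k)),
        mul_zero]
      simp only [hZ, Sum.elim_inl, if_neg hk]
  rw [jointLT, integral_congr_ae e, integral_const_mul, key, Fintype.prod_sum_type]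
  congr 2
  · exact Finset.prod_congr rfl fun k _ => (hS _).tailPGF_oscCut hw (hv k)
  · exact Finset.prod_congr rfl fun l _ => (hS _).tailPGF_osc hw

/-- The transform of the total received power on the event that the received powers from the
nearest BSs are bounded. -/
theorem jointLT_maxNearest_eq [Nonempty (Fin K)] (hp : p.Admissible) (hnet : IsNetwork p μ X Ψ)
    {w u : ℝ} (hw : w ≠ 0) (hu : 0 < u) :
    jointLT p X Ψ μ (maxNearest p X Ψ) (Complex.I * w) u =
      Complex.exp (-(Complex.I * w) * p.noise) *
      ((∏ k : Fin K, ∫ x in (0 : ℝ)..(u / p.gam k),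
          StableTier.kernel (p.expo (Sum.inl k)) (p.intensity (Sum.inl k)) (p.fading (Sum.inl k))
            w x) *
        ∏ l : Fin L, Complex.exp (-StableTier.levy (p.expo (Sum.inr l)) (p.intensity (Sum.inr l))
          (p.fading (Sum.inr l)) w)) := by
  classical
  have hS := hp.stableTier
  have hv : ∀ k, 0 < u / p.gam k := fun k => div_pos hu (one_pos.trans (hp.one_lt_gam k))
  set φ : Tier K L → ℝ → ℂ := Sum.elim (fun k => oscCut w (u / p.gam k)) (fun _ => osc w) with hφ
  -- Only the nearest BS of an open tier is subject to the constraint; closed tiers distinguish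
  -- none.
  set first : Tier K L → Bool := Sum.elim (fun _ => true) (fun _ => false) with hfirst
  set Z : Tier K L → Ω → ℂ := fun t ω => Sum.elim
    (fun k => if rx p X Ψ (Sum.inl k) 0 ω ≤ u / p.gam k then
      osc w (tierPower p X Ψ (Sum.inl k) ω) else 0)
    (fun l => osc w (tierPower p X Ψ (Sum.inr l) ω)) t with hZ
  have hmark : ∀ t, MarkFun (p.fading t)
      (fun s ψ => φ t (ψ * gain (p.expo t) (p.intensity t) s)) := by
    rintro (k | l)
    · exact (hS _).markFun_oscCut _ _
    · exact (hS _).markFun_osc _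
  have key := hnet.integral_prod_eq hp first
    (fun t s ψ => φ t (ψ * gain (p.expo t) (p.intensity t) s))
    (fun t s ψ => osc w (ψ * gain (p.expo t) (p.intensity t) s)) hmark
    (fun t => (hS t).markFun_osc w) (fun t => (hS t).integrableOn_one_sub_oscMean w) Z (by
      intro t
      filter_upwards [hnet.ae_isRegular hp] with ω h
      simp only [markSeq, ← rx_eq hp]
      rcases t with k | l
      · simp only [hfirst, hφ, Sum.elim_inl, and_true]
        exact tendsto_prod_osc_zero_oscCut (h.2 _) _ _
      · simp only [hfirst, Sum.elim_inr, Bool.false_eq_true, and_false, if_false]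
        exact tendsto_prod_osc (h.2 _) _)
  have e : ∀ᵐ ω ∂μ, {ω' | maxNearest p X Ψ ω' ≤ u}.indicator
      (fun ω' => Complex.exp (-(Complex.I * w) * (total p X Ψ ω' : ℂ))) ω =
      Complex.exp (-(Complex.I * w) * p.noise) * ∏ t, Z t ω := by
    refine ae_of_all _ fun ω => ?_
    by_cases hm : maxNearest p X Ψ ω ≤ u
    · have h1 := (maxNearest_le_iff hp u).mp hm
      rw [indicator_of_mem (by exact hm), exp_total_eq, Fintype.prod_sum_type,
        Fintype.prod_sum_type]
      simp only [hZ, Sum.elim_inl, Sum.elim_inr, if_pos (h1 _)]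
    · have h1 := (maxNearest_le_iff (ω := ω) hp u).not.mp hm
      rw [not_forall] at h1
      obtain ⟨k, hk⟩ := h1
      rw [indicator_of_notMem (by exact hm), Finset.prod_eq_zero (Finset.mem_univ (Sum.inl k)),
        mul_zero]
      simp only [hZ, Sum.elim_inl, if_neg hk]
  rw [jointLT, integral_congr_ae e, integral_const_mul, key, Fintype.prod_sum_type]
  congr 2
  · exact Finset.prod_congr rfl fun k _ => (hS _).tierValue_nearest w (hv k).le
  · exact Finset.prod_congr rfl fun l _ => (hS _).tailPGF_osc hw

end IsNetwork

/-! ### Identification with the explicit formulas. -/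

namespace StableTier

variable {a c : ℝ} {F : Measure ℝ}

/-- The integrated mean of `exp (-i w p)` in terms of the received power. -/
lemma integral_oscMean (hS : StableTier a c F) (w : ℝ) {ρ : ℝ} (hρ : 0 < ρ) :
    ∫ s in (0 : ℝ)..(c * ρ ^ (-a)), oscMean a c F w s =
      ∫ ψ, ((c * ψ ^ a * a) • ∫ x in Ioi (ψ * ρ), x ^ (-a - 1) • osc w x) ∂F := by
  have := hS.prob
  have hc := hS.int_pos
  have ha := hS.exp_pos
  have ht : 0 < c * ρ ^ (-a) := by positivity
  have hm := (continuous_osc_right w).measurable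
  have hi : Integrable (Function.uncurry fun s ψ : ℝ => osc w (ψ * gain a c s))
      ((volume.restrict (Ioc 0 (c * ρ ^ (-a)))).prod F) := by
    refine Integrable.of_bound (C := 1) (Measurable.aestronglyMeasurable ?_)
      (ae_of_all _ fun z => (norm_osc _ _).le)
    unfold Function.uncurry
    fun_prop
  rw [intervalIntegral.integral_of_le ht.le]
  unfold oscMean markMean
  rw [integral_integral_swap hi]
  refine integral_congr_ae ?_
  filter_upwards [hS.pos] with ψ hψ
  have e1 : ∫ s in Ioc 0 (c * ρ ^ (-a)), osc w (ψ * gain a c s) =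
      ∫ s in Ioi 0, (Iic (c * ρ ^ (-a))).indicator (fun _ => osc w (ψ * gain a c s)) s := by
    have : ∀ s, (Iic (c * ρ ^ (-a))).indicator (fun _ => osc w (ψ * gain a c s)) s =
        (Iic (c * ρ ^ (-a))).indicator (fun s => osc w (ψ * gain a c s)) s := fun s => rfl
    simp_rw [this]
    rw [setIntegral_indicator measurableSet_Iic, Ioi_inter_Iic]
  rw [e1, hS.integral_comp_gain hψ (fun s x => (Iic (c * ρ ^ (-a))).indicator (fun _ => osc w x) s),
    ← integral_smul, ← integral_Ici_eq_integral_Ioi (x := ψ * ρ),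
    ← integral_indicator measurableSet_Ioi, ← integral_indicator measurableSet_Ici]
  congr 1
  ext x
  have hψρ : 0 < ψ * ρ := by positivity
  by_cases hx : 0 < x
  -- An arrival before c ρ^(-a) is a received power of at least ψρ.
  · have hiff : c * ψ ^ a * x ^ (-a) ≤ c * ρ ^ (-a) ↔ ψ * ρ ≤ x := by
      rw [mul_assoc, mul_le_mul_iff_right₀ hc, Real.rpow_neg hx.le, Real.rpow_neg hρ.le,
        ← div_eq_mul_inv, div_le_iff₀ (by positivity), inv_mul_eq_div, le_div_iff₀ (by positivity),
        ← Real.mul_rpow hψ.le hρ.le, Real.rpow_le_rpow_iff hψρ.le hx.le ha]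
    rw [indicator_of_mem (mem_Ioi.mpr hx)]
    by_cases h : ψ * ρ ≤ x
    · rw [indicator_of_mem (by exact hiff.mpr h), indicator_of_mem (by exact h), smul_smul]
    · rw [indicator_of_notMem (by exact hiff.not.mpr h), indicator_of_notMem (by exact h),
        smul_zero]
  · rw [indicator_of_notMem (by exact hx), indicator_of_notMem]
    exact fun h => hx (hψρ.trans_le h)

/-- The integrand of the kernel. -/
noncomputable def kernelIntegrand (a c : ℝ) (F : Measure ℝ) (w ψ x : ℝ) : ℂ :=
  (c * ψ ^ a * a * x ^ (-a - 1)) • (osc w x * survival a c F w (c * ψ ^ a * x ^ (-a)))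

lemma integral_kernel (hS : StableTier a c F) (w : ℝ) {v : ℝ} (hv : 0 ≤ v) :
    ∫ ψ, (∫ x in (0 : ℝ)..v, kernelIntegrand a c F w ψ x) ∂F =
      ∫ x in (0 : ℝ)..v, kernel a c F w x := by
  have := hS.prob
  simp_rw [intervalIntegral.integral_of_le hv]
  have hi := (hS.integrable_kernel_prod w).mono_measure
    (Measure.prod_mono (le_refl F) (Measure.restrict_mono (show Ioc 0 v ⊆ Ioi 0 from
        Ioc_subset_Ioi_self) le_rfl))
  exact integral_integral_swap (f := fun ψ x => kernelIntegrand a c F w ψ x) hi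

end StableTier

namespace Params

variable {K L : ℕ} (p : Params K L)

noncomputable def levy (t : Tier K L) (w : ℝ) : ℂ :=
  StableTier.levy (p.expo t) (p.intensity t) (p.fading t) w

noncomputable def levyTail (t : Tier K L) (w v : ℝ) : ℂ :=
  StableTier.levyTail (p.expo t) (p.intensity t) (p.fading t) w v

noncomputable def kernel (t : Tier K L) (w x : ℝ) : ℂ :=
  StableTier.kernel (p.expo t) (p.intensity t) (p.fading t) w x

namespace Admissible

variable {p}

lemma mul_pow_cpow (hp : p.Admissible) (t : Tier K L) {w : ℝ} (hw : w ≠ 0) :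
    (Complex.I * w * p.pow t) ^ (p.expo t : ℂ) =
      ((p.pow t ^ p.expo t : ℝ) : ℂ) * (Complex.I * w) ^ (p.expo t : ℂ) := by
  have hz : Complex.I * (w : ℂ) ≠ 0 := mul_ne_zero Complex.I_ne_zero (by exact_mod_cast hw)
  rw [mul_comm (Complex.I * (w : ℂ)), ofReal_mul_cpow (hp.pow_pos t) hz,
    Complex.ofReal_cpow (hp.pow_pos t).le]

lemma levy_eq (hp : p.Admissible) (t : Tier K L) {w : ℝ} (hw : w ≠ 0) :
    (p.dens t * Real.pi : ℂ) * (Complex.I * w * p.pow t) ^ (p.expo t : ℂ) * p.moment t *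
      Real.Gamma (1 - p.expo t) = p.levy t w := by
  rw [hp.mul_pow_cpow t hw, Params.levy, StableTier.levy, Params.intensity, Params.moment]
  push_cast
  ring

lemma closedExponent_eq (hp : p.Admissible) {w : ℝ} (hw : w ≠ 0) :
    closedExponent p (Complex.I * w) = ∑ l : Fin L, p.levy (Sum.inr l) w :=
  Finset.sum_congr rfl fun _ _ => hp.levy_eq _ hw

lemma nearestPrefactor_eq (hp : p.Admissible) {w : ℝ} (hw : w ≠ 0) :
    nearestPrefactor p (Complex.I * w) = Complex.exp (-(Complex.I * w) * p.noise) *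
      ((∏ k : Fin K, Complex.exp (-p.levy (Sum.inl k) w)) *
        ∏ l : Fin L, Complex.exp (-p.levy (Sum.inr l) w)) := by
  rw [nearestPrefactor, hp.closedExponent_eq hw, ← Complex.exp_sum, ← Complex.exp_sum,
    ← Complex.exp_add, ← Complex.exp_add, ← Complex.exp_add, Finset.sum_neg_distrib,
    Finset.sum_neg_distrib, Finset.sum_congr rfl fun k _ => hp.levy_eq (Sum.inl k) hw]
  ring_nf

/-- On the ray through iw the incomplete Gamma function is (iw)^(-a) times the real tail integral;
this power cancels the one in the prefactor. -/
lemma levyTail_eq (hp : p.Admissible) (k : Fin K) {w u : ℝ} (hw : w ≠ 0) (hu : 0 < u) :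
    (p.dens (Sum.inl k) * Real.pi : ℂ) *
      (Complex.I * w * p.pow (Sum.inl k)) ^ (p.expo (Sum.inl k) : ℂ) * p.moment (Sum.inl k) *
      (p.expo (Sum.inl k) * incGamma (-(p.expo (Sum.inl k) : ℂ)) (Complex.I * w * u / p.gam k)) =
      p.levyTail (Sum.inl k) w (u / p.gam k) := by
  have hz : Complex.I * (w : ℂ) ≠ 0 := mul_ne_zero Complex.I_ne_zero (by exact_mod_cast hw)
  have hv : 0 < u / p.gam k := div_pos hu (one_pos.trans (hp.one_lt_gam k))
  have e : Complex.I * w * u / p.gam k = Complex.I * w * ((u / p.gam k : ℝ) : ℂ) := by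
    push_cast
    ring
  have e2 : ∫ x in Ioi (u / p.gam k), (p.expo (Sum.inl k) * x ^ (-p.expo (Sum.inl k) - 1))
      • osc w x =
      p.expo (Sum.inl k) * ∫ x in Ioi (u / p.gam k), x ^ (-p.expo (Sum.inl k) - 1) •
        Complex.exp (-(Complex.I * w * x)) := by
    rw [← integral_const_mul]
    congr 1
    ext x
    rw [osc, Complex.real_smul, Complex.real_smul]
    push_cast
    ring
  rw [hp.mul_pow_cpow _ hw, e, incGamma_eq _ hz hv, Params.levyTail, StableTier.levyTail, e2,
    Params.intensity, Params.moment, Complex.cpow_neg]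
  have h0 : (Complex.I * (w : ℂ)) ^ (p.expo (Sum.inl k) : ℂ) ≠ 0 :=
      by simp [Complex.cpow_eq_zero_iff, hw]
  field_simp
  push_cast
  ring

lemma explicitMax_eq (hp : p.Admissible) {w u : ℝ} (hw : w ≠ 0) (hu : 0 < u) :
    explicitMax p (Complex.I * w) u = Complex.exp (-(Complex.I * w) * p.noise) *
      ((∏ k : Fin K, Complex.exp (-(p.levy (Sum.inl k) w +
          p.levyTail (Sum.inl k) w (u / p.gam k)))) *
        ∏ l : Fin L, Complex.exp (-p.levy (Sum.inr l) w)) := by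
  rw [explicitMax, hp.closedExponent_eq hw, ← Complex.exp_sum, ← Complex.exp_sum,
    ← Complex.exp_add, ← Complex.exp_add, ← Complex.exp_add, Finset.sum_neg_distrib,
    Finset.sum_neg_distrib]
  have e : ∀ k : Fin K, (p.dens (Sum.inl k) * Real.pi : ℂ) *
      (Complex.I * w * p.pow (Sum.inl k)) ^ (p.expo (Sum.inl k) : ℂ) * p.moment (Sum.inl k) *
      (Real.Gamma (1 - p.expo (Sum.inl k)) + p.expo (Sum.inl k) *
        incGamma (-(p.expo (Sum.inl k) : ℂ)) (Complex.I * w * u / p.gam k)) =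
      p.levy (Sum.inl k) w + p.levyTail (Sum.inl k) w (u / p.gam k) := fun k => by
    rw [mul_add, hp.levy_eq _ hw, hp.levyTail_eq k hw hu]
  rw [Finset.sum_congr rfl fun k _ => e k]
  ring_nf

lemma tierConst_eq (hp : p.Admissible) (k : Fin K) {w : ℝ} (hw : w ≠ 0) :
    tierConst p (Complex.I * w) k = ((p.intensity (Sum.inl k) * p.expo (Sum.inl k) : ℝ) : ℂ) *
      (Complex.I * w) ^ (p.expo (Sum.inl k) : ℂ) := by
  rw [tierConst, hp.mul_pow_cpow _ hw, Params.intensity]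
  have : (p.ple (Sum.inl k) : ℂ) ≠ 0 := by
    have := hp.ple_gt_two (Sum.inl k)
    exact_mod_cast (by linarith : p.ple (Sum.inl k) ≠ 0)
  have e : (2 * Real.pi / p.ple (Sum.inl k) : ℂ) = Real.pi * p.expo (Sum.inl k) := by
    rw [Params.expo]
    push_cast
    ring
  rw [e]
  push_cast
  ring

/-- The powers (iw)^a and (iw)^(-a) cancel, and the remaining tail integrals are the integrated mean
of exp(-iwp) over arrivals before c ρ^(-a), written in received powers. -/
lemma tierConst_mul_fadGamma (hp : p.Admissible) (k : Fin K) {w ρ : ℝ} (hw : w ≠ 0) (hρ : 0 < ρ) :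
    tierConst p (Complex.I * w) k * fadGamma p k (Complex.I * w * ρ) =
      ∫ s in (0 : ℝ)..(p.intensity (Sum.inl k) * ρ ^ (-p.expo (Sum.inl k))),
        StableTier.oscMean (p.expo (Sum.inl k)) (p.intensity (Sum.inl k)) (p.fading (Sum.inl k))
          w s := by
  have hz : Complex.I * (w : ℂ) ≠ 0 := mul_ne_zero Complex.I_ne_zero (by exact_mod_cast hw)
  rw [(hp.stableTier _).integral_oscMean w hρ, hp.tierConst_eq k hw, fadGamma,
    ← integral_const_mul]
  refine integral_congr_ae ?_
  filter_upwards [hp.fading_pos (Sum.inl k)] with ψ hψ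
  have e : Complex.I * w * ρ * ψ = Complex.I * w * ((ψ * ρ : ℝ) : ℂ) := by
    push_cast
    ring
  have h0 : (Complex.I * (w : ℂ)) ^ (p.expo (Sum.inl k) : ℂ) ≠ 0 :=
      by simp [Complex.cpow_eq_zero_iff, hw]
  rw [e, incGamma_eq _ hz (by positivity), Complex.cpow_neg, Complex.real_smul]
  simp only [osc]
  push_cast
  field_simp

/-- The explicit formula collects the stable exponents of all tiers in a common prefactor; the
survival factor contains its own copy, which is undone here. -/
lemma levy_mul_survival (hp : p.Admissible) (k : Fin K) {w ρ : ℝ} (hw : w ≠ 0) (hρ : 0 < ρ) :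
    Complex.exp (-(tierConst p (Complex.I * w) k * fadGamma p k (Complex.I * w * ρ))) =
      Complex.exp (p.levy (Sum.inl k) w) * StableTier.survival (p.expo (Sum.inl k))
        (p.intensity (Sum.inl k)) (p.fading (Sum.inl k)) w
        (p.intensity (Sum.inl k) * ρ ^ (-p.expo (Sum.inl k))) := by
  have hc := (hp.stableTier (Sum.inl k)).int_pos
  rw [(hp.stableTier _).survival_eq hw (by positivity), hp.tierConst_mul_fadGamma k hw hρ,
    ← mul_assoc, Params.levy, ← Complex.exp_add, add_neg_cancel, Complex.exp_zero, one_mul]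

lemma rpow_neg_div_mul {a ψ v : ℝ} (hψ : 0 < ψ) (hv : 0 < v) :
    (v / ψ) ^ (-a) = ψ ^ a * v ^ (-a) := by
  rw [Real.div_rpow hv.le hψ.le, Real.rpow_neg hψ.le, div_inv_eq_mul, mul_comm]

lemma kernel_eq (hp : p.Admissible) (k : Fin K) {w u : ℝ} (hw : w ≠ 0) (hu : 0 < u) :
    Complex.exp (p.levy (Sum.inl k) w) * p.kernel (Sum.inl k) w (u / p.gam k) =
      ((p.intensity (Sum.inl k) * p.expo (Sum.inl k) *
        (u / p.gam k) ^ (-p.expo (Sum.inl k) - 1) : ℝ) : ℂ) * osc w (u / p.gam k) *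
        nearestMean p (Complex.I * w) k u := by
  have hγ := one_pos.trans (hp.one_lt_gam k)
  have hv : 0 < u / p.gam k := div_pos hu hγ
  rw [Params.kernel, StableTier.kernel, nearestMean, ← integral_const_mul, ← integral_const_mul]
  refine integral_congr_ae ?_
  filter_upwards [hp.fading_pos (Sum.inl k)] with ψ hψ
  have e : Complex.I * w * u / (p.gam k * ψ) = Complex.I * w * ((u / p.gam k / ψ : ℝ) : ℂ) := by
    push_cast
    field_simp
  rw [neg_mul, e, hp.levy_mul_survival k hw (by positivity), rpow_neg_div_mul hψ hv,
      ← mul_assoc (p.intensity (Sum.inl k)) (ψ ^ _),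
    Complex.real_smul]
  push_cast
  ring

lemma cpow_div_cancel (hp : p.Admissible) (k : Fin K) {w u : ℝ} (hw : w ≠ 0) (hu : 0 < u) :
    tierConst p (Complex.I * w) k * (Complex.I * w * u / p.gam k) ^ (-(p.expo (Sum.inl k) : ℂ)) =
      ((p.intensity (Sum.inl k) * p.expo (Sum.inl k) *
        (u / p.gam k) ^ (-p.expo (Sum.inl k)) : ℝ) : ℂ) := by
  have hγ := one_pos.trans (hp.one_lt_gam k)
  have hv : 0 < u / p.gam k := div_pos hu hγ
  have hz : Complex.I * (w : ℂ) ≠ 0 := mul_ne_zero Complex.I_ne_zero (by exact_mod_cast hw)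
  have e : Complex.I * w * u / p.gam k = ((u / p.gam k : ℝ) : ℂ) * (Complex.I * w) := by
    push_cast
    ring
  have h0 : (Complex.I * (w : ℂ)) ^ (p.expo (Sum.inl k) : ℂ) ≠ 0 :=
      by simp [Complex.cpow_eq_zero_iff, hw]
  rw [e, ofReal_mul_cpow hv hz, hp.tierConst_eq k hw, Complex.cpow_neg (Complex.I * (w : ℂ)),
    ← Complex.ofReal_neg, ← Complex.ofReal_cpow hv.le]
  push_cast
  field_simp

lemma exp_eq_osc_inv (k : Fin K) (w u : ℝ) :
    Complex.exp (Complex.I * w * u / p.gam k) = (osc w (u / p.gam k))⁻¹ := by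
  rw [osc, ← Complex.exp_neg, neg_neg]
  push_cast
  ring_nf

lemma nearestFactorDeriv_eq (hp : p.Admissible) (k : Fin K) {w u : ℝ} (hw : w ≠ 0) (hu : 0 < u) :
    nearestFactorDeriv p (Complex.I * w) k u =
      Complex.exp (p.levy (Sum.inl k) w) * (p.kernel (Sum.inl k) w (u / p.gam k) / p.gam k) := by
  have hγ := one_pos.trans (hp.one_lt_gam k)
  have hv : 0 < u / p.gam k := div_pos hu hγ
  have hγ' : (p.gam k : ℂ) ≠ 0 := by exact_mod_cast hγ.ne'
  have hu' : (u : ℂ) ≠ 0 := by exact_mod_cast hu.ne'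
  rw [nearestFactorDeriv, hp.cpow_div_cancel k hw hu, nearestNum, exp_eq_osc_inv, mul_div_assoc',
    mul_div_assoc', hp.kernel_eq k hw hu, Real.rpow_sub_one hv.ne']
  push_cast
  field_simp
-- On the segment the contour variable is iw times the received power divided by ψ. In terms of that
-- power the integrand is real-variable, and all powers of iw cancel.
lemma nearestIntegrand_eq (hp : p.Admissible) (k : Fin K) {w V ψ x : ℝ} (hw : w ≠ 0) (hV : 0 < V)
    (hψ : 0 < ψ) (hx : 0 < x) :
    nearestIntegrand p (Complex.I * w) k ψ (x * (Complex.I * w * ((V / ψ : ℝ) : ℂ))) *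
        (Complex.I * w * ((V / ψ : ℝ) : ℂ)) =
      Complex.exp (p.levy (Sum.inl k) w) * (V • StableTier.kernelIntegrand (p.expo (Sum.inl k))
        (p.intensity (Sum.inl k)) (p.fading (Sum.inl k)) w ψ (V * x)) := by
  have hz : Complex.I * (w : ℂ) ≠ 0 := mul_ne_zero Complex.I_ne_zero (by exact_mod_cast hw)
  have hVx : 0 < V * x / ψ := by positivity
  have e : x * (Complex.I * w * ((V / ψ : ℝ) : ℂ)) = Complex.I * w * ((V * x / ψ : ℝ) : ℂ) := by
    push_cast
    ring
  have e1 : (Complex.I * w * ((V * x / ψ : ℝ) : ℂ)) ^ (-(p.expo (Sum.inl k) : ℂ) - 1) =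
      (((V * x / ψ) ^ (-p.expo (Sum.inl k) - 1) : ℝ) : ℂ) *
        ((Complex.I * w) ^ (p.expo (Sum.inl k) : ℂ))⁻¹ * (Complex.I * w)⁻¹ := by
    rw [mul_comm (Complex.I * (w : ℂ)), ofReal_mul_cpow hVx hz, Complex.cpow_sub _ _ hz,
      Complex.cpow_neg, Complex.cpow_one, Complex.ofReal_cpow hVx.le]
    push_cast
    ring
  have e2 : Complex.exp (-ψ * (Complex.I * w * ((V * x / ψ : ℝ) : ℂ)) -
      tierConst p (Complex.I * w) k * fadGamma p k (Complex.I * w * ((V * x / ψ : ℝ) : ℂ))) =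
      osc w (V * x) * Complex.exp (-(tierConst p (Complex.I * w) k *
        fadGamma p k (Complex.I * w * ((V * x / ψ : ℝ) : ℂ)))) := by
    rw [osc, ← Complex.exp_add]
    congr 1
    have : (ψ : ℂ) ≠ 0 := by exact_mod_cast hψ.ne'
    push_cast
    field_simp
    ring
  have h0 : (Complex.I * (w : ℂ)) ^ (p.expo (Sum.inl k) : ℂ) ≠ 0 :=
      by simp [Complex.cpow_eq_zero_iff, hw]
  have e3 : (V * x / ψ) ^ (-p.expo (Sum.inl k) - 1) * (V / ψ) =
      V * (ψ ^ p.expo (Sum.inl k) * (V * x) ^ (-p.expo (Sum.inl k) - 1)) := by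
    rw [Real.rpow_sub_one hVx.ne', rpow_neg_div_mul hψ (by positivity),
      Real.rpow_sub_one (by positivity)]
    field_simp
  have e5 : (V : ℂ) * ((p.intensity (Sum.inl k) * ψ ^ p.expo (Sum.inl k) * p.expo (Sum.inl k) *
      (V * x) ^ (-p.expo (Sum.inl k) - 1) : ℝ) : ℂ) =
      ((p.intensity (Sum.inl k) * p.expo (Sum.inl k) : ℝ) : ℂ) *
        ((((V * x / ψ) ^ (-p.expo (Sum.inl k) - 1) : ℝ) : ℂ) * ((V / ψ : ℝ) : ℂ)) := by
    rw [← Complex.ofReal_mul, ← Complex.ofReal_mul, e3, ← Complex.ofReal_mul]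
    congr 1
    ring
  rw [nearestIntegrand, e, e1, e2, hp.levy_mul_survival k hw hVx,
    rpow_neg_div_mul hψ (by positivity), hp.tierConst_eq k hw, StableTier.kernelIntegrand,
    Complex.real_smul, Complex.real_smul, ← mul_assoc (p.intensity (Sum.inl k)) (ψ ^ _)]
  -- With these quantities as atoms, the identity is polynomial and follows from the two inverse
  -- relations and `e5`.
  generalize StableTier.survival _ _ _ _ _ = S
  generalize (Complex.I * (w : ℂ)) ^ (p.expo (Sum.inl k) : ℂ) = Z at h0 ⊢
  generalize Complex.I * (w : ℂ) = z at hz ⊢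
  generalize ((((V * x / ψ) ^ (-p.expo (Sum.inl k) - 1) : ℝ) : ℂ)) = A at e5 ⊢
  generalize ((V / ψ : ℝ) : ℂ) = B at e5 ⊢
  linear_combination (((p.intensity (Sum.inl k) * p.expo (Sum.inl k) : ℝ) : ℂ) * A * B *
    osc w (V * x) * Complex.exp (p.levy (Sum.inl k) w) * S * z * z⁻¹) * mul_inv_cancel₀ h0 +
    (((p.intensity (Sum.inl k) * p.expo (Sum.inl k) : ℝ) : ℂ) * A * B *
    osc w (V * x) * Complex.exp (p.levy (Sum.inl k) w) * S) * mul_inv_cancel₀ hz -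
    (osc w (V * x) * Complex.exp (p.levy (Sum.inl k) w) * S) * e5

lemma nearestFactor_eq (hp : p.Admissible) (k : Fin K) {w u : ℝ} (hw : w ≠ 0) (hu : 0 < u) :
    nearestFactor p (Complex.I * w) k u = Complex.exp (p.levy (Sum.inl k) w) *
      ∫ x in (0 : ℝ)..(u / p.gam k), p.kernel (Sum.inl k) w x := by
  have hγ := one_pos.trans (hp.one_lt_gam k)
  have hv : 0 < u / p.gam k := div_pos hu hγ
  have h1 := (hp.stableTier (Sum.inl k)).integral_kernel w hv.le
  rw [show (∫ x in (0 : ℝ)..(u / p.gam k), p.kernel (Sum.inl k) w x) = _ from h1.symm,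
    ← integral_const_mul, nearestFactor]
  refine integral_congr_ae ?_
  filter_upwards [hp.fading_pos (Sum.inl k)] with ψ hψ
  have e : Complex.I * w * u / (p.gam k * ψ) = Complex.I * w * ((u / p.gam k / ψ : ℝ) : ℂ) := by
    push_cast
    field_simp
  have h2 := intervalIntegral.smul_integral_comp_mul_left (a := 0) (b := 1)
    (fun x => StableTier.kernelIntegrand (p.expo (Sum.inl k))
      (p.intensity (Sum.inl k)) (p.fading (Sum.inl k)) w ψ x) (u / p.gam k)
  rw [mul_zero, mul_one] at h2
  rw [e, ← h2, ← intervalIntegral.integral_smul, ← intervalIntegral.integral_const_mul]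
  refine intervalIntegral.integral_congr_ae (ae_of_all _ fun x hx => ?_)
  rw [uIoc_of_le zero_le_one] at hx
  exact hp.nearestIntegrand_eq k hw hv hψ hx.1

/-- Rescaling the kernel integral to (0, 1) extracts the same constant as in the derivative of the
factor, which then drops out of the logarithmic derivative. -/
lemma nearestDen_eq (hp : p.Admissible) (k : Fin K) {w u : ℝ} (hw : w ≠ 0) (hu : 0 < u) :
    nearestFactor p (Complex.I * w) k u =
      tierConst p (Complex.I * w) k * (Complex.I * w * u / p.gam k) ^ (-(p.expo (Sum.inl k) : ℂ)) *
        nearestDen p (Complex.I * w) k u := by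
  have hγ := one_pos.trans (hp.one_lt_gam k)
  have hv : 0 < u / p.gam k := div_pos hu hγ
  have h2 := intervalIntegral.smul_integral_comp_mul_left (a := 0) (b := 1)
    (fun x => p.kernel (Sum.inl k) w x) (u / p.gam k)
  rw [mul_zero, mul_one] at h2
  rw [hp.nearestFactor_eq k hw hu, hp.cpow_div_cancel k hw hu, nearestDen, ← h2,
    ← intervalIntegral.integral_smul, ← intervalIntegral.integral_const_mul,
    ← intervalIntegral.integral_const_mul]
  refine intervalIntegral.integral_congr_ae (ae_of_all _ fun x hx => ?_)
  rw [uIoc_of_le zero_le_one] at hx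
  have hx0 := hx.1
  have e : Complex.I * w * u * x / p.gam k = Complex.I * w * ((u * x : ℝ) : ℂ) / p.gam k := by
    push_cast
    ring
  have hk := hp.kernel_eq k hw (mul_pos hu hx0)
  have e2 : u / p.gam k * x = u * x / p.gam k := by ring
  have e3 : (u * x / p.gam k) ^ (-p.expo (Sum.inl k) - 1) * (u / p.gam k) =
      (u / p.gam k) ^ (-p.expo (Sum.inl k)) * (x ^ (p.expo (Sum.inl k) + 1))⁻¹ := by
    rw [← e2, Real.mul_rpow hv.le hx0.le, Real.rpow_sub_one hv.ne',
      show -p.expo (Sum.inl k) - 1 = -(p.expo (Sum.inl k) + 1) by ring, Real.rpow_neg hx0.le]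
    field_simp
  have e4 : (((u * x / p.gam k) ^ (-p.expo (Sum.inl k) - 1) : ℝ) : ℂ) * ((u / p.gam k : ℝ) : ℂ) =
      (((u / p.gam k) ^ (-p.expo (Sum.inl k)) : ℝ) : ℂ) *
        ((x ^ (p.expo (Sum.inl k) + 1) : ℝ) : ℂ)⁻¹ := by
    rw [← Complex.ofReal_mul, e3]
    push_cast
    rfl
  rw [e, exp_eq_osc_inv, Complex.real_smul, e2, mul_left_comm, hk,
    div_eq_mul_inv (nearestMean _ _ _ _), mul_inv, inv_inv, Complex.ofReal_mul,
    Complex.ofReal_mul (_ * _) ((u / p.gam k) ^ _)]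
  linear_combination (((p.intensity (Sum.inl k) * p.expo (Sum.inl k) : ℝ) : ℂ) *
    osc w (u * x / p.gam k) * nearestMean p (Complex.I * w) k (u * x)) * e4

end Admissible

end Params

/-! ### Permanence of spectral densities, and bounds and derivatives for one tier. -/

namespace SpectralDensity

variable {D : ℝ → ℝ → ℂ}

lemma bounded_mul (hD : SpectralDensity D) {B : ℝ → ℝ → ℂ} (hB : Measurable (Function.uncurry B))
    {M : ℝ} (hM : ∀ w, w ≠ 0 → ∀ y, 0 < y → ‖B w y‖ ≤ M) :
    SpectralDensity fun w y => B w y * D w y := by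
  obtain ⟨c, α, δ, hc, hα, hδ, hδ1, g, hg, hb⟩ := hD.bound
  refine ⟨hB.mul hD.meas, c, α, δ, hc, hα, hδ, hδ1, fun y => M * g y, ?_, fun w hw y hy => ?_⟩
  · refine (hg.const_mul M).congr (ae_of_all _ fun y => ?_)
    ring
  · rw [norm_mul, mul_left_comm]
    exact mul_le_mul (hM w hw y hy) (hb w hw y hy) (norm_nonneg _)
      ((norm_nonneg _).trans (hM w hw y hy))

lemma comp_div (hD : SpectralDensity D) {γ : ℝ} (hγ : 1 ≤ γ) :
    SpectralDensity fun w y => D w (y / γ) := by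
  obtain ⟨c, α, δ, hc, hα, hδ, hδ1, g, hg, hb⟩ := hD.bound
  have hγ0 : 0 < γ := one_pos.trans_le hγ
  refine ⟨hD.meas.comp (by fun_prop : Measurable fun z : ℝ × ℝ => (z.1, z.2 / γ)), c, α, δ, hc, hα,
    hδ, hδ1, fun y => g (y / γ), ?_, fun w hw y hy => hb w hw _ (by positivity)⟩
  have h1 : IntegrableOn (fun y => (1 + (y / γ) ^ δ) * g (y / γ)) (Ioi 0) := by
    have := (integrableOn_Ioi_comp_mul_right_iff (fun y => (1 + y ^ δ) * g y) 0
      (inv_pos.mpr hγ0)).mpr (by simpa using hg)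
    simpa only [div_eq_mul_inv] using this
  have h2 : ∀ y ∈ Ioi (0 : ℝ), (1 + y ^ δ) / (1 + (y / γ) ^ δ) * ((1 + (y / γ) ^ δ) * g (y / γ)) =
      (1 + y ^ δ) * g (y / γ) := fun y hy => by
    have hy' : 0 < y := hy
    have : 0 < 1 + (y / γ) ^ δ := by positivity
    field_simp
  -- The two weights differ by the factor (1 + y^δ)/(1 + (y/γ)^δ), which is at most γ^δ since γ ≥ 1.
  refine IntegrableOn.congr_fun (Integrable.bdd_mul (c := γ ^ δ) h1
    (Measurable.aestronglyMeasurable (by fun_prop)) ?_) h2 measurableSet_Ioi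
  filter_upwards [ae_restrict_mem measurableSet_Ioi] with y hy
  have hy' : 0 < y := hy
  have hpos : 0 < 1 + (y / γ) ^ δ := by positivity
  rw [Real.norm_of_nonneg (by positivity), div_le_iff₀ hpos, mul_add, mul_one,
    ← Real.mul_rpow hγ0.le (by positivity), mul_div_cancel₀ _ hγ0.ne']
  gcongr
  exact Real.one_le_rpow hγ hδ.le

lemma exists_bound (hD : SpectralDensity D) : ∃ G : ℝ → ℝ, IntegrableOn G (Ioi 0) ∧
    ∀ w, w ≠ 0 → ∀ y, 0 < y → ‖D w y‖ ≤ G y := by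
  obtain ⟨c, α, δ, hc, hα, hδ, hδ1, g, hg, hb⟩ := hD.bound
  refine ⟨_, hg, fun w hw y hy => (hb w hw y hy).trans ?_⟩
  have hg0 : 0 ≤ g y :=
    nonneg_of_mul_nonneg_right ((norm_nonneg _).trans (hb w hw y hy)) (Real.exp_pos _)
  have h1 : Real.exp (-(c * |w| ^ α)) ≤ 1 :=
    Real.exp_le_one_iff.mpr (neg_nonpos.mpr (by positivity))
  have h3 : 0 ≤ y ^ δ := by positivity
  gcongr
  linarith

lemma integrableOn_right (hD : SpectralDensity D) {w : ℝ} (hw : w ≠ 0) :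
    IntegrableOn (D w) (Ioi 0) := by
  obtain ⟨G, hG, hb⟩ := hD.exists_bound
  refine hG.mono' (hD.meas.comp measurable_prodMk_left).aestronglyMeasurable ?_
  filter_upwards [ae_restrict_mem measurableSet_Ioi] with y hy using hb w hw y hy

lemma exists_norm_integral_le (hD : SpectralDensity D) :
    ∃ M, ∀ w, w ≠ 0 → ∀ v, 0 < v → ‖∫ x in (0 : ℝ)..v, D w x‖ ≤ M := by
  obtain ⟨G, hG, hb⟩ := hD.exists_bound
  refine ⟨∫ x in Ioi 0, G x, fun w hw v hv => ?_⟩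
  rw [intervalIntegral.integral_of_le hv.le]
  have hsub : Ioc 0 v ⊆ Ioi 0 := Ioc_subset_Ioi_self
  refine (norm_integral_le_of_norm_le (hG.mono_set hsub) ?_).trans
    (setIntegral_mono_set hG ?_ hsub.eventuallyLE)
  · filter_upwards [ae_restrict_mem measurableSet_Ioc] with x hx using hb w hw x hx.1
  · filter_upwards [ae_restrict_mem measurableSet_Ioi] with x hx using
      (norm_nonneg _).trans (hb w hw x hx)

end SpectralDensity

lemma measurable_setIntegral_section {f : ℝ → ℝ → ℂ} (hf : Measurable (Function.uncurry f))
    {S : Set ((ℝ × ℝ) × ℝ)} (hS : MeasurableSet S) :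
    Measurable fun z : ℝ × ℝ => ∫ x in {x | (z, x) ∈ S}, f z.1 x := by
  have e : ∀ z : ℝ × ℝ, ∫ x in {x | (z, x) ∈ S}, f z.1 x =
      ∫ x, S.indicator (fun q => f q.1.1 q.2) (z, x) := fun z => by
    rw [← integral_indicator (show MeasurableSet {x | (z, x) ∈ S} from measurable_prodMk_left hS)]
    rfl
  simp_rw [e]
  refine (StronglyMeasurable.integral_prod_right (f := fun (z : ℝ × ℝ) x =>
    S.indicator (fun q => f q.1.1 q.2) (z, x)) ?_).measurable
  refine (Measurable.indicator ?_ hS).stronglyMeasurable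
  exact hf.comp (by fun_prop : Measurable fun q : (ℝ × ℝ) × ℝ => (q.1.1, q.2))

/-- An interval integral is a difference of two set integrals, each over the sections of one
measurable set. -/
lemma measurable_uncurry_intervalIntegral {f : ℝ → ℝ → ℂ} (hf : Measurable (Function.uncurry f)) :
    Measurable fun z : ℝ × ℝ => ∫ x in (0 : ℝ)..z.2, f z.1 x :=
  (measurable_setIntegral_section hf ((measurableSet_lt measurable_const measurable_snd).inter
    (measurableSet_le measurable_snd measurable_fst.snd))).sub
    (measurable_setIntegral_section hf ((measurableSet_lt measurable_fst.snd measurable_snd).inter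
      (measurableSet_le measurable_snd measurable_const)))

namespace StableTier

variable {a c : ℝ} {F : Measure ℝ}

lemma spectralDensity_kernel (hS : StableTier a c F) : SpectralDensity (kernel a c F) := by
  refine ⟨hS.measurable_kernel, rate a c F / 4, a, a / 2, div_pos hS.rate_pos (by norm_num),
    hS.exp_pos, half_pos hS.exp_pos, by linarith [hS.exp_lt_one], envelope a c F,
    hS.integrableOn_envelope, fun w hw y hy => ?_⟩
  have := hS.norm_kernel_le hw hy
  rwa [← div_mul_eq_mul_div] at this

lemma tail_eq (hS : StableTier a c F) {v : ℝ} (hv : 0 < v) :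
    ∫ x in Ioi v, a * x ^ (-a - 1) = v ^ (-a) := by
  have ha := hS.exp_pos
  rw [integral_const_mul, integral_Ioi_rpow_of_lt (by linarith) hv]
  rw [show -a - 1 + 1 = -a by ring]
  field_simp

/-- The real part of 1 - `oscCut` is nonnegative everywhere and equals 1 beyond v; the region beyond
v alone contributes m v^(-a), where m is c times the moment. -/
lemma norm_exp_levy_add_levyTail_le (hS : StableTier a c F) {w v : ℝ} (hw : w ≠ 0) (hv : 0 < v) :
    ‖Complex.exp (-(levy a c F w + levyTail a c F w v))‖ ≤
      Real.exp (-((c * ∫ ψ, ψ ^ a ∂F) * v ^ (-a))) := by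
  have hm := mul_pos hS.int_pos hS.moment_pos
  have ha := hS.exp_pos
  have hi : IntegrableOn (fun x => (a * x ^ (-a - 1)) • (1 - oscCut w v x)) (Ioi 0) := by
    refine ((hS.integrableOn_oscCut w hv).smul a).congr (ae_of_all _ fun x => ?_)
    simp only [Pi.smul_apply, smul_smul]
  rw [hS.levy_add_levyTail_eq hw hv, Complex.norm_exp, Complex.neg_re, Complex.re_ofReal_mul]
  gcongr
  have hre : (∫ x in Ioi 0, (a * x ^ (-a - 1)) • (1 - oscCut w v x)).re =
      ∫ x in Ioi 0, ((a * x ^ (-a - 1)) • (1 - oscCut w v x)).re := (integral_re hi).symm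
  have hsub : Ioi v ⊆ Ioi 0 := Ioi_subset_Ioi hv.le
  rw [hre, ← hS.tail_eq hv]
  calc ∫ x in Ioi v, a * x ^ (-a - 1)
      = ∫ x in Ioi v, ((a * x ^ (-a - 1)) • (1 - oscCut w v x)).re := by
        refine setIntegral_congr_fun measurableSet_Ioi fun x hx => ?_
        simp only [oscCut, if_neg (not_le.mpr (mem_Ioi.mp hx)), sub_zero, Complex.smul_re,
          Complex.one_re, smul_eq_mul, mul_one]
    _ ≤ _ := by
        refine setIntegral_mono_set (Integrable.re hi) ?_ hsub.eventuallyLE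
        filter_upwards [ae_restrict_mem measurableSet_Ioi] with x hx
        have hx0 : 0 < x := hx
        rw [Complex.smul_re, smul_eq_mul, Complex.sub_re, Complex.one_re]
        have := (Complex.re_le_norm _).trans (norm_oscCut_le_one w v x)
        exact mul_nonneg (by positivity) (by linarith)

/-- The second bound uses |`levyTail`| ≤ m v^(-a) against the real part of `levy`. The interpolation
is that of the survival factor, with s = m v^(-a). -/
lemma norm_exp_levy_add_levyTail_le' (hS : StableTier a c F) {w v : ℝ} (hw : w ≠ 0) (hv : 0 < v) :
    ‖Complex.exp (-(levy a c F w + levyTail a c F w v))‖ ≤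
      Real.exp (-(rate a c F * |w| ^ a / 4)) *
        Real.exp (-((c * ∫ ψ, ψ ^ a ∂F) * v ^ (-a) / 2)) := by
  refine exp_neg_le_of_le (hS.norm_exp_levy_add_levyTail_le hw hv) ?_
  have hm := mul_pos hS.int_pos hS.moment_pos
  have ha := hS.exp_pos
  have h1 : ‖levyTail a c F w v‖ ≤ (c * ∫ ψ, ψ ^ a ∂F) * v ^ (-a) := by
    rw [levyTail, norm_mul, Complex.norm_real, Real.norm_of_nonneg hm.le, ← hS.tail_eq hv]
    gcongr
    refine (norm_integral_le_integral_norm _).trans (le_of_eq ?_)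
    refine setIntegral_congr_fun measurableSet_Ioi fun x hx => ?_
    have hx0 : 0 < x := hv.trans hx
    simp only [norm_smul, norm_osc, mul_one]
    exact Real.norm_of_nonneg (by positivity)
  rw [Complex.norm_exp, Complex.neg_re, Complex.add_re, levy_re a c F hw]
  refine Real.exp_le_exp.mpr ?_
  have := (abs_le.mp ((Complex.abs_re_le_norm _).trans h1)).1
  linarith

lemma norm_exp_levy_le_one (hS : StableTier a c F) {w : ℝ} (hw : w ≠ 0) :
    ‖Complex.exp (-levy a c F w)‖ ≤ 1 := by
  rw [Complex.norm_exp, Complex.neg_re, levy_re a c F hw, Real.exp_le_one_iff, neg_nonpos]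
  exact mul_nonneg hS.rate_pos.le (by positivity)

lemma norm_exp_levy_add_levyTail_le_one (hS : StableTier a c F) {w v : ℝ} (hw : w ≠ 0)
    (hv : 0 < v) : ‖Complex.exp (-(levy a c F w + levyTail a c F w v))‖ ≤ 1 := by
  refine (hS.norm_exp_levy_add_levyTail_le hw hv).trans (Real.exp_le_one_iff.mpr ?_)
  have hm := mul_pos hS.int_pos hS.moment_pos
  rw [neg_nonpos]
  positivity

lemma measurable_levy (a c : ℝ) (F : Measure ℝ) : Measurable (levy a c F) := by
  unfold levy
  fun_prop

lemma measurable_levyTail (a c : ℝ) (F : Measure ℝ) :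
    Measurable (Function.uncurry (levyTail a c F)) := by
  have hf : Measurable (Function.uncurry fun w x : ℝ => (a * x ^ (-a - 1)) • osc w x) := by
    exact (show Measurable fun z : ℝ × ℝ => a * z.2 ^ (-a - 1) by fun_prop).smul
      continuous_osc.measurable
  exact (measurable_setIntegral_section hf (measurableSet_lt measurable_fst.snd
    measurable_snd)).const_mul _

/-- The density, in the largest received power, of the transform of the interference of a tier. -/
lemma spectralDensity_exp_levyTail (hS : StableTier a c F) :
    SpectralDensity fun w x => ((x ^ (-a - 1) : ℝ) : ℂ) *
      Complex.exp (-(levy a c F w + levyTail a c F w x)) := by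
  have hm := mul_pos hS.int_pos hS.moment_pos
  -- An auxiliary tier with constant gain 1 and intensity c E[ψ^a]: its envelope is the required
  -- function of x up to a constant, so integrability is already known.
  have hS' : StableTier a (c * ∫ ψ, ψ ^ a ∂F) (Measure.dirac 1) :=
    ⟨hS.exp_pos, hS.exp_lt_one, hm, inferInstance, by
      rw [ae_dirac_eq]
      exact zero_lt_one' ℝ, integrable_dirac (by simp)⟩
  have ha := hS.exp_pos
  refine ⟨?_, rate a c F / 4, a, a / 2, div_pos hS.rate_pos (by norm_num),
    hS.exp_pos, half_pos hS.exp_pos, by linarith [hS.exp_lt_one],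
    fun x => ((c * ∫ ψ, ψ ^ a ∂F) * a)⁻¹ * envelope a (c * ∫ ψ, ψ ^ a ∂F) (Measure.dirac 1) x, ?_,
    fun w hw y hy => ?_⟩
  · have h1 := measurable_levyTail a c F
    have h2 : Measurable fun z : ℝ × ℝ => levy a c F z.1 :=
        (measurable_levy a c F).comp measurable_fst
    refine Measurable.mul (by fun_prop) (Measurable.cexp ?_)
    exact (h2.add h1).neg
  · refine (hS'.integrableOn_envelope.const_mul ((c * ∫ ψ, ψ ^ a ∂F) * a)⁻¹).congr
      (ae_of_all _ fun x => ?_)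
    ring
  · have h := hS.norm_exp_levy_add_levyTail_le' hw hy
    unfold envelope
    beta_reduce
    rw [norm_mul, Complex.norm_real, Real.norm_of_nonneg (by positivity), integral_dirac,
      Real.one_rpow, mul_one, div_mul_eq_mul_div]
    calc _ ≤ y ^ (-a - 1) * (Real.exp (-(rate a c F * |w| ^ a / 4)) *
        Real.exp (-((c * ∫ ψ, ψ ^ a ∂F) * y ^ (-a) / 2))) := by gcongr
      _ = _ := by
        generalize c * ∫ ψ, ψ ^ a ∂F = m at hm
        field_simp

lemma hasDerivAt_levyTail (hS : StableTier a c F) (w : ℝ) {v : ℝ} (hv : 0 < v) :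
    HasDerivAt (levyTail a c F w)
      (-((c * ∫ ψ, ψ ^ a ∂F : ℝ) * ((a * v ^ (-a - 1)) • osc w v))) v := by
  -- The tail integral is split at a base point that stays below all levels near v.
  have hv2 : 0 < v / 2 := half_pos hv
  have hi : IntegrableOn (fun x => (a * x ^ (-a - 1)) • osc w x) (Ioi (v / 2)) := by
    refine ((hS.integrableOn_tail w hv2).smul a).congr (ae_of_all _ fun x => ?_)
    simp only [Pi.smul_apply, smul_smul]
  have hcont : ∀ x, 0 < x → ContinuousAt (fun x : ℝ => (a * x ^ (-a - 1)) • osc w x) x :=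
    fun x hx => (continuousAt_const.mul (Real.continuousAt_rpow_const _ _ (Or.inl hx.ne'))).smul
      (continuous_osc_right w).continuousAt
  have hm : Measurable fun x : ℝ => (a * x ^ (-a - 1)) • osc w x :=
    (show Measurable fun x : ℝ => a * x ^ (-a - 1) by fun_prop).smul
      (continuous_osc_right w).measurable
  have h1 := intervalIntegral.integral_hasDerivAt_right
    ((intervalIntegrable_iff_integrableOn_Ioc_of_le (by linarith)).mpr
      (hi.mono_set (show Ioc (v / 2) v ⊆ Ioi (v / 2) from Ioc_subset_Ioi_self)))
    hm.stronglyMeasurable.stronglyMeasurableAtFilter (hcont v hv)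
  have h2 := (h1.const_sub (∫ x in Ioi (v / 2), (a * x ^ (-a - 1)) • osc w x)).const_mul
    ((c * ∫ ψ, ψ ^ a ∂F : ℝ) : ℂ)
  rw [mul_neg] at h2
  refine h2.congr_of_eventuallyEq ?_
  filter_upwards [Ioi_mem_nhds (half_lt_self hv)] with x hx
  have hx' : v / 2 ≤ x := le_of_lt hx
  rw [levyTail, intervalIntegral.integral_of_le hx', ← Ioc_union_Ioi_eq_Ioi hx',
    setIntegral_union (Ioc_disjoint_Ioi le_rfl) measurableSet_Ioi
      (hi.mono_set Ioc_subset_Ioi_self) (hi.mono_set (Ioi_subset_Ioi hx')), add_sub_cancel_left]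

lemma hasDerivAt_integral_kernel (hS : StableTier a c F) (w : ℝ) {v : ℝ} (hv : 0 < v) :
    HasDerivAt (fun v => ∫ x in (0 : ℝ)..v, kernel a c F w x) (kernel a c F w v) v := by
  refine intervalIntegral.integral_hasDerivAt_right
    ((intervalIntegrable_iff_integrableOn_Ioc_of_le hv.le).mpr
      ((hS.integrableOn_kernel w).mono_set (show Ioc 0 v ⊆ Ioi 0 from Ioc_subset_Ioi_self)))
    (StronglyMeasurable.stronglyMeasurableAtFilter ?_) (hS.continuousAt_kernel w hv)
  exact (hS.measurable_kernel.comp measurable_prodMk_left).stronglyMeasurable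

lemma tendsto_integral_kernel (hS : StableTier a c F) (w : ℝ) :
    Tendsto (fun v => ∫ x in (0 : ℝ)..v, kernel a c F w x) (𝓝[>] 0) (𝓝 0) := by
  have h := intervalIntegral.continuousWithinAt_primitive (a := 0) (b₀ := 0) (b₁ := 0) (b₂ := 1)
    (f := kernel a c F w) (μ := volume) (by simp) (by
      rw [min_self, max_eq_right zero_le_one]
      exact (intervalIntegrable_iff_integrableOn_Ioc_of_le zero_le_one).mpr
        ((hS.integrableOn_kernel w).mono_set Ioc_subset_Ioi_self))
  have h2 := (h.mono Ioc_subset_Icc_self).tendsto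
  rw [intervalIntegral.integral_same, nhdsWithin_Ioc_eq_nhdsGT zero_lt_one] at h2
  exact h2

end StableTier

lemma integral_eq_of_hasDerivAt_of_tendsto_zero {f f' : ℝ → ℂ} (hd : ∀ y,
    0 < y → HasDerivAt f (f' y) y)
    (hi : IntegrableOn f' (Ioi 0)) (h0 : Tendsto f (𝓝[>] 0) (𝓝 0)) {u : ℝ} (hu : 0 < u) :
    ∫ y in (0 : ℝ)..u, f' y = f u := by
  have h := intervalIntegral.integral_eq_sub_of_hasDerivAt_of_tendsto hu
    (fun y hy => hd y hy.1) ((intervalIntegrable_iff_integrableOn_Ioc_of_le hu.le).mpr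
      (hi.mono_set (show Ioc 0 u ⊆ Ioi 0 from Ioc_subset_Ioi_self))) h0
    ((hd u hu).continuousAt.tendsto.mono_left nhdsWithin_le_nhds)
  rw [h, sub_zero]

lemma tendsto_div_nhdsGT_zero {γ : ℝ} (hγ : 0 < γ) :
    Tendsto (fun u : ℝ => u / γ) (𝓝[>] 0) (𝓝[>] 0) := by
  refine tendsto_nhdsWithin_of_tendsto_nhds_of_eventually_within _ ?_ ?_
  · have : Tendsto (fun u : ℝ => u / γ) (𝓝 0) (𝓝 (0 / γ)) := tendsto_id.div_const γ
    rw [zero_div] at this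
    exact this.mono_left nhdsWithin_le_nhds
  · filter_upwards [self_mem_nhdsWithin] with u hu using div_pos hu hγ

lemma norm_exp_neg_I_mul (w t : ℝ) : ‖Complex.exp (-(Complex.I * w) * t)‖ = 1 := by
  rw [← norm_osc w t, osc, neg_mul]

lemma SpectralDensity.const_mul {D : ℝ → ℝ → ℂ} (hD : SpectralDensity D) (C : ℂ) :
    SpectralDensity fun w y => C * D w y :=
  hD.bounded_mul (B := fun _ _ => C) measurable_const fun _ _ _ _ => le_rfl

lemma StableTier.tendsto_exp_levy_add_levyTail {a c : ℝ} {F : Measure ℝ} (hS : StableTier a c F)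
    {w : ℝ} (hw : w ≠ 0) :
    Tendsto (fun v => Complex.exp (-(levy a c F w + levyTail a c F w v))) (𝓝[>] 0) (𝓝 0) := by
  have hm := mul_pos hS.int_pos hS.moment_pos
  refine squeeze_zero_norm' (a := fun v => Real.exp (-((c * ∫ ψ, ψ ^ a ∂F) * v ^ (-a)))) ?_ ?_
  · filter_upwards [self_mem_nhdsWithin] with v hv using hS.norm_exp_levy_add_levyTail_le hw hv
  · exact Real.tendsto_exp_neg_atTop_nhds_zero.comp
      ((tendsto_rpow_neg_nhdsGT_zero (neg_neg_of_pos hS.exp_pos)).const_mul_atTop hm)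

/-! ### Densities of the joint transforms in the level u. -/

namespace Params

variable {K L : ℕ} (p : Params K L)

/-- The factor of the transform of the total power that is common to all association rules. -/
noncomputable def background (w : ℝ) : ℂ :=
  Complex.exp (-(Complex.I * w) * p.noise) * ∏ l : Fin L, Complex.exp (-p.levy (Sum.inr l) w)

noncomputable def maxFactor (k : Fin K) (w u : ℝ) : ℂ :=
  Complex.exp (-(p.levy (Sum.inl k) w + p.levyTail (Sum.inl k) w (u / p.gam k)))

noncomputable def nearFactor (k : Fin K) (w u : ℝ) : ℂ :=
  ∫ x in (0 : ℝ)..(u / p.gam k), p.kernel (Sum.inl k) w x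

noncomputable def maxDensity (i : Fin K) (w y : ℝ) : ℂ :=
  (osc w (y / p.gam i) * (p.background w * ∏ k ∈ Finset.univ.erase i, p.maxFactor k w y)) *
    ((((y / p.gam i) ^ (-p.expo (Sum.inl i) - 1) : ℝ) : ℂ) * p.maxFactor i w y)

noncomputable def nearDensity (i : Fin K) (w y : ℝ) : ℂ :=
  (p.background w * ∏ k ∈ Finset.univ.erase i, p.nearFactor k w y) *
    (p.kernel (Sum.inl i) w (y / p.gam i) / p.gam i)

lemma measurable_background : Measurable p.background := by
  unfold background
  refine Measurable.mul (by fun_prop) (Finset.measurable_fun_prod _ fun l _ => ?_)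
  exact (StableTier.measurable_levy _ _ _).neg.cexp

lemma measurable_maxFactor (k : Fin K) : Measurable (Function.uncurry (p.maxFactor k)) := by
  have h1 : Measurable fun z : ℝ × ℝ => p.levy (Sum.inl k) z.1 :=
    (StableTier.measurable_levy _ _ _).comp measurable_fst
  have h2 : Measurable fun z : ℝ × ℝ => p.levyTail (Sum.inl k) z.1 (z.2 / p.gam k) :=
    (StableTier.measurable_levyTail (p.expo (Sum.inl k)) (p.intensity (Sum.inl k))
      (p.fading (Sum.inl k))).comp
      (by fun_prop : Measurable fun z : ℝ × ℝ => (z.1, z.2 / p.gam k))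
  exact (h1.add h2).neg.cexp

namespace Admissible

variable {p}

lemma norm_background_le_one (hp : p.Admissible) {w : ℝ} (hw : w ≠ 0) : ‖p.background w‖ ≤ 1 := by
  rw [background, norm_mul, norm_exp_neg_I_mul, one_mul, norm_prod]
  exact Finset.prod_le_one (fun _ _ => norm_nonneg _) fun l _ =>
    (hp.stableTier _).norm_exp_levy_le_one hw

lemma norm_maxFactor_le_one (hp : p.Admissible) (k : Fin K) {w u : ℝ} (hw : w ≠ 0) (hu : 0 < u) :
    ‖p.maxFactor k w u‖ ≤ 1 :=
  (hp.stableTier _).norm_exp_levy_add_levyTail_le_one hw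
    (div_pos hu (one_pos.trans (hp.one_lt_gam k)))

lemma spectralDensity_maxDensity (hp : p.Admissible) (i : Fin K) :
    SpectralDensity (p.maxDensity i) := by
  refine ((hp.stableTier (Sum.inl i)).spectralDensity_exp_levyTail.comp_div
    (hp.one_lt_gam i).le).bounded_mul (B := fun w y => osc w (y / p.gam i) *
      (p.background w * ∏ k ∈ Finset.univ.erase i, p.maxFactor k w y)) ?_ (M := 1)
    fun w hw y hy => ?_
  · have h1 : Measurable fun z : ℝ × ℝ => osc z.1 (z.2 / p.gam i) :=
      continuous_osc.measurable.comp
        (by fun_prop : Measurable fun z : ℝ × ℝ => (z.1, z.2 / p.gam i))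
    exact h1.mul ((p.measurable_background.comp measurable_fst).mul
      (Finset.measurable_fun_prod _ fun k _ => p.measurable_maxFactor k))
  · rw [norm_mul, norm_osc, one_mul, norm_mul, norm_prod]
    exact mul_le_one₀ (hp.norm_background_le_one hw) (Finset.prod_nonneg fun _ _ => norm_nonneg _)
      (Finset.prod_le_one (fun _ _ => norm_nonneg _) fun k _ => hp.norm_maxFactor_le_one k hw hy)

lemma measurable_nearFactor (hp : p.Admissible) (k : Fin K) :
    Measurable (Function.uncurry (p.nearFactor k)) :=
  (measurable_uncurry_intervalIntegral (hp.stableTier (Sum.inl k)).measurable_kernel).comp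
    (by fun_prop : Measurable fun z : ℝ × ℝ => (z.1, z.2 / p.gam k))

lemma exists_norm_nearFactor_le (hp : p.Admissible) (k : Fin K) :
    ∃ M, ∀ w, w ≠ 0 → ∀ u, 0 < u → ‖p.nearFactor k w u‖ ≤ M := by
  obtain ⟨M, hM⟩ := (hp.stableTier (Sum.inl k)).spectralDensity_kernel.exists_norm_integral_le
  exact ⟨M, fun w hw u hu => hM w hw _ (div_pos hu (one_pos.trans (hp.one_lt_gam k)))⟩

lemma spectralDensity_nearDensity (hp : p.Admissible) (i : Fin K) :
    SpectralDensity (p.nearDensity i) := by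
  choose M hM using hp.exists_norm_nearFactor_le
  have hD := ((hp.stableTier (Sum.inl i)).spectralDensity_kernel.comp_div
    (hp.one_lt_gam i).le).const_mul (p.gam i : ℂ)⁻¹
  simp only [inv_mul_eq_div] at hD
  refine hD.bounded_mul
    (B := fun w y => p.background w * ∏ k ∈ Finset.univ.erase i, p.nearFactor k w y) ?_
    (M := ∏ k ∈ Finset.univ.erase i, M k) fun w hw y hy => ?_
  · exact (p.measurable_background.comp measurable_fst).mul
      (Finset.measurable_fun_prod _ fun k _ => hp.measurable_nearFactor k)
  · rw [norm_mul, norm_prod]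
    exact (mul_le_of_le_one_left (Finset.prod_nonneg fun _ _ => norm_nonneg _)
      (hp.norm_background_le_one hw)).trans
      (Finset.prod_le_prod (fun _ _ => norm_nonneg _) fun k _ => hM k w hw y hy)

lemma hasDerivAt_maxFactor (hp : p.Admissible) (k : Fin K) (w : ℝ) {u : ℝ} (hu : 0 < u) :
    HasDerivAt (p.maxFactor k w) (((p.intensity (Sum.inl k) * p.moment (Sum.inl k) *
      p.expo (Sum.inl k) / p.gam k : ℝ) : ℂ) * (osc w (u / p.gam k) *
      ((((u / p.gam k) ^ (-p.expo (Sum.inl k) - 1) : ℝ) : ℂ) * p.maxFactor k w u))) u := by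
  have hv : 0 < u / p.gam k := div_pos hu (one_pos.trans (hp.one_lt_gam k))
  have h1 := ((hp.stableTier (Sum.inl k)).hasDerivAt_levyTail w hv).scomp u
    ((hasDerivAt_id u).div_const (p.gam k))
  refine (h1.const_add (p.levy (Sum.inl k) w)).neg.cexp.congr_deriv ?_
  simp only [Complex.real_smul, moment, maxFactor, levy, levyTail, Function.comp, id, Pi.neg_apply]
  push_cast
  ring

lemma hasDerivAt_nearFactor (hp : p.Admissible) (k : Fin K) (w : ℝ) {u : ℝ} (hu : 0 < u) :
    HasDerivAt (p.nearFactor k w) (p.kernel (Sum.inl k) w (u / p.gam k) / p.gam k) u := by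
  have hv : 0 < u / p.gam k := div_pos hu (one_pos.trans (hp.one_lt_gam k))
  have h1 := ((hp.stableTier (Sum.inl k)).hasDerivAt_integral_kernel w hv).scomp u
    ((hasDerivAt_id u).div_const (p.gam k))
  refine h1.congr_deriv ?_
  rw [Complex.real_smul, kernel]
  push_cast
  ring

/-- Each summand is one term of the product rule, and the transform vanishes as u → 0, so the
fundamental theorem applies on (0, u). -/
lemma integral_maxDensity [Nonempty (Fin K)] (hp : p.Admissible) {w u : ℝ} (hw : w ≠ 0)
    (hu : 0 < u) :
    ∫ y in (0 : ℝ)..u, ∑ i : Fin K, ((p.intensity (Sum.inl i) * p.moment (Sum.inl i) *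
      p.expo (Sum.inl i) / p.gam i : ℝ) : ℂ) * p.maxDensity i w y =
      p.background w * ∏ k : Fin K, p.maxFactor k w u := by
  refine integral_eq_of_hasDerivAt_of_tendsto_zero
    (f := fun u => p.background w * ∏ k : Fin K, p.maxFactor k w u) (fun y hy => ?_) ?_ ?_ hu
  · refine ((HasDerivAt.fun_finsetProd fun k _ =>
      hp.hasDerivAt_maxFactor k w hy).const_mul _).congr_deriv ?_
    rw [Finset.mul_sum]
    refine Finset.sum_congr rfl fun i _ => ?_
    rw [maxDensity, smul_eq_mul]
    ring
  · exact integrable_finsetSum _ fun i _ =>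
      ((hp.spectralDensity_maxDensity i).integrableOn_right hw).const_mul _
  · have h := tendsto_finsetProd (f := fun k u => p.maxFactor k w u) (a := fun _ => (0 : ℂ))
      (Finset.univ : Finset (Fin K)) fun k _ =>
      ((hp.stableTier (Sum.inl k)).tendsto_exp_levy_add_levyTail hw).comp
        (tendsto_div_nhdsGT_zero (one_pos.trans (hp.one_lt_gam k)))
    have := h.const_mul (p.background w)
    -- The limit 0^K is 0 because there is at least one open tier.
    rwa [Finset.prod_const, zero_pow Finset.univ_nonempty.card_ne_zero, mul_zero] at this

lemma hasDerivAt_nearTransform (hp : p.Admissible) (w : ℝ) {u : ℝ} (hu : 0 < u) :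
    HasDerivAt (fun u => p.background w * ∏ k : Fin K, p.nearFactor k w u)
      (∑ i : Fin K, p.nearDensity i w u) u := by
  refine ((HasDerivAt.fun_finsetProd fun k _ =>
    hp.hasDerivAt_nearFactor k w hu).const_mul _).congr_deriv ?_
  rw [Finset.mul_sum]
  refine Finset.sum_congr rfl fun i _ => ?_
  rw [nearDensity, smul_eq_mul]
  ring

lemma integral_nearDensity [Nonempty (Fin K)] (hp : p.Admissible) {w u : ℝ} (hw : w ≠ 0)
    (hu : 0 < u) :
    ∫ y in (0 : ℝ)..u, ∑ i : Fin K, p.nearDensity i w y =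
      p.background w * ∏ k : Fin K, p.nearFactor k w u := by
  refine integral_eq_of_hasDerivAt_of_tendsto_zero
    (f := fun u => p.background w * ∏ k : Fin K, p.nearFactor k w u)
    (fun y hy => hp.hasDerivAt_nearTransform w hy) ?_ ?_ hu
  · exact integrable_finsetSum _ fun i _ =>
      (hp.spectralDensity_nearDensity i).integrableOn_right hw
  · have h := tendsto_finsetProd (f := fun k u => p.nearFactor k w u) (a := fun _ => (0 : ℂ))
      (Finset.univ : Finset (Fin K)) fun k _ =>
      ((hp.stableTier (Sum.inl k)).tendsto_integral_kernel w).comp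
        (tendsto_div_nhdsGT_zero (one_pos.trans (hp.one_lt_gam k)))
    have := h.const_mul (p.background w)
    rwa [Finset.prod_const, zero_pow Finset.univ_nonempty.card_ne_zero, mul_zero] at this

lemma nearestFactor_eq_mul (hp : p.Admissible) (k : Fin K) {w u : ℝ} (hw : w ≠ 0) (hu : 0 < u) :
    nearestFactor p (Complex.I * w) k u =
      Complex.exp (p.levy (Sum.inl k) w) * p.nearFactor k w u :=
  hp.nearestFactor_eq k hw hu

/-- The derivative of the explicit transform under nearest-station association. -/
lemma explicitNearestDeriv_eq (hp : p.Admissible) {w u : ℝ} (hw : w ≠ 0) (hu : 0 < u) :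
    explicitNearestDeriv p (Complex.I * w) u = ∑ i : Fin K, p.nearDensity i w u := by
  rw [explicitNearestDeriv, hp.nearestPrefactor_eq hw, Finset.mul_sum]
  refine Finset.sum_congr rfl fun i _ => ?_
  rw [hp.nearestFactorDeriv_eq i hw hu, Finset.prod_congr rfl fun k _ =>
      hp.nearestFactor_eq_mul k hw hu,
    Finset.prod_mul_distrib, nearDensity, background,
    ← Finset.mul_prod_erase _ (fun k => Complex.exp (-p.levy (Sum.inl k) w)) (Finset.mem_univ i)]
  have h1 : Complex.exp (-p.levy (Sum.inl i) w) * Complex.exp (p.levy (Sum.inl i) w) = 1 := by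
    rw [← Complex.exp_add, neg_add_cancel, Complex.exp_zero]
  have h2 : (∏ k ∈ Finset.univ.erase i, Complex.exp (-p.levy (Sum.inl k) w)) *
      ∏ k ∈ Finset.univ.erase i, Complex.exp (p.levy (Sum.inl k) w) = 1 := by
    rw [← Finset.prod_mul_distrib]
    exact Finset.prod_eq_one fun k _ => by rw [← Complex.exp_add, neg_add_cancel, Complex.exp_zero]
  linear_combination (Complex.exp (-(Complex.I * w) * p.noise) *
    (∏ l : Fin L, Complex.exp (-p.levy (Sum.inr l) w)) *
    (∏ k ∈ Finset.univ.erase i, p.nearFactor k w u) *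
    (p.kernel (Sum.inl i) w (u / p.gam i) / p.gam i)) *
    ((∏ k ∈ Finset.univ.erase i, Complex.exp (-p.levy (Sum.inl k) w)) *
      (∏ k ∈ Finset.univ.erase i, Complex.exp (p.levy (Sum.inl k) w)) * h1 + h2)

lemma explicitNearest_eq (hp : p.Admissible) {w u : ℝ} (hw : w ≠ 0) (hu : 0 < u) :
    explicitNearest p (Complex.I * w) u = p.background w * ∏ k : Fin K, p.nearFactor k w u := by
  rw [explicitNearest, hp.nearestPrefactor_eq hw,
    Finset.prod_congr rfl fun k _ => hp.nearestFactor_eq_mul k hw hu, Finset.prod_mul_distrib,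
        background]
  have h2 : (∏ k : Fin K, Complex.exp (-p.levy (Sum.inl k) w)) *
      ∏ k : Fin K, Complex.exp (p.levy (Sum.inl k) w) = 1 := by
    rw [← Finset.prod_mul_distrib]
    exact Finset.prod_eq_one fun k _ => by rw [← Complex.exp_add, neg_add_cancel, Complex.exp_zero]
  linear_combination (Complex.exp (-(Complex.I * w) * p.noise) *
    (∏ l : Fin L, Complex.exp (-p.levy (Sum.inr l) w)) * (∏ k, p.nearFactor k w u)) * h2

/-- The logarithmic derivative of the explicit transform under nearest-station association. -/
lemma explicitNearestDeriv_div (hp : p.Admissible) {w u : ℝ} (hw : w ≠ 0) (hu : 0 < u)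
    (h0 : explicitNearest p (Complex.I * w) u ≠ 0) :
    explicitNearestDeriv p (Complex.I * w) u / explicitNearest p (Complex.I * w) u =
      ∑ k : Fin K, nearestNum p (Complex.I * w) k u / nearestDen p (Complex.I * w) k u := by
  rw [explicitNearest] at h0
  have hA := left_ne_zero_of_mul h0
  have hF := Finset.prod_ne_zero_iff.mp (right_ne_zero_of_mul h0)
  rw [explicitNearestDeriv, explicitNearest, mul_div_mul_left _ _ hA, Finset.sum_div]
  refine Finset.sum_congr rfl fun k _ => ?_
  have hk := hF k (Finset.mem_univ k)
  rw [← Finset.mul_prod_erase _ _ (Finset.mem_univ k), mul_div_mul_right _ _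
    (Finset.prod_ne_zero_iff.mpr fun l _ => hF l (Finset.mem_univ l))]
  rw [hp.nearestDen_eq k hw hu] at hk ⊢
  rw [nearestFactorDeriv, mul_div_mul_left _ _ (left_ne_zero_of_mul hk)]

end Admissible

end Params

/-! ### The coverage probabilities. -/

section

variable {Ω : Type*} [MeasurableSpace Ω] {μ : Measure Ω} {K L : ℕ} [IsProbabilityMeasure μ]
  {p : Params K L} {X : Tier K L → ℕ → Ω → Plane} {Ψ : Tier K L → ℕ → Ω → ℝ} [Nonempty (Fin K)]

/-- The inversion formula is linear in the density; every summand is absolutely integrable on its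
own, so the sum may leave both integrals. -/
lemma Params.Admissible.sum_mul_density (hp : p.Admissible) (C : Fin K → ℂ) {D : Fin K → ℝ → ℝ → ℂ}
    (hD : ∀ i, SpectralDensity (D i)) {J Y : Ω → ℝ} (hJ : AEMeasurable J μ) (hY : AEMeasurable Y μ)
    (hpos : ∀ᵐ ω ∂μ, 0 < Y ω) (hlt : ∀ᵐ ω ∂μ, Y ω / p.kap + p.noise < J ω)
    (h : ∀ w : ℝ, w ≠ 0 → ∀ u : ℝ, 0 < u →
      ∫ ω, {ω' | Y ω' ≤ u}.indicator (fun ω' => Complex.exp (-(Complex.I * w) * J ω')) ω ∂μ =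
        ∫ y in (0 : ℝ)..u, ∑ i, C i * D i w y) :
    (μ.real {ω | J ω < Y ω} : ℂ) = ∑ i, C i *
      ∫ y in Ioi (0 : ℝ), ∫ w, D i w y * fourierKernel (y / p.kap + p.noise) y w := by
  have hκ := hp.one_le_kap
  rw [measureReal_lt_eq_integral (D := fun w y => ∑ i, C i * D i w y) hJ hY hpos hlt
    (integrable_finsetSum Finset.univ fun i _ => (hD i).integrable.const_mul (C i)) ?_ h]
  · have e : ∀ y ∈ Ioi (0 : ℝ), ∫ w, (∑ i, C i * D i w y) * fourierKernel (y / p.kap +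
        p.noise) y w =
        ∑ i, C i * ∫ w, D i w y * fourierKernel (y / p.kap + p.noise) y w := fun y hy => by
      simp_rw [Finset.sum_mul, mul_assoc]
      rw [integral_finsetSum _ fun i _ =>
        ((hD i).integrable_mul_kernel_right hκ hp.noise_nonneg hy).const_mul (C i)]
      simp_rw [integral_const_mul]
    rw [setIntegral_congr_fun measurableSet_Ioi e, integral_finsetSum _ fun i _ =>
        ((hD i).integrableOn_integral_mul_kernel hκ hp.noise_nonneg).const_mul (C i)]
    simp_rw [integral_const_mul]
  · simp_rw [Finset.sum_mul, mul_assoc]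
    exact integrable_finsetSum _ fun i _ =>
      ((hD i).integrable_mul_kernel hκ hp.noise_nonneg).const_mul (C i)

namespace IsNetwork

lemma jointLT_maxBest_eq_prod (hp : p.Admissible) (hnet : IsNetwork p μ X Ψ) {w u : ℝ} (hw : w ≠ 0)
    (hu : 0 < u) : jointLT p X Ψ μ (maxBest p X Ψ) (Complex.I * w) u =
      p.background w * ∏ k : Fin K, p.maxFactor k w u := by
  rw [hnet.jointLT_maxBest_eq hp hw hu, Params.background, mul_right_comm, mul_assoc]
  rfl

lemma jointLT_maxNearest_eq_prod (hp : p.Admissible) (hnet : IsNetwork p μ X Ψ) {w u : ℝ}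
    (hw : w ≠ 0) (hu : 0 < u) : jointLT p X Ψ μ (maxNearest p X Ψ) (Complex.I * w) u =
      p.background w * ∏ k : Fin K, p.nearFactor k w u := by
  rw [hnet.jointLT_maxNearest_eq hp hw hu, Params.background, mul_right_comm, mul_assoc]
  rfl

lemma hasDerivAt_jointLT_maxNearest (hp : p.Admissible) (hnet : IsNetwork p μ X Ψ) {w u : ℝ}
    (hw : w ≠ 0) (hu : 0 < u) :
    HasDerivAt (fun v : ℝ => jointLT p X Ψ μ (maxNearest p X Ψ) (Complex.I * w) v)
      (∑ i : Fin K, p.nearDensity i w u) u := by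
  refine (hp.hasDerivAt_nearTransform w hu).congr_of_eventuallyEq ?_
  filter_upwards [Ioi_mem_nhds hu] with v hv using hnet.jointLT_maxNearest_eq_prod hp hw hv

/-- The density contributes exp(-iwy/γ_i), which shifts both exponents in the kernel by y/γ_i, and
(y/γ_i)^(-a-1), which is y^(-1-a) up to a power of γ_i. -/
lemma maxIntegrand_eq (hp : p.Admissible) (hnet : IsNetwork p μ X Ψ) (i : Fin K) {y w : ℝ}
    (hy : 0 < y) (hw : w ≠ 0) : maxIntegrand p μ X Ψ i y w =
      ((p.gam i ^ (-(1 + p.expo (Sum.inl i))) : ℝ) : ℂ) *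
        (p.maxDensity i w y * fourierKernel (y / p.kap + p.noise) y w) := by
  have hγ := one_pos.trans (hp.one_lt_gam i)
  have e1 : (y ^ (1 + p.expo (Sum.inl i)))⁻¹ = p.gam i ^ (-(1 + p.expo (Sum.inl i))) *
      (y / p.gam i) ^ (-p.expo (Sum.inl i) - 1) := by
    rw [show -p.expo (Sum.inl i) - 1 = -(1 + p.expo (Sum.inl i)) by ring,
      ← Real.mul_rpow hγ.le (by positivity), mul_div_cancel₀ _ hγ.ne', Real.rpow_neg hy.le]
  have e2 : Complex.exp (Complex.I * w * (y * (1 - (p.gam i)⁻¹) : ℝ)) -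
      Complex.exp (Complex.I * w * (p.noise + y * (p.kap⁻¹ - (p.gam i)⁻¹) : ℝ)) =
      osc w (y / p.gam i) * (Complex.exp (Complex.I * w * y) -
        Complex.exp (Complex.I * w * (y / p.kap + p.noise : ℝ))) := by
    rw [osc, mul_sub (Complex.exp _), ← Complex.exp_add, ← Complex.exp_add]
    congr 2 <;> push_cast <;> ring
  rw [maxIntegrand, hnet.jointLT_maxBest_eq_prod hp hw hy, e2, div_mul_eq_div_div, div_eq_mul_inv,
    ← Complex.ofReal_inv, e1, Params.maxDensity, fourierKernel,
    ← Finset.mul_prod_erase _ _ (Finset.mem_univ i)]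
  push_cast
  ring

lemma nearestCovIntegrand_eq (hp : p.Admissible) (hnet : IsNetwork p μ X Ψ) {y w : ℝ}
    (hy : 0 < y) (hw : w ≠ 0) : nearestCovIntegrand p μ X Ψ y w =
      ∑ i, p.nearDensity i w y * fourierKernel (y / p.kap + p.noise) y w := by
  rw [nearestCovIntegrand, (hnet.hasDerivAt_jointLT_maxNearest hp hw hy).deriv, ← Finset.sum_mul,
    fourierKernel]
  congr 2
  ring

lemma maxIntegrand_ae_eq (hp : p.Admissible) (hnet : IsNetwork p μ X Ψ) (i : Fin K) {y : ℝ}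
    (hy : 0 < y) : maxIntegrand p μ X Ψ i y =ᵐ[volume] fun w =>
      ((p.gam i ^ (-(1 + p.expo (Sum.inl i))) : ℝ) : ℂ) *
        (p.maxDensity i w y * fourierKernel (y / p.kap + p.noise) y w) := by
  filter_upwards [Measure.ae_ne volume (0 : ℝ)] with w hw using hnet.maxIntegrand_eq hp i hy hw

lemma nearestCovIntegrand_ae_eq (hp : p.Admissible) (hnet : IsNetwork p μ X Ψ) {y : ℝ}
    (hy : 0 < y) : nearestCovIntegrand p μ X Ψ y =ᵐ[volume] fun w =>
      ∑ i, p.nearDensity i w y * fourierKernel (y / p.kap + p.noise) y w := by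
  filter_upwards [Measure.ae_ne volume (0 : ℝ)] with w hw using hnet.nearestCovIntegrand_eq hp hy hw

lemma integrable_maxIntegrand (hp : p.Admissible) (hnet : IsNetwork p μ X Ψ) (i : Fin K) {y : ℝ}
    (hy : 0 < y) : Integrable fun w => maxIntegrand p μ X Ψ i y w :=
  (((hp.spectralDensity_maxDensity i).integrable_mul_kernel_right hp.one_le_kap hp.noise_nonneg
    hy).const_mul _).congr (hnet.maxIntegrand_ae_eq hp i hy).symm

lemma integral_maxIntegrand (hp : p.Admissible) (hnet : IsNetwork p μ X Ψ) (i : Fin K) {y : ℝ}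
    (hy : 0 < y) : ∫ w, maxIntegrand p μ X Ψ i y w =
      ((p.gam i ^ (-(1 + p.expo (Sum.inl i))) : ℝ) : ℂ) *
        ∫ w, p.maxDensity i w y * fourierKernel (y / p.kap + p.noise) y w := by
  rw [integral_congr_ae (hnet.maxIntegrand_ae_eq hp i hy), integral_const_mul]

lemma integrableOn_integral_maxIntegrand (hp : p.Admissible) (hnet : IsNetwork p μ X Ψ)
    (i : Fin K) : IntegrableOn (fun y => ∫ w, maxIntegrand p μ X Ψ i y w) (Ioi 0) :=
  IntegrableOn.congr_fun (((hp.spectralDensity_maxDensity i).integrableOn_integral_mul_kernel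
    hp.one_le_kap hp.noise_nonneg).const_mul _)
    (fun _ hy => (hnet.integral_maxIntegrand hp i hy).symm) measurableSet_Ioi

lemma integrable_nearestCovIntegrand (hp : p.Admissible) (hnet : IsNetwork p μ X Ψ) {y : ℝ}
    (hy : 0 < y) : Integrable fun w => nearestCovIntegrand p μ X Ψ y w :=
  (integrable_finsetSum _ fun i _ => (hp.spectralDensity_nearDensity i).integrable_mul_kernel_right
    hp.one_le_kap hp.noise_nonneg hy).congr (hnet.nearestCovIntegrand_ae_eq hp hy).symm

lemma integral_nearestCovIntegrand (hp : p.Admissible) (hnet : IsNetwork p μ X Ψ) {y : ℝ}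
    (hy : 0 < y) : ∫ w, nearestCovIntegrand p μ X Ψ y w =
      ∑ i, ∫ w, p.nearDensity i w y * fourierKernel (y / p.kap + p.noise) y w := by
  rw [integral_congr_ae (hnet.nearestCovIntegrand_ae_eq hp hy), integral_finsetSum _ fun i _ =>
    (hp.spectralDensity_nearDensity i).integrable_mul_kernel_right hp.one_le_kap hp.noise_nonneg hy]

lemma integrableOn_integral_nearestCovIntegrand (hp : p.Admissible) (hnet : IsNetwork p μ X Ψ) :
    IntegrableOn (fun y => ∫ w, nearestCovIntegrand p μ X Ψ y w) (Ioi 0) :=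
  IntegrableOn.congr_fun (integrable_finsetSum _ fun i _ =>
    (hp.spectralDensity_nearDensity i).integrableOn_integral_mul_kernel hp.one_le_kap
      hp.noise_nonneg) (fun _ hy => (hnet.integral_nearestCovIntegrand hp hy).symm)
          measurableSet_Ioi

theorem coverageMaxSINR_eq (hp : p.Admissible) (hnet : IsNetwork p μ X Ψ) :
    (coverageMaxSINR p X Ψ μ : ℂ) = ∑ i : Fin K,
      ((p.dens (Sum.inl i) * (2 * Real.pi / p.ple (Sum.inl i)) *
        (p.gam i * p.pow (Sum.inl i)) ^ p.expo (Sum.inl i) * p.moment (Sum.inl i) : ℝ) : ℂ) *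
      ∫ y in Ioi (0 : ℝ), ∫ w, maxIntegrand p μ X Ψ i y w := by
  have hreg := hnet.ae_isRegular hp
  have h1 : coverageMaxSINR p X Ψ μ = μ.real {ω | total p X Ψ ω < maxBest p X Ψ ω} :=
    measureReal_congr (by
      filter_upwards [hreg] with ω h using propext (h.exists_thr_lt_sinr_iff hp))
  rw [h1, hp.sum_mul_density (fun i => ((p.intensity (Sum.inl i) * p.moment (Sum.inl i) *
      p.expo (Sum.inl i) / p.gam i : ℝ) : ℂ)) hp.spectralDensity_maxDensity
    (hnet.aemeasurable_total hp) (hnet.measurable_maxBest hp).aemeasurable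
    (hreg.mono fun ω h => (h.maxNearest_pos hp).trans_le (h.maxNearest_le_maxBest hp))
    (hreg.mono fun ω h => h.maxBest_lt hp)
    fun w hw u hu => (hnet.jointLT_maxBest_eq_prod hp hw hu).trans
      (hp.integral_maxDensity hw hu).symm]
  refine Finset.sum_congr rfl fun i _ => ?_
  have hγ := one_pos.trans (hp.one_lt_gam i)
  rw [setIntegral_congr_fun measurableSet_Ioi fun y hy => hnet.integral_maxIntegrand hp i hy,
    integral_const_mul, ← mul_assoc, ← Complex.ofReal_mul]
  congr 2
  -- The factor 1/γ from the chain rule and γ^(1+a) from the rescaled power of y combine to γ^a.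
  rw [Real.mul_rpow hγ.le (hp.pow_pos _).le, Params.intensity, neg_add, Real.rpow_add hγ,
    Real.rpow_neg hγ.le, Real.rpow_neg hγ.le,
    Real.rpow_one]
  have h2 : p.expo (Sum.inl i) = 2 / p.ple (Sum.inl i) := rfl
  have h3 : p.gam i ^ p.expo (Sum.inl i) ≠ 0 := (Real.rpow_pos_of_pos hγ _).ne'
  have h4 := (two_pos.trans (hp.ple_gt_two (Sum.inl i))).ne'
  generalize p.gam i ^ p.expo (Sum.inl i) = A at h3 ⊢
  generalize p.pow (Sum.inl i) ^ p.expo (Sum.inl i) = B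
  rw [h2]
  field_simp

theorem coverageNearest_eq (hp : p.Admissible) (hnet : IsNetwork p μ X Ψ) :
    (coverageNearest p X Ψ μ : ℂ) =
      ∫ y in Ioi (0 : ℝ), ∫ w, nearestCovIntegrand p μ X Ψ y w := by
  have hreg := hnet.ae_isRegular hp
  have h1 : coverageNearest p X Ψ μ = μ.real {ω | total p X Ψ ω < maxNearest p X Ψ ω} :=
    measureReal_congr (by
      filter_upwards [hreg] with ω h using propext (h.exists_thr_lt_sinr_zero_iff hp))
  rw [h1, hp.sum_mul_density (fun _ => 1) hp.spectralDensity_nearDensity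
    (hnet.aemeasurable_total hp) (hnet.measurable_maxNearest hp).aemeasurable
    (hreg.mono fun ω h => h.maxNearest_pos hp) (hreg.mono fun ω h => h.maxNearest_lt hp)
    fun w hw u hu => (hnet.jointLT_maxNearest_eq_prod hp hw hu).trans (by
      simp only [one_mul, hp.integral_nearDensity hw hu])]
  rw [setIntegral_congr_fun measurableSet_Ioi fun y hy => hnet.integral_nearestCovIntegrand hp hy,
    integral_finsetSum _ fun i _ =>
        (hp.spectralDensity_nearDensity i).integrableOn_integral_mul_kernel
      hp.one_le_kap hp.noise_nonneg]
  simp only [one_mul]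

end IsNetwork

end

end HetNet

end

theorem mainTheorem1 {K L : ℕ} (hK : 0 < K) (p : HetNet.Params K L) (hp : p.Admissible)
    {Ω : Type*} [MeasurableSpace Ω] (μ : Measure Ω) [IsProbabilityMeasure μ]
    (X : HetNet.Tier K L → ℕ → Ω → HetNet.Plane) (Ψ : HetNet.Tier K L → ℕ → Ω → ℝ)
    (hnet : HetNet.IsNetwork p μ X Ψ) :
    -- the received powers are almost surely summable
    (∀ t, ∀ᵐ ω ∂μ, Summable (fun n => HetNet.rx p X Ψ t n ω)) ∧
    -- max-SINR connectivity: the iterated integrals converge absolutely, and the formula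
    ((∀ i, ∀ y : ℝ, 0 < y → Integrable (fun w => HetNet.maxIntegrand p μ X Ψ i y w)) ∧
      (∀ i, IntegrableOn (fun y => ∫ w, HetNet.maxIntegrand p μ X Ψ i y w) (Set.Ioi 0)) ∧
      (HetNet.coverageMaxSINR p X Ψ μ : ℂ) =
        ∑ i : Fin K,
          ((p.dens (Sum.inl i) * (2 * Real.pi / p.ple (Sum.inl i)) *
            (p.gam i * p.pow (Sum.inl i)) ^ p.expo (Sum.inl i) * p.moment (Sum.inl i) : ℝ) : ℂ) *
          ∫ y in Set.Ioi (0 : ℝ), ∫ w, HetNet.maxIntegrand p μ X Ψ i y w) ∧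
    -- explicit form of the joint Laplace transform in the max-SINR formula
    (∀ w u : ℝ, w ≠ 0 → 0 < u →
      HetNet.jointLT p X Ψ μ (HetNet.maxBest p X Ψ) (Complex.I * w) u =
        HetNet.explicitMax p (Complex.I * w) u) ∧
    -- nearest-BS connectivity: the iterated integrals converge absolutely, and the formula
    ((∀ y : ℝ, 0 < y → Integrable (fun w => HetNet.nearestCovIntegrand p μ X Ψ y w)) ∧
      IntegrableOn (fun y => ∫ w, HetNet.nearestCovIntegrand p μ X Ψ y w) (Set.Ioi 0) ∧
      (HetNet.coverageNearest p X Ψ μ : ℂ) =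
        ∫ y in Set.Ioi (0 : ℝ), ∫ w, HetNet.nearestCovIntegrand p μ X Ψ y w) ∧
    -- explicit form of the joint Laplace transform in the nearest-BS formula, of its derivative,
    -- and of its logarithmic derivative where it does not vanish
    (∀ w u : ℝ, w ≠ 0 → 0 < u →
      HetNet.jointLT p X Ψ μ (HetNet.maxNearest p X Ψ) (Complex.I * w) u =
        HetNet.explicitNearest p (Complex.I * w) u ∧
      HasDerivAt
        (fun v : ℝ => HetNet.jointLT p X Ψ μ (HetNet.maxNearest p X Ψ) (Complex.I * w) v)
        (HetNet.explicitNearestDeriv p (Complex.I * w) u) u ∧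
      (HetNet.jointLT p X Ψ μ (HetNet.maxNearest p X Ψ) (Complex.I * w) u ≠ 0 →
        deriv (fun v : ℝ => HetNet.jointLT p X Ψ μ (HetNet.maxNearest p X Ψ) (Complex.I * w) v) u /
            HetNet.jointLT p X Ψ μ (HetNet.maxNearest p X Ψ) (Complex.I * w) u =
          ∑ k : Fin K, HetNet.nearestNum p (Complex.I * w) k u /
            HetNet.nearestDen p (Complex.I * w) k u)) := by
  have : Nonempty (Fin K) := Fin.pos_iff_nonempty.mp hK
  have hB : ∀ w u : ℝ, w ≠ 0 → 0 < u →
      HetNet.jointLT p X Ψ μ (HetNet.maxNearest p X Ψ) (Complex.I * w) u =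
        HetNet.explicitNearest p (Complex.I * w) u := fun w u hw hu =>
    (hnet.jointLT_maxNearest_eq_prod hp hw hu).trans (hp.explicitNearest_eq hw hu).symm
  have hD : ∀ w u : ℝ, w ≠ 0 → 0 < u → HasDerivAt
      (fun v : ℝ => HetNet.jointLT p X Ψ μ (HetNet.maxNearest p X Ψ) (Complex.I * w) v)
      (HetNet.explicitNearestDeriv p (Complex.I * w) u) u := fun w u hw hu => by
    rw [hp.explicitNearestDeriv_eq hw hu]
    exact hnet.hasDerivAt_jointLT_maxNearest hp hw hu
  refine ⟨fun t => (hnet.ae_summable hp).mono fun ω h => h t,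
    ⟨fun i y hy => hnet.integrable_maxIntegrand hp i hy,
      fun i => hnet.integrableOn_integral_maxIntegrand hp i, hnet.coverageMaxSINR_eq hp⟩,
    fun w u hw hu => (hnet.jointLT_maxBest_eq hp hw hu).trans (hp.explicitMax_eq hw hu).symm,
    ⟨fun y hy => hnet.integrable_nearestCovIntegrand hp hy,
      hnet.integrableOn_integral_nearestCovIntegrand hp, hnet.coverageNearest_eq hp⟩,
    fun w u hw hu => ⟨hB w u hw hu, hD w u hw hu, fun h0 => ?_⟩⟩
  rw [(hD w u hw hu).deriv, hB w u hw hu]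
  exact hp.explicitNearestDeriv_div hw hu (by rwa [← hB w u hw hu])
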